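/- Let $M$ be a complex manifold (Hausdorff, second countable) with a Hermitian metric $g$, i.e. a smooth Riemannian metric for which the complex structure is an isometry. Let $\Lambda^{p,q}$ and $\Lambda^k_{\mathbb C}$ be the bundles of $(p,q)$-forms and of complex $k$-forms on $M$, and $L^2\Lambda^{p,q}$, $L^2\Lambda^k_{\mathbb C}$ the Hilbert spaces of their square-integrable sections, with respect to the Hermitian metric on forms and the Riemannian measure induced by $g$; spaces of forms with a negative index are $0$. For a differential operator $P$ between two such bundles (or sums of them), with formal adjoint $P^*$, let $P_s$ be the closure in $L^2$ of $P$ acting on smooth compactly supported sections, and let $P_w$ be its weak extension: $P_wu=v$ if $u,v$ are in $L^2$ and $\langle v,w\rangle=\langle u,P^*w\rangle$ for all smooth compactly supported sections $w$. Consider the reduced $L^2$ cohomology spaces $$L^2\bar H^{p,q}_{\partial,sw}=\frac{\ker\partial_w}{\overline{\operatorname{im}\partial_s}},\qquad L^2\bar H^{p,q}_{\bar\partial,sw}=\frac{\ker\bar\partial_w}{\overline{\operatorname{im}\bar\partial_s}},\qquad L^2\bar H^{k}_{dR,sw}=\frac{\ker d_w}{\overline{\operatorname{im}d_s}},$$ $$L^2\bar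 H^{p,q}_{BC,sw}=\frac{\ker(\partial+\bar\partial)_w}{\overline{\operatorname{im}(\partial\bar\partial)_s}},\qquad L^2\bar H^{p,q}_{A,sw}=\frac{\ker(\partial\bar\partial)_w}{\overline{\operatorname{im}(\bar\partial\oplus\partial)_s}},$$ where kernels and closures of images are taken in $L^2\Lambda^{p,q}$, respectively $L^2\Lambda^k_{\mathbb C}$, where $\partial+\bar\partial$ maps $(p,q)$-forms to sections of $\Lambda^{p+1,q}\oplus\Lambda^{p,q+1}$, and where $\bar\partial\oplus\partial$ maps a pair $(a,b)$ of sections of $\Lambda^{p,q-1}$ and $\Lambda^{p-1,q}$ to $\bar\partial a+\partial b$. Then for all integers $p,q\ge0$ and $k\ge 0$ the identity on representatives induces well-defined linear maps $$L^2\bar H^{p,q}_{BC,sw}\to L^2\bar H^{p,q}_{\partial,sw},\qquad L^2\bar H^{p,q}_{BC,sw}\to L^2\bar H^{p,q}_{\bar\partial,sw},\qquad L^2\bar H^{p,q}_{BC,sw}\to L^2\bar H^{p+q}_{dR,sw},$$ $$L^2\bar H^{p,q}_{\partial,sw}\to L^2\bar H^{p,q}_{A,sw},\qquad L^2\bar H^{p,q}_{\bar\partial,sw}\to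 L^2\bar H^{p,q}_{A,sw},\qquad L^2\bar H^{k}_{dR,sw}\to\bigoplus_{p+q=k}L^2\bar H^{p,q}_{A,sw},$$ the last one sending the class of $\alpha=\sum_{p+q=k}\alpha^{p,q}$, $\alpha^{p,q}\in L^2\Lambda^{p,q}$, to the classes of its components $\alpha^{p,q}$. The diagram they form commutes: the composites $L^2\bar H^{p,q}_{BC,sw}\to L^2\bar H^{p,q}_{A,sw}$ through $\partial$-cohomology and through $\bar\partial$-cohomology are equal, and the composite $L^2\bar H^{p,q}_{BC,sw}\to L^2\bar H^{p+q}_{dR,sw}\to\bigoplus_{p'+q'=p+q}L^2\bar H^{p',q'}_{A,sw}$ is this same map followed by the inclusion of the summand $(p,q)$. -/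

import Mathlib

open scoped Manifold ContDiff

namespace L2Hodge

noncomputable section

section Pointwise

/-- The sesquilinear form `∑ N_{i₁j₁} ⋯ N_{i_kj_k} conj(f_{i₁…i_k}) h_{j₁…j_k}` on arrays of complex
numbers with `k` indices. -/
def tensorInner {m k : ℕ} (N : Matrix (Fin m) (Fin m) ℝ) (f h : (Fin k → Fin m) → ℂ) : ℂ :=
  ∑ I, ∑ J, ((∏ a, N (I a) (J a) : ℝ) : ℂ) * (starRingEnd ℂ (f I) * h J)

theorem tensorInner_add {m k : ℕ} (N : Matrix (Fin m) (Fin m) ℝ) (f f' h : (Fin k → Fin m) → ℂ) :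
    tensorInner N (f + f') h = tensorInner N f h + tensorInner N f' h := by
  simp only [tensorInner, ← Finset.sum_add_distrib, Pi.add_apply, map_add]
  refine Finset.sum_congr rfl fun I _ => Finset.sum_congr rfl fun J _ => ?_
  ring

theorem tensorInner_smul {m k : ℕ} (N : Matrix (Fin m) (Fin m) ℝ) (c : ℂ)
    (f h : (Fin k → Fin m) → ℂ) :
    tensorInner N (c • f) h = starRingEnd ℂ c * tensorInner N f h := by
  simp only [tensorInner, Finset.mul_sum, Pi.smul_apply, smul_eq_mul, map_mul]
  refine Finset.sum_congr rfl fun I _ => Finset.sum_congr rfl fun J _ => ?_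
  ring

theorem tensorInner_symm {m k : ℕ} {N : Matrix (Fin m) (Fin m) ℝ} (hN : N.IsSymm)
    (f h : (Fin k → Fin m) → ℂ) :
    starRingEnd ℂ (tensorInner N h f) = tensorInner N f h := by
  simp only [tensorInner, map_sum, map_mul, Complex.conj_ofReal, Complex.conj_conj]
  rw [Finset.sum_comm]
  refine Finset.sum_congr rfl fun I _ => Finset.sum_congr rfl fun J _ => ?_
  have : ∏ a, N (J a) (I a) = ∏ a, N (I a) (J a) :=
    Finset.prod_congr rfl fun a _ => hN.apply _ _
  rw [this]; ring

theorem tensorInner_change {m n k : ℕ} (N : Matrix (Fin n) (Fin n) ℝ)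
    (A : Matrix (Fin m) (Fin n) ℝ)
    (f h : (Fin k → Fin m) → ℂ) :
    tensorInner N (fun I => ∑ K : Fin k → Fin m, ((∏ a, A (K a) (I a) : ℝ) : ℂ) * f K)
      (fun I => ∑ K : Fin k → Fin m, ((∏ a, A (K a) (I a) : ℝ) : ℂ) * h K) =
      tensorInner (A * N * A.transpose) f h := by
  have key : ∀ K L : Fin k → Fin m, ∏ a, (A * N * A.transpose) (K a) (L a) =
      ∑ I : Fin k → Fin n, ∑ J : Fin k → Fin n,
        (∏ a, N (I a) (J a)) * (∏ a, A (K a) (I a)) * (∏ a, A (L a) (J a)) := by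
    intro K L
    have h1 : ∀ a, (A * N * A.transpose) (K a) (L a) =
        ∑ z : Fin n × Fin n, N z.1 z.2 * A (K a) z.1 * A (L a) z.2 := by
      intro a
      simp only [Matrix.mul_apply, Matrix.transpose_apply, Fintype.sum_prod_type, Finset.sum_mul]
      rw [Finset.sum_comm]
      refine Finset.sum_congr rfl fun _ _ => Finset.sum_congr rfl fun _ _ => ?_
      ring
    simp only [h1]
    rw [Finset.prod_univ_sum, Fintype.piFinset_univ]
    rw [← Fintype.sum_prod_type' (f := fun (I J : Fin k → Fin n) =>
      (∏ a, N (I a) (J a)) * (∏ a, A (K a) (I a)) * (∏ a, A (L a) (J a)))]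
    refine Fintype.sum_equiv (Equiv.arrowProdEquivProdArrow (Fin k) (fun _ => Fin n)
      (fun _ => Fin n))
      _ _ fun z => ?_
    simp [Finset.prod_mul_distrib, Equiv.arrowProdEquivProdArrow]
  simp only [tensorInner, key, map_sum, map_mul, Complex.conj_ofReal, Complex.ofReal_sum,
    Complex.ofReal_mul, Finset.sum_mul, Finset.mul_sum]
  have swap : ∀ F : (Fin k → Fin n) → (Fin k → Fin n) → (Fin k → Fin m) → (Fin k → Fin m) → ℂ,
      ∑ I, ∑ J, ∑ L, ∑ K, F I J K L = ∑ K, ∑ L, ∑ I, ∑ J, F I J K L := by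
    intro F
    calc ∑ I, ∑ J, ∑ L, ∑ K, F I J K L
        = ∑ I, ∑ L, ∑ J, ∑ K, F I J K L :=
          Finset.sum_congr rfl fun _ _ => Finset.sum_comm
      _ = ∑ L, ∑ I, ∑ J, ∑ K, F I J K L := Finset.sum_comm
      _ = ∑ L, ∑ I, ∑ K, ∑ J, F I J K L :=
          Finset.sum_congr rfl fun _ _ => Finset.sum_congr rfl fun _ _ => Finset.sum_comm
      _ = ∑ L, ∑ K, ∑ I, ∑ J, F I J K L :=
          Finset.sum_congr rfl fun _ _ => Finset.sum_comm
      _ = _ := Finset.sum_comm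
  rw [swap]
  refine Finset.sum_congr rfl fun K _ => Finset.sum_congr rfl fun L _ =>
    Finset.sum_congr rfl fun I _ => Finset.sum_congr rfl fun J _ => ?_
  ring

theorem tensorInner_nonneg {m k : ℕ} {N : Matrix (Fin m) (Fin m) ℝ} (hN : N.PosSemidef)
    (f : (Fin k → Fin m) → ℂ) : 0 ≤ (tensorInner N f f).re := by
  obtain ⟨n, v, hv⟩ := Matrix.posSemidef_iff_eq_sum_vecMulVec.1 hN
  have hN' : N = (Matrix.of fun j i => v i j) * (1 : Matrix (Fin n) (Fin n) ℝ) *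
      (Matrix.of fun j i => v i j).transpose := by
    rw [hv, Matrix.mul_one]
    ext i j
    simp [Matrix.mul_apply, Matrix.sum_apply, Matrix.vecMulVec_apply]
  rw [hN', ← tensorInner_change]
  unfold tensorInner
  have h1 : ∀ I J : Fin k → Fin n, (∏ a, (1 : Matrix (Fin n) (Fin n) ℝ) (I a) (J a)) =
      if I = J then 1 else 0 := by
    intro I J
    split_ifs with h
    · subst h; simp
    · obtain ⟨a, ha⟩ := Function.ne_iff.1 h
      exact Finset.prod_eq_zero (Finset.mem_univ a) (Matrix.one_apply_ne ha)
  simp only [h1, Complex.re_sum]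
  refine Finset.sum_nonneg fun I _ => Finset.sum_nonneg fun J _ => ?_
  split_ifs with h
  · subst h
    rw [mul_comm (starRingEnd ℂ _), Complex.mul_conj]
    simp only [Complex.ofReal_one, one_mul, Complex.ofReal_re]
    exact Complex.normSq_nonneg _
  · simp

variable (E : Type*) [NormedAddCommGroup E] [NormedSpace ℂ E]

/-- The algebra `Λ^•_ℂ = ⨁_k Λ^k_ℂ` of complex-valued alternating `ℝ`-multilinear forms on `E`. As
`Λ^k_ℂ = 0` for `k > dim_ℝ E`, the product over `k` is the direct sum. -/
abbrev CovectorAlgebra : Type _ := (k : ℕ) → E [⋀^Fin k]→L[ℝ] ℂ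

variable {E}

/-- The space `Λ^{p,q}` of forms of bidegree `(p, q)`, for integers `p, q`: the forms `α` with
`α(c v₁, …, c v_k) = c^p (conj c)^q α(v₁, …, v_k)` for all complex `c ≠ 0`. Real `c` force the degree
to be `p + q`, so that this is `0` if `p < 0` or `q < 0`. -/
def ofType (p q : ℤ) : Submodule ℂ (CovectorAlgebra E) where
  carrier := {α | ∀ (k : ℕ) (c : ℂ) (v : Fin k → E), c ≠ 0 →
    α k (fun i => c • v i) = c ^ p * (starRingEnd ℂ c) ^ q * α k v}
  zero_mem' := by intro k c v _; simp
  add_mem' := by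
    intro α β hα hβ k c v hc
    simp only [Pi.add_apply, ContinuousAlternatingMap.add_apply, hα k c v hc, hβ k c v hc, mul_add]
  smul_mem' := by
    intro a α hα k c v hc
    simp only [Pi.smul_apply, ContinuousAlternatingMap.smul_apply, hα k c v hc, smul_eq_mul]
    ring

/-- The space `Λ^k_ℂ` of forms of degree `k`, for an integer `k` (it is `0` if `k < 0`). -/
def ofDegree (k : ℤ) : Submodule ℂ (CovectorAlgebra E) where
  carrier := {α | ∀ j : ℕ, (j : ℤ) ≠ k → α j = 0}
  zero_mem' := by intro j _; rfl
  add_mem' := by intro α β hα hβ j hj; simp [hα j hj, hβ j hj]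
  smul_mem' := by intro a α hα j hj; simp [hα j hj]

/-- Pull-back of alternating forms by an `ℝ`-linear map. -/
def pullback (L : E →L[ℝ] E) (α : CovectorAlgebra E) : CovectorAlgebra E :=
  fun k => (α k).compContinuousLinearMap L

/-- Pull-back of a bilinear form by an `ℝ`-linear map. -/
def pullbackMetric (L : E →L[ℝ] E) (G : E →L[ℝ] E →L[ℝ] ℝ) : E →L[ℝ] E →L[ℝ] ℝ :=
  G.bilinearComp L L

/-- `G` is a real inner product. -/
structure IsInner (G : E →L[ℝ] E →L[ℝ] ℝ) : Prop where
  symm : ∀ v w, G v w = G w v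
  pos : ∀ v, v ≠ 0 → 0 < G v v

variable [FiniteDimensional ℂ E]

variable (E) in
/-- A basis of `E` as a real vector space; no notion below depends on its choice. -/
def realBasis : Module.Basis (Fin (Module.finrank ℝ E)) ℝ E := Module.finBasis ℝ E

/-- The matrix `(g_{ij})` of a bilinear form. -/
def gram (G : E →L[ℝ] E →L[ℝ] ℝ) :
    Matrix (Fin (Module.finrank ℝ E)) (Fin (Module.finrank ℝ E)) ℝ :=
  Matrix.of fun i j => G (realBasis E i) (realBasis E j)

/-- The coefficients `α(e_{i₁}, …, e_{i_k})` of a form. -/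
def coeffs (α : CovectorAlgebra E) (k : ℕ) (I : Fin k → Fin (Module.finrank ℝ E)) : ℂ :=
  α k (fun a => realBasis E (I a))

/-- The Hermitian inner product on `Λ^•_ℂ` (conjugate linear in the first variable) induced by a real
inner product `G`: different degrees are orthogonal, and on `k`-forms it is
`(1/k!) ∑ g^{i₁j₁} ⋯ g^{i_kj_k} conj(α_{i₁…i_k}) β_{j₁…j_k}` with `(g^{ij})` the inverse of `(g_{ij})`,
so that `e^{i₁} ∧ ⋯ ∧ e^{i_k}`, `i₁ < ⋯ < i_k`, is an orthonormal basis if `e` is one. -/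
def covectorInner (G : E →L[ℝ] E →L[ℝ] ℝ) (α β : CovectorAlgebra E) : ℂ :=
  ∑ k ∈ Finset.range (Module.finrank ℝ E + 1), ((k.factorial : ℝ)⁻¹ : ℝ) *
    tensorInner (gram G)⁻¹ (coeffs α k) (coeffs β k)

theorem gram_posDef {G : E →L[ℝ] E →L[ℝ] ℝ} (hG : IsInner G) : (gram G).PosDef := by
  refine Matrix.PosDef.of_dotProduct_mulVec_pos ?_ ?_
  · ext i j; simp [gram, hG.symm]
  · intro x hx
    have : star x ⬝ᵥ (gram G).mulVec x =
        G (∑ i, x i • realBasis E i) (∑ i, x i • realBasis E i) := by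
      simp only [dotProduct, Matrix.mulVec, gram, Matrix.of_apply, map_sum, map_smul,
        _root_.sum_apply, _root_.smul_apply, smul_eq_mul,
        Pi.star_apply, star_trivial, Finset.mul_sum]
      rw [Finset.sum_comm]
      refine Finset.sum_congr rfl fun _ _ => Finset.sum_congr rfl fun _ _ => ?_
      ring
    rw [this]
    refine hG.pos _ fun h0 => hx ?_
    ext i
    have := (realBasis E).repr_sum_self x
    rw [h0] at this
    simpa using (congrFun this i).symm

/-- `covectorInner G` is Hermitian, positive and sesquilinear. -/
abbrev covectorCore {G : E →L[ℝ] E →L[ℝ] ℝ} (hG : IsInner G) :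
    PreInnerProductSpace.Core ℂ (CovectorAlgebra E) where
  inner := covectorInner G
  conj_inner_symm α β := by
    have hs : ((gram G)⁻¹).IsSymm := by
      have := (gram_posDef hG).inv.isHermitian
      simpa [Matrix.IsHermitian, Matrix.IsSymm] using this
    simp only [covectorInner, map_sum, map_mul, Complex.conj_ofReal, tensorInner_symm hs]
  re_inner_nonneg α := by
    simp only [covectorInner, map_sum]
    refine Finset.sum_nonneg fun k _ => ?_
    rw [RCLike.re_eq_complex_re, Complex.re_ofReal_mul]
    exact mul_nonneg (by positivity) (tensorInner_nonneg (gram_posDef hG).inv.posSemidef _)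
  add_left α β γ := by
    have : ∀ k, coeffs (α + β) k = coeffs α k + coeffs β k := fun k => rfl
    simp only [covectorInner, this, tensorInner_add, mul_add, Finset.sum_add_distrib]
  smul_left α β c := by
    have : ∀ k, coeffs (c • α) k = c • coeffs α k := fun k => rfl
    simp only [covectorInner, this, tensorInner_smul, Finset.mul_sum]
    refine Finset.sum_congr rfl fun _ _ => ?_
    ring

theorem covectorInner_norm_le {G : E →L[ℝ] E →L[ℝ] ℝ} (hG : IsInner G) (α β : CovectorAlgebra E) :
    ‖covectorInner G α β‖ ≤ ‖covectorInner G α α‖ + ‖covectorInner G β β‖ := by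
  let _ := covectorCore hG
  have h1 := InnerProductSpace.Core.inner_mul_inner_self_le (𝕜 := ℂ) α β
  change ‖covectorInner G α β‖ * ‖covectorInner G β α‖ ≤
    (covectorInner G α α).re * (covectorInner G β β).re at h1
  have h2 : ‖covectorInner G β α‖ = ‖covectorInner G α β‖ := by
    have h3 : starRingEnd ℂ (covectorInner G β α) = covectorInner G α β :=
      (covectorCore hG).conj_inner_symm α β
    rw [← h3]
    exact (RCLike.norm_conj _).symm
  rw [h2] at h1
  have h3 : (covectorInner G α α).re ≤ ‖covectorInner G α α‖ := Complex.re_le_norm _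
  have h4 : (covectorInner G β β).re ≤ ‖covectorInner G β β‖ := Complex.re_le_norm _
  have h5 : 0 ≤ (covectorInner G α α).re := (covectorCore hG).re_inner_nonneg α
  have h6 : 0 ≤ (covectorInner G β β).re := (covectorCore hG).re_inner_nonneg β
  nlinarith [norm_nonneg (covectorInner G α β), mul_nonneg (h5.trans h3) (h6.trans h4),
    mul_le_mul h3 h4 h6 (h5.trans h3)]

theorem covectorInner_pullback (L : E →L[ℝ] E)
    (hL : IsUnit (LinearMap.toMatrix (realBasis E) (realBasis E) L.toLinearMap))
    (G : E →L[ℝ] E →L[ℝ] ℝ) (α β : CovectorAlgebra E) :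
    covectorInner (pullbackMetric L G) (pullback L α) (pullback L β) = covectorInner G α β := by
  set A := LinearMap.toMatrix (realBasis E) (realBasis E) L.toLinearMap with hA
  have hLb : ∀ i, L (realBasis E i) = ∑ j, A j i • realBasis E j := by
    intro i
    have := (realBasis E).sum_repr (L (realBasis E i))
    rw [← this]
    refine Finset.sum_congr rfl fun j _ => ?_
    rw [hA, LinearMap.toMatrix_apply]; simp
  have hg : gram (pullbackMetric L G) = A.transpose * gram G * A := by
    ext i j
    simp only [gram, pullbackMetric, Matrix.of_apply, ContinuousLinearMap.bilinearComp_apply, hLb,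
      map_sum, map_smul, _root_.sum_apply, _root_.smul_apply, smul_eq_mul,
      Matrix.mul_apply, Matrix.transpose_apply, Finset.sum_mul, Finset.mul_sum]
    refine Finset.sum_congr rfl fun _ _ => Finset.sum_congr rfl fun _ _ => ?_
    ring
  have hc : ∀ (γ : CovectorAlgebra E) (k : ℕ), coeffs (pullback L γ) k =
      fun I => ∑ K : Fin k → Fin (Module.finrank ℝ E),
        ((∏ a, A (K a) (I a) : ℝ) : ℂ) * coeffs γ k K := by
    intro γ k
    funext I
    simp only [coeffs, pullback, ContinuousAlternatingMap.compContinuousLinearMap_apply]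
    have : (L ∘ fun a => realBasis E (I a)) = fun a => ∑ j, A j (I a) • realBasis E j := by
      funext a; exact hLb _
    rw [this]
    have h2 := (γ k).toContinuousMultilinearMap.toMultilinearMap.map_sum
      (fun a j => A j (I a) • realBasis E j)
    refine h2.trans (Finset.sum_congr rfl fun K _ => ?_)
    have h3 := (γ k).toContinuousMultilinearMap.toMultilinearMap.map_smul_univ
      (fun a => A (K a) (I a)) (fun a => realBasis E (K a))
    refine h3.trans ?_
    rw [Complex.real_smul]; rfl
  simp only [covectorInner, hc, tensorInner_change, hg]
  have hdet : IsUnit A.det := (Matrix.isUnit_iff_isUnit_det _).1 hL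
  have hinv : A * (A.transpose * gram G * A)⁻¹ * A.transpose = (gram G)⁻¹ := by
    rw [Matrix.mul_inv_rev, Matrix.mul_inv_rev, ← Matrix.mul_assoc, Matrix.mul_nonsing_inv A hdet,
      Matrix.one_mul, Matrix.mul_assoc, Matrix.nonsing_inv_mul _ (by rwa [Matrix.det_transpose]),
      Matrix.mul_one]
  rw [hinv]

end Pointwise

section Manifold

variable {E : Type*} [NormedAddCommGroup E] [NormedSpace ℂ E]
  {M : Type*} [TopologicalSpace M] [ChartedSpace E M]

/-- The smooth manifold underlying a complex manifold. -/
instance realManifold [IsManifold 𝓘(ℂ, E) ω M] : IsManifold 𝓘(ℝ, E) ∞ M := by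
  apply isManifold_of_contDiffOn
  intro e e' he he'
  have h := (mem_groupoid_of_pregroupoid.1
    ((contDiffGroupoid ω 𝓘(ℂ, E)).compatible he he')).1
  have h' : ContDiffOn ℂ ω (𝓘(ℂ, E) ∘ (e.symm ≫ₕ e') ∘ 𝓘(ℂ, E).symm)
    (𝓘(ℂ, E).symm ⁻¹' (e.symm ≫ₕ e').source ∩ Set.range 𝓘(ℂ, E)) := h
  exact (h'.restrict_scalars ℝ).of_le le_top

variable (E M) in
/-- A Hermitian metric on a complex manifold: a smooth Riemannian metric for which multiplication by
`i` on the tangent spaces is an isometry. (In Mathlib the tangent space at `x` is the model space `E`,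
read through the preferred chart `chartAt E x`.) -/
structure HermitianMetric [IsManifold 𝓘(ℂ, E) ω M] extends
    Bundle.ContMDiffRiemannianMetric 𝓘(ℝ, E) ∞ E (fun x : M => TangentSpace 𝓘(ℝ, E) x) where
  hermitian (x : M) (v w : E) : inner x (Complex.I • v : E) (Complex.I • w : E) = inner x v w

/-- The value of the metric at `x`, on `T_x M = E`. -/
def HermitianMetric.tensorAt [IsManifold 𝓘(ℂ, E) ω M] (g : HermitianMetric E M) (x : M) :
    E →L[ℝ] E →L[ℝ] ℝ := g.inner x

variable (E M) in
/-- Complex differential forms of mixed degree on `M`, without any regularity: sections of `Λ^•_ℂ M`.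
The value at `x` is a form on `T_x M = E`. -/
abbrev Form : Type _ := M → CovectorAlgebra E

/-- The differential at `y` of the inverse of the chart `e`, from `E` to the tangent space at
`e.symm y`. -/
def chartFrame (e : OpenPartialHomeomorph M E) (y : E) : E →L[ℝ] E :=
  mfderiv 𝓘(ℝ, E) 𝓘(ℝ, E) e.symm y

/-- The local expression of a form in the chart `e`: its pull-back by `e.symm`. -/
def Form.inChart (e : OpenPartialHomeomorph M E) (u : Form E M) (y : E) : CovectorAlgebra E :=
  pullback (chartFrame e y) (u (e.symm y))

/-- A form is smooth if its local expressions are. -/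
def Form.IsSmooth (u : Form E M) : Prop :=
  ∀ e ∈ atlas E M, ∀ k : ℕ, ContDiffOn ℝ ∞ (fun y => u.inChart e y k) e.target

/-- A form is measurable if its coefficients in the charts are. -/
def Form.IsMeasurable [MeasurableSpace E] (u : Form E M) : Prop :=
  ∀ e ∈ atlas E M, ∀ (k : ℕ) (v : Fin k → E),
    Measurable fun y : e.target => u.inChart e (y : E) k v

theorem Form.IsMeasurable.add [MeasurableSpace E] {u v : Form E M} (hu : u.IsMeasurable)
    (hv : v.IsMeasurable) : (u + v).IsMeasurable := fun e he k w => (hu e he k w).add (hv e he k w)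

theorem Form.IsMeasurable.smul [MeasurableSpace E] {u : Form E M} (c : ℂ) (hu : u.IsMeasurable) :
    (c • u).IsMeasurable := fun e he k w => (hu e he k w).const_mul c

/-- The exterior derivative `d`. At `x` it is computed in the preferred chart at `x`, whose
differential at `x` is the identity of `T_x M = E`. -/
def Form.extD (u : Form E M) : Form E M
  | _, 0 => 0
  | x, k + 1 => extDeriv (fun y => u.inChart (chartAt E x) y k) (chartAt E x x)

/-- The `ℂ`-linear part `v ↦ (L v - i L (i v)) / 2` of an `ℝ`-linear map. -/
def linearPart {k : ℕ} (L : E →L[ℝ] E [⋀^Fin k]→L[ℝ] ℂ) : E →L[ℝ] E [⋀^Fin k]→L[ℝ] ℂ :=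
  (1 / 2 : ℂ) • (L - Complex.I • L.comp (Complex.I • ContinuousLinearMap.id ℝ E))

/-- The `ℂ`-antilinear part `v ↦ (L v + i L (i v)) / 2` of an `ℝ`-linear map. -/
def antilinearPart {k : ℕ} (L : E →L[ℝ] E [⋀^Fin k]→L[ℝ] ℂ) : E →L[ℝ] E [⋀^Fin k]→L[ℝ] ℂ :=
  (1 / 2 : ℂ) • (L + Complex.I • L.comp (Complex.I • ContinuousLinearMap.id ℝ E))

/-- The operator `∂`: in holomorphic coordinates,
`∂ (∑ f_{IJ} dz_I ∧ dz̄_J) = ∑ (∂f_{IJ}/∂z_i) dz_i ∧ dz_I ∧ dz̄_J`. -/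
def Form.del (u : Form E M) : Form E M
  | _, 0 => 0
  | x, k + 1 => .alternatizeUncurryFin
      (linearPart (fderiv ℝ (fun y => u.inChart (chartAt E x) y k) (chartAt E x x)))

/-- The operator `∂̄`: in holomorphic coordinates,
`∂̄ (∑ f_{IJ} dz_I ∧ dz̄_J) = ∑ (∂f_{IJ}/∂z̄_i) dz̄_i ∧ dz_I ∧ dz̄_J`. -/
def Form.delbar (u : Form E M) : Form E M
  | _, 0 => 0
  | x, k + 1 => .alternatizeUncurryFin
      (antilinearPart (fderiv ℝ (fun y => u.inChart (chartAt E x) y k) (chartAt E x x)))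

/-- `d = ∂ + ∂̄`. -/
theorem Form.extD_eq (u : Form E M) : u.extD = u.del + u.delbar := by
  funext x k
  rcases k with _ | k
  · simp [Form.extD, Form.del, Form.delbar]
  · simp only [Form.extD, Form.del, Form.delbar, Pi.add_apply, extDeriv,
      ← ContinuousAlternatingMap.alternatizeUncurryFin_add]
    congr 1
    ext v w
    simp [linearPart, antilinearPart]
    ring

/-- Smooth forms with compact support and values in the subbundle of `Λ^•_ℂ M` with fibre `S`
(`S` is always a sum of spaces `Λ^{p,q}` or `Λ^k_ℂ`). -/
structure Form.IsTest (S : Submodule ℂ (CovectorAlgebra E)) (u : Form E M) : Prop where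
  smooth : u.IsSmooth
  compactSupport : HasCompactSupport u
  mem : ∀ x, u x ∈ S

theorem HermitianMetric.isInner [IsManifold 𝓘(ℂ, E) ω M] (g : HermitianMetric E M) (x : M) :
    IsInner (g.tensorAt x) where
  symm v w := g.symm x v w
  pos v hv := g.pos x v hv

/-- The local expression of the metric in the chart `e`. -/
def HermitianMetric.inChart [IsManifold 𝓘(ℂ, E) ω M] (g : HermitianMetric E M) (e : OpenPartialHomeomorph M E)
    (y : E) : E →L[ℝ] E →L[ℝ] ℝ :=
  pullbackMetric (chartFrame e y) (g.tensorAt (e.symm y))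

theorem HermitianMetric.continuousOn_inChart [IsManifold 𝓘(ℂ, E) ω M]
    (g : HermitianMetric E M) {e : OpenPartialHomeomorph M E} (he : e ∈ atlas E M) (v w : E) :
    ContinuousOn (fun y => g.inChart e y v w) e.target := by
  have hs : ContMDiffOn 𝓘(ℝ, E) 𝓘(ℝ, E) ∞ e.symm e.target :=
    contMDiffOn_symm_of_mem_maximalAtlas (IsManifold.subset_maximalAtlas he)
  have ht := hs.contMDiffOn_tangentMapWithin (m := ∞) le_rfl e.open_target.uniqueMDiffOn
  have hvec : ∀ v : E, ContMDiffOn 𝓘(ℝ, E) (𝓘(ℝ, E).prod 𝓘(ℝ, E)) ∞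
      (fun y => Bundle.TotalSpace.mk' E (E := fun x : M => TangentSpace 𝓘(ℝ, E) x) (e.symm y)
        (chartFrame e y v)) e.target := by
    intro v
    have hc : ContMDiffOn 𝓘(ℝ, E) (𝓘(ℝ, E).prod 𝓘(ℝ, E)) ∞
      (fun y : E => (⟨y, v⟩ : TangentBundle 𝓘(ℝ, E) E)) e.target :=
      contMDiffOn_vectorSpace_iff_contDiffOn.2 contDiffOn_const
    refine (ht.comp hc fun y hy => hy).congr fun y hy => ?_
    simp only [Function.comp, tangentMapWithin, chartFrame]
    rw [mfderivWithin_of_isOpen e.open_target hy]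
    rfl
  have hg := g.contMDiff.contMDiffOn (s := Set.univ) |>.comp hs (fun _ _ => Set.mem_univ _)
  have hfin := ContMDiffOn.clm_bundle_apply₂ (F₁ := E) (F₂ := E) (F₃ := ℝ)
    (E₃ := Bundle.Trivial M ℝ)
    (E₁ := fun x : M => TangentSpace 𝓘(ℝ, E) x) (E₂ := fun x : M => TangentSpace 𝓘(ℝ, E) x)
    (b := e.symm) (ψ := fun y => g.inner (e.symm y)) hg (hvec v) (hvec w)
  intro y hy
  have h1 := hfin y hy
  simp only [Bundle.contMDiffWithinAt_totalSpace] at h1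
  exact h1.2.continuousWithinAt

variable [FiniteDimensional ℂ E] [IsManifold 𝓘(ℂ, E) ω M]

theorem isUnit_chartFrame {e : OpenPartialHomeomorph M E} (he : e ∈ atlas E M) {y : E}
    (hy : y ∈ e.target) :
    IsUnit (LinearMap.toMatrix (realBasis E) (realBasis E) (chartFrame e y).toLinearMap) := by
  have hd := mdifferentiable_of_mem_atlas (I := 𝓘(ℝ, E)) he
  have h1 := hd.comp_symm_deriv hy
  let D : E →L[ℝ] E := mfderiv 𝓘(ℝ, E) 𝓘(ℝ, E) e (e.symm y)
  have h2 : D.toLinearMap ∘ₗ (chartFrame e y).toLinearMap = LinearMap.id := by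
    ext v
    exact DFunLike.congr_fun h1 v
  have h3 := congrArg (LinearMap.toMatrix (realBasis E) (realBasis E)) h2
  rw [LinearMap.toMatrix_comp _ (realBasis E), LinearMap.toMatrix_id] at h3
  exact IsUnit.of_mul_eq_one_right _ h3


theorem HermitianMetric.measurable_gram_inv [MeasurableSpace E] [BorelSpace E]
    (g : HermitianMetric E M) {e : OpenPartialHomeomorph M E} (he : e ∈ atlas E M)
    (i j : Fin (Module.finrank ℝ E)) :
    Measurable fun y : e.target => (gram (g.inChart e (y : E)))⁻¹ i j := by
  have hc : Continuous fun y : e.target => gram (g.inChart e (y : E)) :=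
    continuous_matrix fun i j =>
      (g.continuousOn_inChart he (realBasis E i) (realBasis E j)).domRestrict
  simp only [Matrix.inv_def, Matrix.smul_apply, Ring.inverse_eq_inv', smul_eq_mul]
  exact hc.matrix_det.measurable.inv.mul (hc.matrix_adjugate.matrix_elem i j).measurable

/-- The function `x ↦ h_x(u(x), v(x))`, conjugate linear in `u`. -/
def HermitianMetric.formInner (g : HermitianMetric E M) (u v : Form E M) (x : M) : ℂ :=
  covectorInner (g.tensorAt x) (u x) (v x)

theorem HermitianMetric.formInner_eq (g : HermitianMetric E M) (u v : Form E M)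
    {e : OpenPartialHomeomorph M E} (he : e ∈ atlas E M) {x : M} (hx : x ∈ e.source) :
    g.formInner u v x =
      covectorInner (g.inChart e (e x)) (u.inChart e (e x)) (v.inChart e (e x)) := by
  simp only [HermitianMetric.inChart, Form.inChart,
    covectorInner_pullback _ (isUnit_chartFrame he (e.map_source hx)), e.left_inv hx]
  rfl

theorem HermitianMetric.measurable_formInner [MeasurableSpace E] [BorelSpace E]
    [MeasurableSpace M] [BorelSpace M] [SecondCountableTopology M]
    (g : HermitianMetric E M) {u v : Form E M} (hu : u.IsMeasurable) (hv : v.IsMeasurable) :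
    Measurable (g.formInner u v) := by
  have hloc : ∀ e ∈ atlas E M, Measurable fun x : e.source => g.formInner u v x := by
    intro e he
    have hF : Measurable fun y : e.target =>
        covectorInner (g.inChart e y) (u.inChart e y) (v.inChart e y) := by
      unfold covectorInner tensorInner coeffs
      refine Finset.measurable_sum _ fun k _ => Measurable.const_mul ?_ _
      refine Finset.measurable_sum _ fun I _ => Finset.measurable_sum _ fun J _ => ?_
      refine Measurable.mul ?_ (Measurable.mul ?_ (hv e he k _))
      · exact Complex.measurable_ofReal.comp
          (Finset.measurable_prod _ fun a _ => g.measurable_gram_inv he _ _)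
      · exact Complex.continuous_conj.measurable.comp (hu e he k _)
    have hE : Measurable fun x : e.source => (⟨e x, e.map_source x.2⟩ : e.target) :=
      (Continuous.subtype_mk e.continuousOn.domRestrict _).measurable
    have heq : (fun x : e.source => g.formInner u v x) =
        (fun y : e.target => covectorInner (g.inChart e y) (u.inChart e y) (v.inChart e y)) ∘
          fun x : e.source => (⟨e x, e.map_source x.2⟩ : e.target) := by
      funext x
      exact g.formInner_eq u v he x.2
    rw [heq]
    exact hF.comp hE
  obtain ⟨T, hT, hTu⟩ := TopologicalSpace.countable_cover_nhds
    (f := fun x : M => (chartAt E x).source) fun x => chart_source_mem_nhds E x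
  intro s hs
  have hpre : g.formInner u v ⁻¹' s = ⋃ x ∈ T, Subtype.val ''
      ((fun z : (chartAt E x).source => g.formInner u v z) ⁻¹' s) := by
    ext z
    simp only [Set.mem_preimage, Set.mem_iUnion, Set.mem_image, Subtype.exists, exists_and_right,
      exists_eq_right, exists_prop]
    constructor
    · intro hz
      have : z ∈ ⋃ x ∈ T, (chartAt E x).source := hTu ▸ Set.mem_univ z
      simp only [Set.mem_iUnion, exists_prop] at this
      obtain ⟨x, hx, hzx⟩ := this
      exact ⟨⟨x, hx, hzx⟩, hz⟩
    · rintro ⟨_, hz⟩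
      exact hz
  rw [hpre]
  exact MeasurableSet.biUnion hT fun x _ =>
    (chartAt E x).open_source.measurableSet.subtype_image
      (hloc _ (chart_mem_atlas E x) hs)

theorem HermitianMetric.formInner_add_left (g : HermitianMetric E M) (u v w : Form E M) :
    g.formInner (u + v) w = g.formInner u w + g.formInner v w :=
  funext fun x => (covectorCore (g.isInner x)).add_left (u x) (v x) (w x)

theorem HermitianMetric.formInner_smul_left (g : HermitianMetric E M) (c : ℂ) (u w : Form E M) :
    g.formInner (c • u) w = fun x => starRingEnd ℂ c * g.formInner u w x :=
  funext fun x => (covectorCore (g.isInner x)).smul_left (u x) (w x) c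

theorem HermitianMetric.formInner_conj (g : HermitianMetric E M) (u v : Form E M) (x : M) :
    starRingEnd ℂ (g.formInner v u x) = g.formInner u v x :=
  (covectorCore (g.isInner x)).conj_inner_symm (u x) (v x)

theorem HermitianMetric.formInner_add_right (g : HermitianMetric E M) (u v w : Form E M) :
    g.formInner w (u + v) = g.formInner w u + g.formInner w v := by
  funext x
  rw [Pi.add_apply, ← g.formInner_conj w (u + v), g.formInner_add_left, Pi.add_apply, map_add,
    g.formInner_conj, g.formInner_conj]

theorem HermitianMetric.formInner_smul_right (g : HermitianMetric E M) (c : ℂ) (u w : Form E M) :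
    g.formInner w (c • u) = fun x => c * g.formInner w u x := by
  funext x
  rw [← g.formInner_conj w (c • u), g.formInner_smul_left]
  simp only [map_mul, Complex.conj_conj, g.formInner_conj]

end Manifold

section L2

open MeasureTheory

variable {E : Type*} [NormedAddCommGroup E] [NormedSpace ℂ E] [FiniteDimensional ℂ E]
  [MeasurableSpace E] [BorelSpace E]
  {M : Type*} [TopologicalSpace M] [ChartedSpace E M] [IsManifold 𝓘(ℂ, E) ω M]
  [MeasurableSpace M]

/-- The Riemannian measure. On the domain of each chart of the atlas it is `√det(g_{ij})` times
Lebesgue measure; these measures agree where charts overlap, and their supremum is the measure they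
together define. -/
def HermitianMetric.vol (g : HermitianMetric E M) : Measure M :=
  ⨆ e : atlas E M, Measure.map e.1.symm
    (((realBasis E).addHaar.restrict e.1.target).withDensity
      fun y => ENNReal.ofReal (Real.sqrt (gram (g.inChart e.1 y)).det))

variable [BorelSpace M] [SecondCountableTopology M]

theorem HermitianMetric.integrable_formInner (g : HermitianMetric E M) {u v : Form E M}
    (hu : u.IsMeasurable) (hv : v.IsMeasurable)
    (hu' : Integrable (g.formInner u u) g.vol) (hv' : Integrable (g.formInner v v) g.vol) :
    Integrable (g.formInner u v) g.vol :=
  (hu'.norm.add hv'.norm).mono' (g.measurable_formInner hu hv).aestronglyMeasurable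
    (Filter.Eventually.of_forall fun x => covectorInner_norm_le (g.isInner x) (u x) (v x))

/-- Measurable forms `u` with `∫_M h(u, u) vol < ∞`. -/
def squareIntegrable (g : HermitianMetric E M) : Submodule ℂ (Form E M) where
  carrier := {u | u.IsMeasurable ∧ Integrable (g.formInner u u) g.vol}
  zero_mem' := by
    refine ⟨fun e he k w => measurable_const, ?_⟩
    have h0 : g.formInner (0 : Form E M) 0 = 0 := by
      funext x
      simp [HermitianMetric.formInner, covectorInner, tensorInner, coeffs]
    change Integrable (g.formInner 0 0) g.vol
    rw [h0]; exact integrable_zero _ _ _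
  add_mem' := by
    rintro u v ⟨hu, hu'⟩ ⟨hv, hv'⟩
    refine ⟨hu.add hv, ?_⟩
    rw [g.formInner_add_left, g.formInner_add_right, g.formInner_add_right]
    exact (hu'.add (g.integrable_formInner hu hv hu' hv')).add
      ((g.integrable_formInner hv hu hv' hu').add hv')
  smul_mem' := by
    rintro c u ⟨hu, hu'⟩
    refine ⟨hu.smul c, ?_⟩
    rw [g.formInner_smul_left, g.formInner_smul_right]
    exact (hu'.const_mul c).const_mul _

/-- The square-integrable forms, with the semi-inner product `∫_M h(u, v) vol`. -/
def PreL2 (g : HermitianMetric E M) : Type _ := squareIntegrable g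

instance (g : HermitianMetric E M) : AddCommGroup (PreL2 g) :=
  inferInstanceAs (AddCommGroup (squareIntegrable g))

instance (g : HermitianMetric E M) : Module ℂ (PreL2 g) :=
  inferInstanceAs (Module ℂ (squareIntegrable g))

/-- A square-integrable form as an element of `PreL2 g`. -/
def PreL2.ofForm {g : HermitianMetric E M} (u : Form E M) (hu : u ∈ squareIntegrable g) : PreL2 g :=
  ⟨u, hu⟩

/-- The underlying form. -/
def PreL2.form {g : HermitianMetric E M} (u : PreL2 g) : Form E M := u.1

/-- The semi-inner product on square-integrable forms. -/
abbrev preL2Core (g : HermitianMetric E M) : PreInnerProductSpace.Core ℂ (PreL2 g) where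
  inner u v := ∫ x, g.formInner u.form v.form x ∂g.vol
  conj_inner_symm u v := by
    rw [← integral_conj]
    simp only [g.formInner_conj]
  re_inner_nonneg u := by
    have h : RCLike.re (∫ x, g.formInner u.form u.form x ∂g.vol) =
        ∫ x, RCLike.re (g.formInner u.form u.form x) ∂g.vol := (integral_re u.2.2).symm
    rw [h]
    exact integral_nonneg fun x => (covectorCore (g.isInner x)).re_inner_nonneg (u.form x)
  add_left u v w := by
    have h : g.formInner (u + v).form w.form =
        g.formInner u.form w.form + g.formInner v.form w.form := g.formInner_add_left _ _ _
    rw [h]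
    exact integral_add (g.integrable_formInner u.2.1 w.2.1 u.2.2 w.2.2)
      (g.integrable_formInner v.2.1 w.2.1 v.2.2 w.2.2)
  smul_left u v c := by
    have h : g.formInner (c • u).form v.form =
        fun x => starRingEnd ℂ c * g.formInner u.form v.form x := g.formInner_smul_left _ _ _
    rw [h]
    exact integral_const_mul _ _

instance (g : HermitianMetric E M) : SeminormedAddCommGroup (PreL2 g) :=
  @InnerProductSpace.Core.toSeminormedAddCommGroup ℂ _ _ _ _ (preL2Core g)

instance (g : HermitianMetric E M) : InnerProductSpace ℂ (PreL2 g) :=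
  InnerProductSpace.ofCore (preL2Core g)

/-- The Hilbert space `L²Λ^•_ℂ` of square-integrable forms of mixed degree, modulo equality almost
everywhere (that is, modulo forms of norm `0`). -/
def L2 (g : HermitianMetric E M) : Type _ := SeparationQuotient (PreL2 g)

instance (g : HermitianMetric E M) : NormedAddCommGroup (L2 g) :=
  inferInstanceAs (NormedAddCommGroup (SeparationQuotient (PreL2 g)))

instance (g : HermitianMetric E M) : InnerProductSpace ℂ (L2 g) :=
  inferInstanceAs (InnerProductSpace ℂ (SeparationQuotient (PreL2 g)))

/-- The class of a square-integrable form. -/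
def L2.mk {g : HermitianMetric E M} (u : PreL2 g) : L2 g := SeparationQuotient.mk u

/-- `a` is the class of the form `u`; in particular `u` is square-integrable. -/
def Represents {g : HermitianMetric E M} (a : L2 g) (u : Form E M) : Prop :=
  ∃ hu : u ∈ squareIntegrable g, L2.mk (PreL2.ofForm u hu) = a

/-- The square-integrable sections of the subbundle with fibre `S`, such as `L²Λ^{p,q}`. -/
def sections (g : HermitianMetric E M) (S : Submodule ℂ (CovectorAlgebra E)) :
    Submodule ℂ (L2 g) where
  carrier := {a | ∃ u : Form E M, Represents a u ∧ ∀ x, u x ∈ S}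
  zero_mem' := ⟨0, ⟨(squareIntegrable g).zero_mem, rfl⟩, fun _ => S.zero_mem⟩
  add_mem' := by
    rintro _ _ ⟨u, ⟨hu, rfl⟩, hu'⟩ ⟨v, ⟨hv, rfl⟩, hv'⟩
    exact ⟨u + v, ⟨(squareIntegrable g).add_mem hu hv, rfl⟩, fun x => S.add_mem (hu' x) (hv' x)⟩
  smul_mem' := by
    rintro c _ ⟨u, ⟨hu, rfl⟩, hu'⟩
    exact ⟨c • u, ⟨(squareIntegrable g).smul_mem c hu, rfl⟩, fun x => S.smul_mem c (hu' x)⟩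

/-- The classes of the smooth compactly supported sections of the subbundle with fibre `S`. -/
def testSections (g : HermitianMetric E M) (S : Submodule ℂ (CovectorAlgebra E)) : Set (L2 g) :=
  {a | ∃ u : Form E M, u.IsTest S ∧ Represents a u}

/-- The graph of `P₀`, the operator `P` on smooth compactly supported sections of the subbundle with
fibre `S`. -/
def graphZero (g : HermitianMetric E M) (S : Submodule ℂ (CovectorAlgebra E))
    (P : Form E M → Form E M) : Set (L2 g × L2 g) :=
  {z | ∃ u : Form E M, u.IsTest S ∧ Represents z.1 u ∧ Represents z.2 (P u)}

/-- The graph of `(∂̄ ⊕ ∂)₀ : (a, b) ↦ ∂̄a + ∂b` on pairs of smooth compactly supported sections of the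
subbundles with fibres `S` and `T`. -/
def graphZeroDelbarSumDel (g : HermitianMetric E M) (S T : Submodule ℂ (CovectorAlgebra E)) :
    Set (WithLp 2 (L2 g × L2 g) × L2 g) :=
  {z | ∃ a b : Form E M, a.IsTest S ∧ b.IsTest T ∧
    Represents z.1.fst a ∧ Represents z.1.snd b ∧ Represents z.2 (a.delbar + b.del)}

end L2

section Operators

/-! Unbounded operators between inner product spaces are given by their graphs. -/

variable {X Y : Type*} [NormedAddCommGroup X] [InnerProductSpace ℂ X]
  [NormedAddCommGroup Y] [InnerProductSpace ℂ Y]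

/-- The kernel of the operator with graph `G`. -/
def opKer (G : Submodule ℂ (X × Y)) : Submodule ℂ X := G.comap (LinearMap.inl ℂ X Y)

/-- The closure of the image of the operator with graph `G`. -/
def opImClosure (G : Submodule ℂ (X × Y)) : Submodule ℂ Y :=
  (G.map (LinearMap.snd ℂ X Y)).topologicalClosure

/-- The strong extension of an operator with graph `G₀` (a linear subspace): its graph is the closure
of `G₀`. -/
def strongExtension (G₀ : Set (X × Y)) : Submodule ℂ (X × Y) :=
  (Submodule.span ℂ G₀).topologicalClosure

/-- The weak extension of an operator `P₀` with graph `G₀` from `H₁ ⊆ X` to `H₂ ⊆ Y`, given the spaces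
`D₁ ⊆ H₁`, `D₂ ⊆ H₂` of smooth compactly supported sections: `u ∈ H₁` is in the domain with value
`v ∈ H₂` if `⟨v, w⟩ = ⟨u, P^* w⟩` for all `w ∈ D₂`. Here the formal adjoint applied to `w` is the element
`z = P^* w` of `D₁` with `⟨P a, w⟩ = ⟨a, z⟩` for all smooth compactly supported `a`. -/
def weakExtension (G₀ : Set (X × Y)) (D₁ : Set X) (D₂ : Set Y)
    (H₁ : Submodule ℂ X) (H₂ : Submodule ℂ Y) : Submodule ℂ (X × Y) where
  carrier := {a | a.1 ∈ H₁ ∧ a.2 ∈ H₂ ∧ ∀ w ∈ D₂, ∀ z ∈ D₁,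
    (∀ b ∈ G₀, inner ℂ b.2 w = inner ℂ b.1 z) → inner ℂ a.2 w = inner ℂ a.1 z}
  zero_mem' := ⟨H₁.zero_mem, H₂.zero_mem, fun w _ z _ _ => by simp⟩
  add_mem' := by
    rintro a b ⟨ha₁, ha₂, ha⟩ ⟨hb₁, hb₂, hb⟩
    refine ⟨H₁.add_mem ha₁ hb₁, H₂.add_mem ha₂ hb₂, fun w hw z hz h => ?_⟩
    simp only [Prod.fst_add, Prod.snd_add, inner_add_left, ha w hw z hz h, hb w hw z hz h]
  smul_mem' := by
    rintro c a ⟨ha₁, ha₂, ha⟩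
    refine ⟨H₁.smul_mem c ha₁, H₂.smul_mem c ha₂, fun w hw z hz h => ?_⟩
    simp only [Prod.smul_fst, Prod.smul_snd, inner_smul_left, ha w hw z hz h]

/-- The quotient `Z / (Z ∩ B)`. -/
abbrev Cohomology (Z B : Submodule ℂ X) : Type _ := Z ⧸ B.comap Z.subtype

/-- The map between quotients is induced by the identity on representatives. -/
def InducedByIdentity {Z B Z' B' : Submodule ℂ X} (f : Cohomology Z B →ₗ[ℂ] Cohomology Z' B') :
    Prop :=
  ∀ a : Z, ∃ a' : Z', (a' : X) = a ∧ f (Submodule.Quotient.mk a) = Submodule.Quotient.mk a'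

end Operators

section ReducedCohomology

variable {E : Type*} [NormedAddCommGroup E] [NormedSpace ℂ E] [FiniteDimensional ℂ E]
  [MeasurableSpace E] [BorelSpace E]
  {M : Type*} [TopologicalSpace M] [ChartedSpace E M] [IsManifold 𝓘(ℂ, E) ω M]
  [MeasurableSpace M] [BorelSpace M] [SecondCountableTopology M]

/-- `P_s`, for `P` acting on sections of the subbundle with fibre `S`. -/
def strong (g : HermitianMetric E M) (S : Submodule ℂ (CovectorAlgebra E))
    (P : Form E M → Form E M) : Submodule ℂ (L2 g × L2 g) :=
  strongExtension (graphZero g S P)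

/-- `P_w`, for `P` acting from sections of the subbundle with fibre `S` to sections of the subbundle
with fibre `T`. -/
def weak (g : HermitianMetric E M) (S T : Submodule ℂ (CovectorAlgebra E))
    (P : Form E M → Form E M) : Submodule ℂ (L2 g × L2 g) :=
  weakExtension (graphZero g S P) (testSections g S) (testSections g T)
    (sections g S) (sections g T)

/-- `ker ∂_w` in `L²Λ^{p,q}`. -/
def delZ (g : HermitianMetric E M) (p q : ℤ) : Submodule ℂ (L2 g) :=
  opKer (weak g (ofType p q) (ofType (p + 1) q) Form.del)

/-- The closure of `im ∂_s` in `L²Λ^{p,q}`. -/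
def delB (g : HermitianMetric E M) (p q : ℤ) : Submodule ℂ (L2 g) :=
  opImClosure (strong g (ofType (p - 1) q) Form.del)

/-- `ker ∂̄_w` in `L²Λ^{p,q}`. -/
def delbarZ (g : HermitianMetric E M) (p q : ℤ) : Submodule ℂ (L2 g) :=
  opKer (weak g (ofType p q) (ofType p (q + 1)) Form.delbar)

/-- The closure of `im ∂̄_s` in `L²Λ^{p,q}`. -/
def delbarB (g : HermitianMetric E M) (p q : ℤ) : Submodule ℂ (L2 g) :=
  opImClosure (strong g (ofType p (q - 1)) Form.delbar)

/-- `ker d_w` in `L²Λ^k_ℂ`. -/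
def deRhamZ (g : HermitianMetric E M) (k : ℤ) : Submodule ℂ (L2 g) :=
  opKer (weak g (ofDegree k) (ofDegree (k + 1)) Form.extD)

/-- The closure of `im d_s` in `L²Λ^k_ℂ`. -/
def deRhamB (g : HermitianMetric E M) (k : ℤ) : Submodule ℂ (L2 g) :=
  opImClosure (strong g (ofDegree (k - 1)) Form.extD)

/-- `ker (∂ + ∂̄)_w` in `L²Λ^{p,q}`, for `∂ + ∂̄ : A^{p,q} → A^{p+1,q} ⊕ A^{p,q+1}`. -/
def bottChernZ (g : HermitianMetric E M) (p q : ℤ) : Submodule ℂ (L2 g) :=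
  opKer (weak g (ofType p q) (ofType (p + 1) q ⊔ ofType p (q + 1)) fun u => u.del + u.delbar)

/-- The closure of `im (∂∂̄)_s` in `L²Λ^{p,q}`. -/
def bottChernB (g : HermitianMetric E M) (p q : ℤ) : Submodule ℂ (L2 g) :=
  opImClosure (strong g (ofType (p - 1) (q - 1)) fun u => u.delbar.del)

/-- `ker (∂∂̄)_w` in `L²Λ^{p,q}`. -/
def aeppliZ (g : HermitianMetric E M) (p q : ℤ) : Submodule ℂ (L2 g) :=
  opKer (weak g (ofType p q) (ofType (p + 1) (q + 1)) fun u => u.delbar.del)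

/-- The closure of `im (∂̄ ⊕ ∂)_s` in `L²Λ^{p,q}`, for
`∂̄ ⊕ ∂ : A^{p,q-1} ⊕ A^{p-1,q} → A^{p,q}`. -/
def aeppliB (g : HermitianMetric E M) (p q : ℤ) : Submodule ℂ (L2 g) :=
  opImClosure (strongExtension
    (graphZeroDelbarSumDel g (ofType p (q - 1)) (ofType (p - 1) q)))

/-- Reduced `L²` `∂`-cohomology `ker ∂_w / closure(im ∂_s)`. -/
abbrev DelCohomology (g : HermitianMetric E M) (p q : ℤ) : Type _ :=
  Cohomology (delZ g p q) (delB g p q)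

/-- Reduced `L²` Dolbeault cohomology `ker ∂̄_w / closure(im ∂̄_s)`. -/
abbrev DelbarCohomology (g : HermitianMetric E M) (p q : ℤ) : Type _ :=
  Cohomology (delbarZ g p q) (delbarB g p q)

/-- Reduced `L²` de Rham cohomology `ker d_w / closure(im d_s)`. -/
abbrev DeRhamCohomology (g : HermitianMetric E M) (k : ℤ) : Type _ :=
  Cohomology (deRhamZ g k) (deRhamB g k)

/-- Reduced `L²` Bott-Chern cohomology `ker (∂ + ∂̄)_w / closure(im (∂∂̄)_s)`. -/
abbrev BottChernCohomology (g : HermitianMetric E M) (p q : ℤ) : Type _ :=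
  Cohomology (bottChernZ g p q) (bottChernB g p q)

/-- Reduced `L²` Aeppli cohomology `ker (∂∂̄)_w / closure(im (∂̄ ⊕ ∂)_s)`. -/
abbrev AeppliCohomology (g : HermitianMetric E M) (p q : ℤ) : Type _ :=
  Cohomology (aeppliZ g p q) (aeppliB g p q)

/-- `⨁_{p+q=k}` of the reduced `L²` Aeppli cohomologies (a finite direct sum). -/
abbrev TotalAeppliCohomology (g : HermitianMetric E M) (k : ℕ) : Type _ :=
  (i : Finset.HasAntidiagonal.antidiagonal k) → AeppliCohomology g (i.1.1 : ℤ) (i.1.2 : ℤ)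

/-- The map from de Rham to total Aeppli cohomology is induced by the identity of
`L²Λ^k_ℂ = ⨁_{p+q=k} L²Λ^{p,q}`: the class of `a` goes to the classes of its components
`b_{p,q} ∈ ker (∂∂̄)_w ⊆ L²Λ^{p,q}`. -/
def InducedByDecomposition (g : HermitianMetric E M) (k : ℕ)
    (f : DeRhamCohomology g k →ₗ[ℂ] TotalAeppliCohomology g k) : Prop :=
  ∀ a : deRhamZ g k, ∃ b : (i : Finset.HasAntidiagonal.antidiagonal k) →
      aeppliZ g (i.1.1 : ℤ) (i.1.2 : ℤ),
    ∑ i, (b i : L2 g) = a ∧ ∀ i, f (Submodule.Quotient.mk a) i = Submodule.Quotient.mk (b i)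

end ReducedCohomology

end

end L2Hodge

set_option linter.unusedSectionVars false

/-! On images everything is algebra. For a smooth compactly supported form `u` of pure type, `d² =
0` splits by bidegree into `∂² = 0`, `∂̄² = 0` and `∂∂̄ = -∂̄∂`, so `∂∂̄u = ∂(∂̄u) = -∂̄(∂u) =
d(∂̄u)`, while `(dα)^{p,q} = ∂α^{p-1,q} + ∂̄α^{p,q-1}`. Since the targets are closed subspaces, it
is enough to check such generators (`opImClosure_strongExtension_le`).

On kernels the argument is dual. By `mem_opKer_weak_iff`, `ker P_w` consists of the `L²` sections
orthogonal to every `P^*w` with `w` a test section. Hence `ker P_w ⊆ ker Q_w` as soon as each `Q^*w`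
is of the form `P^*w'`. From `(∂∂̄)^* = ∂̄^*∂^* = -∂^*∂̄^*` both `ker ∂_w` and `ker ∂̄_w` lie in
`ker (∂∂̄)_w`; the component `(p,q)` of a weakly closed form lies there too, because `d^*∂^*w` has
`(p,q)`-component `∂̄^*∂^*w` and `(p-1,q+1)`-component `∂^*∂^*w = 0`.

The weak extension only speaks of pairs `(w, z)` with `⟨Pu, w⟩ = ⟨u, z⟩` for all test `u`, so the
argument needs `∂^*w` and `∂̄^*w` to exist as test forms. This is the analytic core,
`exists_isCodifferential`: in a chart, `d^*` is found by integrating by parts against the density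
`√det g` and inverting the inner product on `k`-forms; a partition of unity makes it global. The
adjoints of `∂` and `∂̄` are components of it.

The remaining ingredient is the orthogonal decomposition into types. Averaging over rotations by
roots of unity gives the projection to `Λ^{p,q}`; it commutes with holomorphic coordinate changes,
preserves smoothness and measurability, and is orthogonal since a Hermitian metric is invariant
under rotations. It therefore acts on `L²` forms, where it provides the map from de Rham to Aeppli
cohomology. -/

namespace L2Hodge
noncomputable section
-- Linear algebra of the decomposition into bidegrees
section TypeDecomposition

variable {E : Type*} [NormedAddCommGroup E] [NormedSpace ℂ E]

/-- A homogeneous polynomial of degree `k` in `c` and its conjugate. -/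
def IsHomogeneousInConj (k : ℕ) (f : ℂ → ℂ) : Prop :=
  ∃ A : ℕ → ℂ, ∀ c, f c = ∑ m ∈ Finset.range (k + 1), A m * (c ^ m * starRingEnd ℂ c ^ (k - m))

theorem IsHomogeneousInConj.add {k : ℕ} {f h : ℂ → ℂ} (hf : IsHomogeneousInConj k f)
    (hh : IsHomogeneousInConj k h) : IsHomogeneousInConj k fun c => f c + h c := by
  obtain ⟨A, hA⟩ := hf
  obtain ⟨B, hB⟩ := hh
  refine ⟨A + B, fun c => ?_⟩
  simp only [hA, hB, ← Finset.sum_add_distrib, Pi.add_apply, add_mul]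

theorem IsHomogeneousInConj.const_mul {k : ℕ} {f : ℂ → ℂ} (a : ℂ) (hf : IsHomogeneousInConj k f) :
    IsHomogeneousInConj k fun c => a * f c := by
  obtain ⟨A, hA⟩ := hf
  exact ⟨fun m => a * A m, fun c => by simp only [hA, Finset.mul_sum, mul_assoc]⟩

theorem IsHomogeneousInConj.sum {ι : Type*} (s : Finset ι) {k : ℕ} {f : ι → ℂ → ℂ}
    (hf : ∀ i ∈ s, IsHomogeneousInConj k (f i)) : IsHomogeneousInConj k fun c => ∑ i ∈ s, f i c := by
  classical
  induction s using Finset.induction_on with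
  | empty => exact ⟨0, fun c => by simp⟩
  | insert i s hi ih =>
    simp only [Finset.sum_insert hi]
    exact (hf i (by simp)).add (ih fun j hj => hf j (by simp [hj]))

theorem IsHomogeneousInConj.self_mul {k : ℕ} {f : ℂ → ℂ} (hf : IsHomogeneousInConj k f) :
    IsHomogeneousInConj (k + 1) fun c => c * f c := by
  obtain ⟨A, hA⟩ := hf
  -- Multiplication by `c` shifts the coefficients by one; multiplication by the conjugate, in the
  -- next lemma, leaves the power of `c` alone and adds a zero top coefficient.
  refine ⟨fun m => if m = 0 then 0 else A (m - 1), fun c => ?_⟩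
  beta_reduce
  rw [Finset.sum_range_succ', hA, Finset.mul_sum]
  simp only [Nat.add_eq_zero_iff, one_ne_zero, and_false, if_false, Nat.add_sub_cancel, if_true,
    zero_mul, add_zero, Nat.add_sub_add_right]
  exact Finset.sum_congr rfl fun m _ => by ring

theorem IsHomogeneousInConj.conj_mul {k : ℕ} {f : ℂ → ℂ} (hf : IsHomogeneousInConj k f) :
    IsHomogeneousInConj (k + 1) fun c => starRingEnd ℂ c * f c := by
  obtain ⟨A, hA⟩ := hf
  refine ⟨fun m => if m = k + 1 then 0 else A m, fun c => ?_⟩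
  beta_reduce
  rw [Finset.sum_range_succ, hA, Finset.mul_sum]
  simp only [if_true, zero_mul, add_zero]
  refine Finset.sum_congr rfl fun m hm => ?_
  have hm' : m < k + 1 := Finset.mem_range.1 hm
  rw [if_neg hm'.ne, Nat.succ_sub (Nat.lt_succ_iff.1 hm'), pow_succ]
  ring

/-- Each factor is `(c + c̄)/2` or `(c - c̄)/(2i)`, and so raises the degree by one. -/
theorem isHomogeneousInConj_prod {ι : Type*} (s : Finset ι) (t : Finset ι) [DecidableEq ι] :
    IsHomogeneousInConj t.card fun c => ∏ i ∈ t, (s.piecewise (fun _ => (c.re : ℂ))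
      (fun _ => (c.im : ℂ)) i) := by
  induction t using Finset.induction_on with
  | empty => exact ⟨fun _ => 1, fun c => by simp⟩
  | insert i t hi ih =>
    simp only [Finset.prod_insert hi, Finset.card_insert_of_notMem hi]
    by_cases h : i ∈ s
    · convert (ih.self_mul.const_mul (1 / 2)).add (ih.conj_mul.const_mul (1 / 2)) using 2 with c
      rw [Finset.piecewise_eq_of_mem _ _ _ h, Complex.re_eq_add_conj]
      ring
    · convert (ih.self_mul.const_mul (1 / (2 * Complex.I))).add
        (ih.conj_mul.const_mul (-1 / (2 * Complex.I))) using 2 with c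
      rw [Finset.piecewise_eq_of_notMem _ _ _ h, Complex.im_eq_sub_conj]
      ring

/-- `c ↦ α (c v₁, …, c v_k)` is a homogeneous polynomial in `c` and its conjugate. -/
theorem isHomogeneousInConj_apply_smul {k : ℕ} (α : E [⋀^Fin k]→L[ℝ] ℂ) (v : Fin k → E) :
    IsHomogeneousInConj k fun c => α fun i => c • v i := by
  have h : ∀ c : ℂ, (α fun i => c • v i) = ∑ s : Finset (Fin k),
      α (s.piecewise v fun i => Complex.I • v i) *
        ∏ i, (s.piecewise (fun _ => (c.re : ℂ)) (fun _ => (c.im : ℂ)) i) := by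
    intro c
    -- The form is only `ℝ`-multilinear, so `c` is split into real and imaginary parts; in the
    -- expansion `s` is the set of slots taking the real part.
    have h1 : (fun i => c • v i) = (fun i => c.re • v i) + fun i => c.im • (Complex.I • v i) := by
      funext i
      conv_lhs => rw [← Complex.re_add_im c]
      simp only [Pi.add_apply, add_smul, mul_smul, Complex.coe_smul]
    rw [h1]
    refine (α.toContinuousMultilinearMap.toMultilinearMap.map_add_univ _ _).trans
      (Finset.sum_congr rfl fun s _ => ?_)
    have h2 : (s.piecewise (fun i => c.re • v i) fun i => c.im • (Complex.I • v i)) =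
        fun i => s.piecewise (fun _ => c.re) (fun _ => c.im) i •
          s.piecewise v (fun i => Complex.I • v i) i := by
      funext i
      by_cases hi : i ∈ s <;> simp [hi]
    rw [h2]
    refine (α.toContinuousMultilinearMap.toMultilinearMap.map_smul_univ _ _).trans ?_
    rw [Complex.real_smul, mul_comm, Complex.ofReal_prod]
    congr 1
    refine Finset.prod_congr rfl fun i _ => ?_
    by_cases hi : i ∈ s <;> simp [hi]
  simp only [h]
  refine IsHomogeneousInConj.sum _ fun s _ => IsHomogeneousInConj.const_mul _ ?_
  simpa using isHomogeneousInConj_prod s (Finset.univ : Finset (Fin k))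

/-- Multiplication by a complex number as an `ℝ`-linear map. -/
def rotation (c : ℂ) : E →L[ℝ] E := c • ContinuousLinearMap.id ℝ E

@[simp] theorem rotation_apply (c : ℂ) (v : E) : rotation c v = c • v := rfl

/-- The order of the root of unity used for the projection to `Λ^{p,q}`. -/
def averagingOrder (p q : ℤ) : ℕ := 2 * (p.natAbs + q.natAbs) + 1

/-- A primitive root of unity of order `averagingOrder p q`. -/
def averagingRoot (p q : ℤ) : ℂ := Complex.exp (2 * Real.pi * Complex.I / averagingOrder p q)

theorem averagingRoot_isPrimitiveRoot (p q : ℤ) :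
    IsPrimitiveRoot (averagingRoot p q) (averagingOrder p q) :=
  Complex.isPrimitiveRoot_exp _ (by simp [averagingOrder])

theorem averagingRoot_ne_zero (p q : ℤ) : averagingRoot p q ≠ 0 := Complex.exp_ne_zero _

theorem conj_averagingRoot (p q : ℤ) :
    starRingEnd ℂ (averagingRoot p q) = (averagingRoot p q)⁻¹ := by
  rw [averagingRoot, ← Complex.exp_conj, ← Complex.exp_neg]
  congr 1
  simp [Complex.conj_ofReal, neg_div, Complex.conj_ofNat 2]

/-- The average over powers of a root of unity extracts one coefficient. -/
theorem average_zpow (p q m : ℤ) (h : |m - p| ≤ p.natAbs + q.natAbs) :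
    ∑ j ∈ Finset.range (averagingOrder p q),
      (averagingOrder p q : ℂ)⁻¹ * (averagingRoot p q ^ (2 * (m - p))) ^ j =
        if m = p then 1 else 0 := by
  have hN : (averagingOrder p q : ℂ) ≠ 0 := Nat.cast_ne_zero.2 (by simp [averagingOrder])
  rw [← Finset.mul_sum]
  split_ifs with hm
  · subst hm; simp [hN]
  -- The order is odd, so the factor `2` can be cancelled, and it exceeds `|m - p|`, so it cannot
  -- divide a nonzero `m - p`.
  · have h1 : averagingRoot p q ^ (2 * (m - p)) ≠ 1 := by
      rw [Ne, (averagingRoot_isPrimitiveRoot p q).zpow_eq_one_iff_dvd]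
      intro hd
      have hc : IsCoprime (averagingOrder p q : ℤ) 2 :=
        ⟨1, -(p.natAbs + q.natAbs), by simp only [averagingOrder]; push_cast; ring⟩
      have hd' := hc.dvd_of_dvd_mul_left hd
      have := Int.le_of_dvd (abs_pos.2 (sub_ne_zero.2 hm)) ((dvd_abs _ _).2 hd')
      simp only [averagingOrder] at this
      omega
    rw [geom_sum_eq h1, ← zpow_natCast, ← zpow_mul, mul_comm (2 * (m - p)), zpow_mul, zpow_natCast,
      (averagingRoot_isPrimitiveRoot p q).pow_eq_one]
    simp

/-- The projection to forms of bidegree `(p, q)` on `k`-forms. -/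
def typeProjDeg (p q : ℤ) (k : ℕ) : (E [⋀^Fin k]→L[ℝ] ℂ) →L[ℝ] (E [⋀^Fin k]→L[ℝ] ℂ) :=
  if (k : ℤ) = p + q then
    ∑ j ∈ Finset.range (averagingOrder p q),
      -- On `Λ^{p,q}` the rotation by a unit complex number `c` acts as `c^(p-q)`; this weight
      -- undoes that action before averaging.
      ((averagingOrder p q : ℂ)⁻¹ * (averagingRoot p q ^ (q - p)) ^ j) •
        ContinuousAlternatingMap.compContinuousLinearMapCLM (rotation (averagingRoot p q ^ j))
  else 0

theorem typeProjDeg_of_ne {p q : ℤ} {k : ℕ} (h : (k : ℤ) ≠ p + q) (α : E [⋀^Fin k]→L[ℝ] ℂ) :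
    typeProjDeg p q k α = 0 := by simp [typeProjDeg, h]

theorem typeProjDeg_apply {p q : ℤ} {k : ℕ} (h : (k : ℤ) = p + q) (α : E [⋀^Fin k]→L[ℝ] ℂ)
    (v : Fin k → E) :
    typeProjDeg p q k α v = ∑ j ∈ Finset.range (averagingOrder p q),
      ((averagingOrder p q : ℂ)⁻¹ * (averagingRoot p q ^ (q - p)) ^ j) *
        α fun i => averagingRoot p q ^ j • v i := by
  simp only [typeProjDeg, h, if_true]
  simp [_root_.sum_apply, ContinuousAlternatingMap.sum_apply, Function.comp_def]

theorem typeProjDeg_smul (p q : ℤ) {k : ℕ} (a : ℂ) (α : E [⋀^Fin k]→L[ℝ] ℂ) :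
    typeProjDeg p q k (a • α) = a • typeProjDeg p q k α := by
  by_cases h : (k : ℤ) = p + q
  · ext v
    simp only [typeProjDeg_apply h, ContinuousAlternatingMap.smul_apply, smul_eq_mul,
      Finset.mul_sum]
    exact Finset.sum_congr rfl fun _ _ => by ring
  · rw [typeProjDeg_of_ne h, typeProjDeg_of_ne h]
    ext v
    simp

/-- With `ζ` the root of unity, replacing `c` by `ζ^j c` multiplies the monomial of index `m` by
`ζ^(j(2m-k))`. Together with the weight `ζ^(j(q-p))` and `k = p + q` this is `ζ^(2j(m-p))`, whose
average vanishes unless `m = p`. -/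
theorem average_coefficients {p q : ℤ} {k : ℕ} (h : (k : ℤ) = p + q) {f : ℂ → ℂ} {A : ℕ → ℂ}
    (hA : ∀ c, f c = ∑ m ∈ Finset.range (k + 1), A m * (c ^ m * starRingEnd ℂ c ^ (k - m)))
    (c : ℂ) :
    ∑ j ∈ Finset.range (averagingOrder p q),
      ((averagingOrder p q : ℂ)⁻¹ * (averagingRoot p q ^ (q - p)) ^ j) *
        f (averagingRoot p q ^ j * c) =
      ∑ m ∈ Finset.range (k + 1),
        if (m : ℤ) = p then A m * (c ^ m * starRingEnd ℂ c ^ (k - m)) else 0 := by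
  simp only [hA, Finset.mul_sum]
  rw [Finset.sum_comm]
  refine Finset.sum_congr rfl fun m hm => ?_
  have hm' : m ≤ k := Nat.lt_succ_iff.1 (Finset.mem_range.1 hm)
  have h1 := average_zpow p q m (by rw [abs_le]; omega)
  have h2 : ∀ j ∈ Finset.range (averagingOrder p q),
      (averagingOrder p q : ℂ)⁻¹ * (averagingRoot p q ^ (q - p)) ^ j *
        (A m * ((averagingRoot p q ^ j * c) ^ m *
          starRingEnd ℂ (averagingRoot p q ^ j * c) ^ (k - m))) =
      (averagingOrder p q : ℂ)⁻¹ * (averagingRoot p q ^ (2 * ((m : ℤ) - p))) ^ j *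
        (A m * (c ^ m * starRingEnd ℂ c ^ (k - m))) := by
    intro j _
    have h3 : (2 * ((m : ℤ) - p)) = (q - p) + m - ((k - m : ℕ) : ℤ) := by
      push_cast [Nat.cast_sub hm']; omega
    rw [h3, zpow_sub₀ (averagingRoot_ne_zero p q) (q - p + m),
      zpow_add₀ (averagingRoot_ne_zero p q) (q - p)]
    simp only [map_mul, map_pow, conj_averagingRoot, zpow_natCast, div_eq_mul_inv, mul_pow, inv_pow]
    ring
  rw [Finset.sum_congr rfl h2, ← Finset.sum_mul, h1]
  split_ifs <;> simp

/-- The projection to `Λ^{p,q}`. -/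
def typeProj (p q : ℤ) : CovectorAlgebra E →ₗ[ℂ] CovectorAlgebra E where
  toFun α k := typeProjDeg p q k (α k)
  map_add' α β := by funext k; simp
  map_smul' a α := by funext k; simp [typeProjDeg_smul]

theorem typeProj_apply (p q : ℤ) (α : CovectorAlgebra E) (k : ℕ) :
    typeProj p q α k = typeProjDeg p q k (α k) := rfl

/-- The average leaves at most the monomial `c^p c̄^q`, whose coefficient is read off at `c = 1`. -/
theorem typeProj_mem (p q : ℤ) (α : CovectorAlgebra E) : typeProj p q α ∈ ofType p q := by
  intro k c v hc
  rw [typeProj_apply]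
  by_cases h : (k : ℤ) = p + q
  · obtain ⟨A, hA⟩ := isHomogeneousInConj_apply_smul (α k) v
    have h1 := average_coefficients h hA c
    have h2 := average_coefficients h hA 1
    simp only [mul_one, mul_smul] at h1 h2
    rw [typeProjDeg_apply h, typeProjDeg_apply h, h1, h2, Finset.mul_sum]
    refine Finset.sum_congr rfl fun m hm => ?_
    have hm' : m ≤ k := Nat.lt_succ_iff.1 (Finset.mem_range.1 hm)
    split_ifs with hmp
    · have hq : q = ((k - m : ℕ) : ℤ) := by push_cast [Nat.cast_sub hm']; omega
      rw [← hmp, hq]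
      simp only [zpow_natCast, map_one, one_pow]
      ring
    · simp
  · simp [typeProjDeg_of_ne h]

/-- At `c = 1` the value of `α` is the sum of all coefficients of its polynomial, and the projection
to `(m, k - m)` returns the coefficient of index `m`. -/
theorem sum_typeProj {k : ℕ} {α : CovectorAlgebra E} (hα : α ∈ ofDegree (E := E) k) :
    ∑ i ∈ Finset.HasAntidiagonal.antidiagonal k, typeProj (i.1 : ℤ) (i.2 : ℤ) α = α := by
  funext l
  rw [Finset.sum_apply]
  by_cases hl : l = k
  · subst hl
    ext v
    obtain ⟨A, hA⟩ := isHomogeneousInConj_apply_smul (α l) v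
    have h0 : α l v = ∑ m ∈ Finset.range (l + 1), A m := by simpa using hA 1
    rw [ContinuousAlternatingMap.sum_apply, h0, Finset.Nat.sum_antidiagonal_eq_sum_range_succ_mk]
    refine Finset.sum_congr rfl fun m hm => ?_
    have hm' : m ≤ l := Nat.lt_succ_iff.1 (Finset.mem_range.1 hm)
    have h : (l : ℤ) = (m : ℤ) + ((l - m : ℕ) : ℤ) := by push_cast [Nat.cast_sub hm']; omega
    have h2 := average_coefficients h hA 1
    simp only [mul_one, one_pow, map_one, Nat.cast_inj] at h2
    rw [typeProj_apply, typeProjDeg_apply h, h2, Finset.sum_ite_eq', if_pos hm]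
  · rw [hα l (by exact_mod_cast hl)]
    exact Finset.sum_eq_zero fun i _ => by rw [typeProj_apply, hα l (by exact_mod_cast hl), map_zero]

/-- Scaling by the real number `2` multiplies a `k`-form by `2^k`, and a form of type `(p, q)` by
`2^(p+q)`. -/
theorem ofType_le_ofDegree (p q : ℤ) : ofType (E := E) p q ≤ ofDegree (p + q) := by
  intro α hα k hk
  ext v
  have h1 := hα k 2 v two_ne_zero
  have h2 : α k (fun i => (2 : ℂ) • v i) = (2 : ℂ) ^ (k : ℤ) * α k v := by
    have h3 : (fun i => (2 : ℂ) • v i) = fun i => (2 : ℝ) • v i := by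
      funext i; rw [← Complex.coe_smul]; norm_num
    rw [h3]
    refine (((α k).toContinuousMultilinearMap.toMultilinearMap.map_smul_univ
      (fun _ => (2 : ℝ)) v)).trans ?_
    simp [Complex.real_smul]
  have h3 : starRingEnd ℂ 2 = 2 := Complex.conj_ofNat 2
  rw [h2, h3, ← zpow_add₀ two_ne_zero] at h1
  by_contra h0
  have h4 := mul_right_cancel₀ h0 h1
  have h5 : ((2 : ℝ) ^ (k : ℤ)) = (2 : ℝ) ^ (p + q) := by
    apply Complex.ofReal_injective
    push_cast
    simpa using h4
  exact hk (zpow_right_injective₀ (by norm_num) (by norm_num) h5)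

/-- Rotation by a unit `c` acts on `Λ^{p,q}` as `c^(p-q)`. Two distinct bidegrees of equal total
degree differ in `p - q`; with `n` this difference, the rotation acts on them with opposite signs.
-/
theorem exists_unit_zpow_eq_neg_one {n : ℤ} (hn : n ≠ 0) :
    ∃ c : ℂ, c ≠ 0 ∧ starRingEnd ℂ c = c⁻¹ ∧ c ^ n = -1 := by
  refine ⟨Complex.exp (Real.pi * Complex.I / n), Complex.exp_ne_zero _, ?_, ?_⟩
  · rw [← Complex.exp_conj, ← Complex.exp_neg]
    congr 1
    simp [Complex.conj_ofReal, neg_div]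
  · rw [← Complex.exp_int_mul, mul_div_cancel₀ _ (by exact_mod_cast hn), Complex.exp_pi_mul_I]

theorem ofType_disjoint {p q p' q' : ℤ} (h : (p, q) ≠ (p', q')) {α : CovectorAlgebra E}
    (hα : α ∈ ofType p q) (hα' : α ∈ ofType p' q') : α = 0 := by
  by_cases hd : p + q = p' + q'
  · have hn : (p - q) - (p' - q') ≠ 0 := by
      intro h0
      apply h
      ext <;> simp <;> omega
    obtain ⟨c, hc, hcc, hcn⟩ := exists_unit_zpow_eq_neg_one hn
    funext k
    ext v
    have h1 := (hα k c v hc).symm.trans (hα' k c v hc)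
    rw [hcc, inv_zpow', inv_zpow', ← zpow_add₀ hc, ← zpow_add₀ hc, ← sub_eq_add_neg,
      ← sub_eq_add_neg] at h1
    have h2 : c ^ (p - q) = - c ^ (p' - q') := by
      rw [show p - q = (p - q) - (p' - q') + (p' - q') by ring, zpow_add₀ hc, hcn]; ring
    rw [h2] at h1
    have h3 : (2 * c ^ (p' - q')) * α k v = 0 := by linear_combination -h1
    simpa [zpow_ne_zero _ hc] using h3
  · funext k
    by_cases hk : (k : ℤ) = p + q
    · exact ofType_le_ofDegree p' q' hα' k (by omega)
    · exact ofType_le_ofDegree p q hα k hk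

theorem typeProj_mem_ofType {p q p' q' : ℤ} {α : CovectorAlgebra E} (hα : α ∈ ofType p' q') :
    typeProj p q α ∈ ofType p' q' := by
  intro k c v hc
  rw [typeProj_apply]
  by_cases h : (k : ℤ) = p + q
  · rw [typeProjDeg_apply h, typeProjDeg_apply h, Finset.mul_sum]
    refine Finset.sum_congr rfl fun j _ => ?_
    have h1 := hα k c (fun i => averagingRoot p q ^ j • v i) hc
    simp only [smul_comm c] at h1
    rw [h1]; ring
  · simp [typeProjDeg_of_ne h]

theorem typeProj_of_mem_ne {p q p' q' : ℤ} (h : (p, q) ≠ (p', q')) {α : CovectorAlgebra E}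
    (hα : α ∈ ofType p' q') : typeProj p q α = 0 :=
  ofType_disjoint h (typeProj_mem p q α) (typeProj_mem_ofType hα)

/-- A form of degree `k ≥ 0` is the sum of its projections to nonnegative bidegrees, and these
vanish on a form of any other type. -/
theorem ofType_eq_bot_of_neg {p q : ℤ} (h : p < 0 ∨ q < 0) {α : CovectorAlgebra E}
    (hα : α ∈ ofType p q) : α = 0 := by
  by_cases hd : 0 ≤ p + q
  · obtain ⟨k, hk⟩ := Int.eq_ofNat_of_zero_le hd
    have hα' := ofType_le_ofDegree p q hα
    rw [hk] at hα'
    rw [← sum_typeProj hα']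
    refine Finset.sum_eq_zero fun i _ => typeProj_of_mem_ne ?_ hα
    rintro hi
    rw [Prod.mk.injEq] at hi
    omega
  · funext k
    exact ofType_le_ofDegree p q hα k (by omega)

theorem typeProj_of_mem {p q : ℤ} {α : CovectorAlgebra E} (hα : α ∈ ofType p q) :
    typeProj p q α = α := by
  by_cases hn : p < 0 ∨ q < 0
  · rw [ofType_eq_bot_of_neg hn hα, map_zero]
  · push Not at hn
    obtain ⟨a, rfl⟩ := Int.eq_ofNat_of_zero_le hn.1
    obtain ⟨b, rfl⟩ := Int.eq_ofNat_of_zero_le hn.2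
    have hα' : α ∈ ofDegree (E := E) ((a + b : ℕ) : ℤ) := by
      push_cast; exact ofType_le_ofDegree _ _ hα
    conv_rhs => rw [← sum_typeProj hα']
    rw [Finset.sum_eq_single (a, b)]
    · intro i _ hi
      refine typeProj_of_mem_ne ?_ hα
      intro h
      apply hi
      simpa [Prod.ext_iff] using h
    · simp

/-- A complex linear map commutes with the rotations being averaged. Applied to differentials of
charts, this makes the type projection visible in every chart. -/
theorem typeProj_pullback (p q : ℤ) {L : E →L[ℝ] E} (hL : ∀ (c : ℂ) v, L (c • v) = c • L v)
    (α : CovectorAlgebra E) : typeProj p q (pullback L α) = pullback L (typeProj p q α) := by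
  funext k
  by_cases h : (k : ℤ) = p + q
  · ext v
    simp only [pullback, typeProj_apply, ContinuousAlternatingMap.compContinuousLinearMap_apply,
      typeProjDeg_apply h, Function.comp_def, hL]
  · simp only [typeProj_apply, pullback, typeProjDeg_of_ne h]
    rfl

theorem pullback_mem_ofType {p q : ℤ} {L : E →L[ℝ] E} (hL : ∀ (c : ℂ) v, L (c • v) = c • L v)
    {α : CovectorAlgebra E} (hα : α ∈ ofType p q) : pullback L α ∈ ofType p q := by
  intro k c v hc
  simp only [pullback, ContinuousAlternatingMap.compContinuousLinearMap_apply, Function.comp_def, hL]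
  exact hα k c _ hc

/-! ### Orthogonality of the bidegrees for a Hermitian metric -/

variable {G : E →L[ℝ] E →L[ℝ] ℝ}

/-- Invariance under `i` makes `i` skew for `G`. Writing `c = a + bi`, the cross terms cancel and
`a² + b² = 1` remains. -/
theorem pullbackMetric_rotation (hI : ∀ v w, G (Complex.I • v) (Complex.I • w) = G v w) {c : ℂ}
    (hc : starRingEnd ℂ c = c⁻¹) (hc0 : c ≠ 0) : pullbackMetric (rotation c) G = G := by
  have hn : c.re * c.re + c.im * c.im = 1 := by
    have : (Complex.normSq c : ℂ) = 1 := by rw [← Complex.mul_conj, hc, mul_inv_cancel₀ hc0]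
    rw [← Complex.normSq_apply]; exact_mod_cast this
  ext v w
  simp only [pullbackMetric, ContinuousLinearMap.bilinearComp_apply, rotation_apply]
  have h1 : ∀ v : E, c • v = c.re • v + c.im • (Complex.I • v) := by
    intro v
    conv_lhs => rw [← Complex.re_add_im c]
    simp only [add_smul, mul_smul, Complex.coe_smul]
  have h2 : G (Complex.I • v) w = - G v (Complex.I • w) := by
    rw [← hI (Complex.I • v) w, smul_smul, Complex.I_mul_I, neg_one_smul, map_neg]
    rfl
  rw [h1 v, h1 w]
  simp only [map_add, map_smul, _root_.add_apply, _root_.smul_apply, smul_eq_mul, hI, h2]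
  linear_combination (G v w) * hn

variable [FiniteDimensional ℂ E]

theorem covectorInner_smul_left (α β : CovectorAlgebra E) (a : ℂ) :
    covectorInner G (a • α) β = starRingEnd ℂ a * covectorInner G α β := by
  have : ∀ k, coeffs (a • α) k = a • coeffs α k := fun k => rfl
  simp only [covectorInner, this, tensorInner_smul, Finset.mul_sum]
  refine Finset.sum_congr rfl fun _ _ => ?_
  ring

theorem covectorInner_conj (hG : IsInner G) (α β : CovectorAlgebra E) :
    starRingEnd ℂ (covectorInner G β α) = covectorInner G α β :=
  (covectorCore hG).conj_inner_symm α β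

theorem covectorInner_smul_right (hG : IsInner G) (α β : CovectorAlgebra E) (a : ℂ) :
    covectorInner G α (a • β) = a * covectorInner G α β := by
  rw [← covectorInner_conj hG, covectorInner_smul_left, map_mul, Complex.conj_conj,
    covectorInner_conj hG]

theorem covectorInner_add_left (hG : IsInner G) (α β γ : CovectorAlgebra E) :
    covectorInner G (α + β) γ = covectorInner G α γ + covectorInner G β γ :=
  (covectorCore hG).add_left α β γ

theorem covectorInner_add_right (hG : IsInner G) (α β γ : CovectorAlgebra E) :
    covectorInner G α (β + γ) = covectorInner G α β + covectorInner G α γ := by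
  rw [← covectorInner_conj hG, covectorInner_add_left hG, map_add, covectorInner_conj hG,
    covectorInner_conj hG]

theorem tensorInner_zero_left {m k : ℕ} (N : Matrix (Fin m) (Fin m) ℝ)
    (h : (Fin k → Fin m) → ℂ) : tensorInner N 0 h = 0 := by simp [tensorInner]

theorem tensorInner_zero_right {m k : ℕ} (N : Matrix (Fin m) (Fin m) ℝ)
    (h : (Fin k → Fin m) → ℂ) : tensorInner N h 0 = 0 := by simp [tensorInner]

theorem coeffs_eq_zero {α : CovectorAlgebra E} {k : ℕ} (h : α k = 0) : coeffs α k = 0 := by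
  funext I; simp [coeffs, h]

theorem covectorInner_zero_left (β : CovectorAlgebra E) : covectorInner G 0 β = 0 :=
  Finset.sum_eq_zero fun k _ => by
    rw [coeffs_eq_zero (Pi.zero_apply k), tensorInner_zero_left, mul_zero]

theorem covectorInner_zero_right (α : CovectorAlgebra E) : covectorInner G α 0 = 0 :=
  Finset.sum_eq_zero fun k _ => by
    rw [coeffs_eq_zero (Pi.zero_apply k), tensorInner_zero_right, mul_zero]

theorem covectorInner_eq_zero_of_degree {a b : ℤ} (hab : a ≠ b) {α β : CovectorAlgebra E}
    (hα : α ∈ ofDegree a) (hβ : β ∈ ofDegree b) : covectorInner G α β = 0 := by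
  refine Finset.sum_eq_zero fun k _ => ?_
  by_cases hk : (k : ℤ) = a
  · rw [coeffs_eq_zero (hβ k (by omega)), tensorInner_zero_right, mul_zero]
  · rw [coeffs_eq_zero (hα k hk), tensorInner_zero_left, mul_zero]

theorem isUnit_rotation {c : ℂ} (hc : c ≠ 0) :
    IsUnit (LinearMap.toMatrix (realBasis E) (realBasis E) (rotation c : E →L[ℝ] E).toLinearMap) := by
  have h : (rotation c⁻¹ : E →L[ℝ] E).toLinearMap ∘ₗ (rotation c : E →L[ℝ] E).toLinearMap =
      LinearMap.id := by
    ext v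
    simp [smul_smul, inv_mul_cancel₀ hc]
  have h3 := congrArg (LinearMap.toMatrix (realBasis E) (realBasis E)) h
  rw [LinearMap.toMatrix_comp _ (realBasis E), LinearMap.toMatrix_id] at h3
  exact IsUnit.of_mul_eq_one_right _ h3

/-- Forms of different bidegrees are orthogonal for a Hermitian metric. -/
theorem covectorInner_eq_zero_of_type (hG : IsInner G)
    (hI : ∀ v w, G (Complex.I • v) (Complex.I • w) = G v w) {p q p' q' : ℤ}
    (h : (p, q) ≠ (p', q')) {α β : CovectorAlgebra E} (hα : α ∈ ofType p q)
    (hβ : β ∈ ofType p' q') : covectorInner G α β = 0 := by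
  by_cases hd : p + q = p' + q'
  · have hn : (p' - q') - (p - q) ≠ 0 := by
      intro h0
      apply h
      ext <;> simp <;> omega
    obtain ⟨c, hc, hcc, hcn⟩ := exists_unit_zpow_eq_neg_one hn
    -- The inner product is invariant under the rotation, which acts on `α` and `β` by opposite
    -- signs; hence it equals its own negative.
    have h1 := covectorInner_pullback (rotation c) (isUnit_rotation hc) G α β
    rw [pullbackMetric_rotation hI hcc hc] at h1
    have h2 : ∀ {r s : ℤ} {γ : CovectorAlgebra E}, γ ∈ ofType r s →
        pullback (rotation c) γ = c ^ (r - s) • γ := by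
      intro r s γ hγ
      funext k
      ext v
      have := hγ k c v hc
      rw [hcc, inv_zpow', ← zpow_add₀ hc, ← sub_eq_add_neg] at this
      exact this
    rw [h2 hα, h2 hβ, covectorInner_smul_left, covectorInner_smul_right hG, map_zpow₀, hcc,
      inv_zpow', ← mul_assoc, ← zpow_add₀ hc,
      show -(p - q) + (p' - q') = (p' - q') - (p - q) by ring, hcn] at h1
    linear_combination (-1 / 2 : ℂ) * h1
  · exact covectorInner_eq_zero_of_degree hd (ofType_le_ofDegree p q hα)
      (ofType_le_ofDegree p' q' hβ)

theorem covectorInner_sum_right (hG : IsInner G) {ι : Type*} (s : Finset ι) (α : CovectorAlgebra E)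
    (f : ι → CovectorAlgebra E) :
    covectorInner G α (∑ i ∈ s, f i) = ∑ i ∈ s, covectorInner G α (f i) := by
  classical
  induction s using Finset.induction_on with
  | empty =>
    rw [Finset.sum_empty, Finset.sum_empty, covectorInner_zero_right]
  | insert i s hi ih => rw [Finset.sum_insert hi, Finset.sum_insert hi,
      covectorInner_add_right hG, ih]

/-- The pairing with a form of bidegree `(p, q)` only sees the component of bidegree `(p, q)`. -/
theorem covectorInner_typeProj_right (hG : IsInner G)
    (hI : ∀ v w, G (Complex.I • v) (Complex.I • w) = G v w) {p q : ℤ} {α : CovectorAlgebra E}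
    (hα : α ∈ ofType p q) (β : CovectorAlgebra E) :
    covectorInner G α (typeProj p q β) = covectorInner G α β := by
  by_cases hn : p < 0 ∨ q < 0
  · rw [ofType_eq_bot_of_neg hn hα, covectorInner_zero_left, covectorInner_zero_left]
  · push Not at hn
    obtain ⟨a, rfl⟩ := Int.eq_ofNat_of_zero_le hn.1
    obtain ⟨b, rfl⟩ := Int.eq_ofNat_of_zero_le hn.2
    have hαd := ofType_le_ofDegree _ _ hα
    -- `β` may have mixed degree, while `sum_typeProj` needs a fixed one. Truncating to degree `a +
    -- b` changes neither side.
    let β' : CovectorAlgebra E := fun k => if k = a + b then β k else 0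
    have hβ' : β' ∈ ofDegree (E := E) ((a + b : ℕ) : ℤ) := by
      intro k hk
      exact if_neg (by exact_mod_cast hk)
    have h1 : covectorInner G α β = covectorInner G α β' := by
      refine Finset.sum_congr rfl fun k _ => ?_
      by_cases hk : k = a + b
      · have : coeffs β' k = coeffs β k := by
          funext I; simp [coeffs, β', hk]
        rw [this]
      · rw [coeffs_eq_zero (hαd k (by exact_mod_cast hk)), tensorInner_zero_left,
          tensorInner_zero_left]
    have h2 : typeProj (a : ℤ) (b : ℤ) β = typeProj (a : ℤ) (b : ℤ) β' := by
      funext k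
      rw [typeProj_apply, typeProj_apply]
      by_cases hk : k = a + b
      · simp [β', hk]
      · rw [typeProjDeg_of_ne (by exact_mod_cast hk), typeProjDeg_of_ne (by exact_mod_cast hk)]
    rw [h1, h2]
    conv_rhs => rw [← sum_typeProj hβ']
    rw [covectorInner_sum_right hG, Finset.sum_eq_single (a, b)]
    · intro i _ hi
      refine covectorInner_eq_zero_of_type hG hI ?_ hα (typeProj_mem _ _ _)
      intro h
      apply hi
      simp only [Prod.mk.injEq, Nat.cast_inj] at h
      ext <;> simp [h]
    · simp

theorem norm_covectorInner_typeProj_le (hG : IsInner G)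
    (hI : ∀ v w, G (Complex.I • v) (Complex.I • w) = G v w) (p q : ℤ) (α : CovectorAlgebra E) :
    ‖covectorInner G (typeProj p q α) (typeProj p q α)‖ ≤ ‖covectorInner G α α‖ := by
  set β := typeProj p q α with hβ
  have h1 : covectorInner G β β = covectorInner G β α :=
    covectorInner_typeProj_right hG hI (typeProj_mem p q α) α
  have h2 : covectorInner G α β = covectorInner G β β := by
    rw [← covectorInner_conj hG α β, ← h1, covectorInner_conj hG]
  -- Pythagoras: `β` is orthogonal to `α - β`.
  obtain ⟨γ, hγ⟩ : ∃ γ, γ = α + (-1 : ℂ) • β := ⟨_, rfl⟩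
  have h3 : covectorInner G α α = covectorInner G β β + covectorInner G γ γ := by
    rw [hγ, covectorInner_add_left hG, covectorInner_add_right hG, covectorInner_add_right hG,
      covectorInner_smul_left, covectorInner_smul_left, covectorInner_smul_right hG,
      covectorInner_smul_right hG, h2, ← h1]
    simp
  have h4 : ∀ δ : CovectorAlgebra E, covectorInner G δ δ = ((covectorInner G δ δ).re : ℂ) := by
    intro δ
    exact ((Complex.conj_eq_iff_real.1 (covectorInner_conj hG δ δ)).elim fun r hr => by
      rw [hr]; simp)
  have h5 : ∀ δ : CovectorAlgebra E, 0 ≤ (covectorInner G δ δ).re :=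
    fun δ => (covectorCore hG).re_inner_nonneg δ
  rw [h4 β, h4 α, Complex.norm_real, Complex.norm_real, Real.norm_of_nonneg (h5 _),
    Real.norm_of_nonneg (h5 _), h3, Complex.add_re]
  linarith [h5 γ]

end TypeDecomposition

/-! ### Forms in charts and the exterior derivative -/

section Charts

open Filter Topology

variable {E : Type*} [NormedAddCommGroup E] [NormedSpace ℂ E]
  {M : Type*} [TopologicalSpace M] [ChartedSpace E M] [IsManifold 𝓘(ℂ, E) ω M]
  {e e' : OpenPartialHomeomorph M E}

theorem contDiffOn_transition_complex (he : e ∈ atlas E M) (he' : e' ∈ atlas E M) :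
    ContDiffOn ℂ ω (e' ∘ e.symm) (e.target ∩ e.symm ⁻¹' e'.source) := by
  have h := (mem_groupoid_of_pregroupoid.1
    ((contDiffGroupoid ω 𝓘(ℂ, E)).compatible he he')).1
  have h' : ContDiffOn ℂ ω (𝓘(ℂ, E) ∘ (e.symm ≫ₕ e') ∘ 𝓘(ℂ, E).symm)
    (𝓘(ℂ, E).symm ⁻¹' (e.symm ≫ₕ e').source ∩ Set.range 𝓘(ℂ, E)) := h
  refine h'.mono fun y hy => ?_
  simpa using hy

theorem contDiffOn_transition (he : e ∈ atlas E M) (he' : e' ∈ atlas E M) :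
    ContDiffOn ℝ ∞ (e' ∘ e.symm) (e.target ∩ e.symm ⁻¹' e'.source) :=
  ((contDiffOn_transition_complex he he').restrict_scalars ℝ).of_le le_top

theorem isOpen_transition_source (e e' : OpenPartialHomeomorph M E) :
    IsOpen (e.target ∩ e.symm ⁻¹' e'.source) :=
  e.isOpen_inter_preimage_symm e'.open_source

theorem contDiffAt_transition (he : e ∈ atlas E M) (he' : e' ∈ atlas E M) {y : E}
    (hy : y ∈ e.target) (hy' : e.symm y ∈ e'.source) : ContDiffAt ℝ ∞ (e' ∘ e.symm) y :=
  (contDiffOn_transition he he').contDiffAt ((isOpen_transition_source e e').mem_nhds ⟨hy, hy'⟩)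

theorem differentiableAt_transition (he : e ∈ atlas E M) (he' : e' ∈ atlas E M) {y : E}
    (hy : y ∈ e.target) (hy' : e.symm y ∈ e'.source) : DifferentiableAt ℝ (e' ∘ e.symm) y :=
  (contDiffAt_transition he he' hy hy').differentiableAt (by simp)

theorem fderiv_transition_smul (he : e ∈ atlas E M) (he' : e' ∈ atlas E M) {y : E}
    (hy : y ∈ e.target) (hy' : e.symm y ∈ e'.source) (c : ℂ) (v : E) :
    fderiv ℝ (e' ∘ e.symm) y (c • v) = c • fderiv ℝ (e' ∘ e.symm) y v := by
  have h : DifferentiableAt ℂ (e' ∘ e.symm) y :=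
    ((contDiffOn_transition_complex he he').contDiffAt
      ((isOpen_transition_source e e').mem_nhds ⟨hy, hy'⟩)).differentiableAt (by simp)
  rw [h.fderiv_restrictScalars ℝ]
  simp

/-- The tangent space at a point is read in the preferred chart there, so the differential of
`e.symm` is that of a transition map. Hence it is complex linear and obeys the chain rule. -/
theorem chartFrame_eq (he : e ∈ atlas E M) {y : E} (hy : y ∈ e.target) :
    chartFrame e y = fderiv ℝ (chartAt E (e.symm y) ∘ e.symm) y := by
  have hd := (mdifferentiable_of_mem_atlas (I := 𝓘(ℝ, E)) he).mdifferentiableAt_symm hy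
  rw [chartFrame, hd.mfderiv]
  simp only [mfld_simps, fderivWithin_univ]
  rfl

theorem chartFrame_smul (he : e ∈ atlas E M) {y : E} (hy : y ∈ e.target) (c : ℂ) (v : E) :
    chartFrame e y (c • v) = c • chartFrame e y v := by
  rw [chartFrame_eq he hy]
  exact fderiv_transition_smul he (chart_mem_atlas E _) hy (mem_chart_source E _) c v

theorem transition_comp_eventuallyEq {e₀ : OpenPartialHomeomorph M E} {y : E}
    (hy : y ∈ e.target) (hy' : e.symm y ∈ e'.source) :
    e₀ ∘ e.symm =ᶠ[𝓝 y] (e₀ ∘ e'.symm) ∘ (e' ∘ e.symm) := by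
  filter_upwards [(isOpen_transition_source e e').mem_nhds ⟨hy, hy'⟩] with z hz
  simp only [Function.comp]
  rw [e'.left_inv hz.2]

theorem chartFrame_change (he : e ∈ atlas E M) (he' : e' ∈ atlas E M) {y : E}
    (hy : y ∈ e.target) (hy' : e.symm y ∈ e'.source) :
    chartFrame e y = (chartFrame e' (e' (e.symm y))).comp (fderiv ℝ (e' ∘ e.symm) y) := by
  have hz : e' (e.symm y) ∈ e'.target := e'.map_source hy'
  rw [chartFrame_eq he hy, chartFrame_eq he' hz, e'.left_inv hy',
    (transition_comp_eventuallyEq (e₀ := chartAt E (e.symm y)) hy hy').fderiv_eq]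
  refine fderiv_comp y (differentiableAt_transition he' (chart_mem_atlas E _) hz ?_)
    (differentiableAt_transition he he' hy hy')
  change e'.symm (e' (e.symm y)) ∈ _
  rw [e'.left_inv hy']
  exact mem_chart_source E _

theorem pullback_comp (L L' : E →L[ℝ] E) (α : CovectorAlgebra E) :
    pullback (L.comp L') α = pullback L' (pullback L α) := by
  funext k; ext v; rfl

theorem pullback_zero (L : E →L[ℝ] E) : pullback L (0 : CovectorAlgebra E) = 0 := by
  funext k; ext v; rfl

theorem Form.inChart_change (u : Form E M) (he : e ∈ atlas E M) (he' : e' ∈ atlas E M) {y : E}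
    (hy : y ∈ e.target) (hy' : e.symm y ∈ e'.source) :
    u.inChart e y = pullback (fderiv ℝ (e' ∘ e.symm) y) (u.inChart e' (e' (e.symm y))) := by
  rw [Form.inChart, chartFrame_change he he' hy hy', pullback_comp, Form.inChart, e'.left_inv hy']

theorem Form.IsSmooth.contDiffAt {u : Form E M} (hu : u.IsSmooth) (he : e ∈ atlas E M) (k : ℕ)
    {y : E} (hy : y ∈ e.target) : ContDiffAt ℝ ∞ (fun y => u.inChart e y k) y :=
  (hu e he k).contDiffAt (e.open_target.mem_nhds hy)

theorem Form.IsSmooth.differentiableAt {u : Form E M} (hu : u.IsSmooth) (he : e ∈ atlas E M)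
    (k : ℕ) {y : E} (hy : y ∈ e.target) : DifferentiableAt ℝ (fun y => u.inChart e y k) y :=
  (hu.contDiffAt he k hy).differentiableAt (by simp)

theorem minSmoothness_two_le_infty : minSmoothness ℝ 2 ≤ ∞ := by
  rw [minSmoothness_of_isRCLikeNormedField]
  exact WithTop.coe_le_coe.2 (le_top : (2 : ℕ∞) ≤ ⊤)

theorem extDeriv_zero {k : ℕ} (y : E) :
    extDeriv (fun _ => (0 : E [⋀^Fin k]→L[ℝ] ℂ)) y = 0 := by
  ext v
  simp [extDeriv, ContinuousAlternatingMap.alternatizeUncurryFin_apply]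

theorem Form.extD_inChart_zero (u : Form E M) (y : E) : u.extD.inChart e y 0 = 0 := by
  ext v; rfl

/-- The exterior derivative is `extDeriv` in every chart. -/
theorem Form.extD_inChart_succ {u : Form E M} (hu : u.IsSmooth) (he : e ∈ atlas E M) (k : ℕ)
    {y : E} (hy : y ∈ e.target) :
    u.extD.inChart e y (k + 1) = extDeriv (fun y => u.inChart e y k) y := by
  set e₀ := chartAt E (e.symm y) with he₀
  have hy₀ : e.symm y ∈ e₀.source := mem_chart_source E _
  have h₀ : e₀ ∈ atlas E M := chart_mem_atlas E _
  -- `extD` is computed in the preferred chart `e₀` at the point; the two local expressions differ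
  -- by pull-back along the transition map, with which `extDeriv` commutes.
  have h1 : (fun z => u.inChart e z k) =ᶠ[𝓝 y] fun z =>
      (u.inChart e₀ ((e₀ ∘ e.symm) z) k).compContinuousLinearMap (fderiv ℝ (e₀ ∘ e.symm) z) := by
    filter_upwards [(isOpen_transition_source e e₀).mem_nhds ⟨hy, hy₀⟩] with z hz
    rw [u.inChart_change he h₀ hz.1 hz.2]
    rfl
  have hd : DifferentiableAt ℝ (fun z => u.inChart e₀ z k) ((e₀ ∘ e.symm) y) :=
    hu.differentiableAt h₀ k (e₀.map_source hy₀)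
  rw [h1.extDeriv_eq, extDeriv_pullback hd (contDiffAt_transition he h₀ hy hy₀)
    minSmoothness_two_le_infty, ← chartFrame_eq he hy]
  rfl

theorem Form.IsSmooth.extD {u : Form E M} (hu : u.IsSmooth) : u.extD.IsSmooth := by
  intro e he k
  rcases k with _ | k
  · simp only [Form.extD_inChart_zero]
    exact contDiffOn_const
  · have h : ContDiffOn ℝ ∞ (fderiv ℝ fun y => u.inChart e y k) e.target :=
      (hu e he k).fderiv_of_isOpen e.open_target (by simp)
    refine ((ContinuousAlternatingMap.alternatizeUncurryFinCLM ℝ E ℂ).contDiff.comp_contDiffOn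
      h).congr fun y hy => ?_
    rw [Form.extD_inChart_succ hu he k hy]
    rfl

/-- The inner derivative at nearby points uses their own preferred charts. Chart independence
rewrites it in the single chart at `x`, where `extDeriv` squares to zero. -/
theorem Form.extD_extD {u : Form E M} (hu : u.IsSmooth) : u.extD.extD = 0 := by
  funext x k
  have hx := mem_chart_target E x
  have he := chart_mem_atlas E x
  rcases k with _ | _ | k
  · rfl
  · have : (fun y => u.extD.inChart (chartAt E x) y 0) = fun _ => 0 := by
      funext y; exact u.extD_inChart_zero y
    simp only [Form.extD, this]
    exact extDeriv_zero _
  · have : (fun y => u.extD.inChart (chartAt E x) y (k + 1)) =ᶠ[𝓝 (chartAt E x x)]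
        extDeriv fun y => u.inChart (chartAt E x) y k := by
      filter_upwards [(chartAt E x).open_target.mem_nhds hx] with y hy
      exact Form.extD_inChart_succ hu he k hy
    change extDeriv (fun y => u.extD.inChart (chartAt E x) y (k + 1)) (chartAt E x x) = 0
    rw [this.extDeriv_eq]
    exact extDeriv_extDeriv_apply (r := ∞) (hu.contDiffAt he k hx) minSmoothness_two_le_infty

theorem Form.IsSmooth.add {u v : Form E M} (hu : u.IsSmooth) (hv : v.IsSmooth) :
    (u + v).IsSmooth := fun e he k => (hu e he k).add (hv e he k)

theorem Form.isSmooth_zero : (0 : Form E M).IsSmooth := by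
  intro e he k
  have : ∀ y, (0 : Form E M).inChart e y k = 0 := fun y => by ext v; rfl
  simp only [this]
  exact contDiffOn_const

theorem Form.extD_add {u v : Form E M} (hu : u.IsSmooth) (hv : v.IsSmooth) :
    (u + v).extD = u.extD + v.extD := by
  funext x k
  rcases k with _ | k
  · simp [Form.extD]
  · exact extDeriv_add (hu.differentiableAt (chart_mem_atlas E x) k (mem_chart_target E x))
      (hv.differentiableAt (chart_mem_atlas E x) k (mem_chart_target E x))

theorem Form.extD_zero : (0 : Form E M).extD = 0 := by
  have h := Form.extD_add (Form.isSmooth_zero (E := E) (M := M)) Form.isSmooth_zero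
  rw [add_zero] at h
  exact left_eq_add.1 h

theorem Form.IsSmooth.sum {ι : Type*} (s : Finset ι) {u : ι → Form E M}
    (hu : ∀ i ∈ s, (u i).IsSmooth) : (∑ i ∈ s, u i).IsSmooth := by
  classical
  induction s using Finset.induction_on with
  | empty => exact Form.isSmooth_zero
  | insert i s hi ih =>
    rw [Finset.sum_insert hi]
    exact (hu i (by simp)).add (ih fun j hj => hu j (by simp [hj]))

theorem Form.extD_sum {ι : Type*} (s : Finset ι) {u : ι → Form E M}
    (hu : ∀ i ∈ s, (u i).IsSmooth) : (∑ i ∈ s, u i).extD = ∑ i ∈ s, (u i).extD := by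
  classical
  induction s using Finset.induction_on with
  | empty => exact Form.extD_zero
  | insert i s hi ih =>
    rw [Finset.sum_insert hi, Finset.sum_insert hi, Form.extD_add (hu i (by simp))
      (Form.IsSmooth.sum s fun j hj => hu j (by simp [hj])), ih fun j hj => hu j (by simp [hj])]

theorem Form.extD_smul (c : ℂ) {u : Form E M} (hu : u.IsSmooth) :
    (c • u).extD = c • u.extD := by
  funext x k
  rcases k with _ | k
  · ext v
    simp [Form.extD]
  · have h : fderiv ℝ (fun y => (c • u).inChart (chartAt E x) y k) (chartAt E x x) =
        c • fderiv ℝ (fun y => u.inChart (chartAt E x) y k) (chartAt E x x) :=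
      ((hu.differentiableAt (chart_mem_atlas E x) k
        (mem_chart_target E x)).hasFDerivAt.const_smul c).fderiv
    change ContinuousAlternatingMap.alternatizeUncurryFin
        (fderiv ℝ (fun y => (c • u).inChart (chartAt E x) y k) (chartAt E x x)) =
      c • ContinuousAlternatingMap.alternatizeUncurryFin
        (fderiv ℝ (fun y => u.inChart (chartAt E x) y k) (chartAt E x x))
    rw [h]
    ext v
    simp only [ContinuousAlternatingMap.alternatizeUncurryFin_apply, _root_.smul_apply,
      ContinuousAlternatingMap.smul_apply, Finset.smul_sum]
    exact Finset.sum_congr rfl fun i _ => smul_comm _ _ _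

theorem Form.extD_eq_zero_of_eventuallyEq {u : Form E M} {x : M} (h : u =ᶠ[𝓝 x] 0) :
    u.extD x = 0 := by
  have hx := mem_chart_target E x
  have hc : Tendsto (chartAt E x).symm (𝓝 (chartAt E x x)) (𝓝 x) := by
    have := (chartAt E x).continuousAt_symm hx
    rwa [ContinuousAt, (chartAt E x).left_inv (mem_chart_source E x)] at this
  funext k
  rcases k with _ | k
  · rfl
  · have h1 : (fun y => u.inChart (chartAt E x) y k) =ᶠ[𝓝 (chartAt E x x)] fun _ => 0 := by
      filter_upwards [hc.eventually h] with y hy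
      rw [Form.inChart, hy]
      exact congrFun (pullback_zero _) k
    change extDeriv (fun y => u.inChart (chartAt E x) y k) (chartAt E x x) = 0
    rw [h1.extDeriv_eq, extDeriv_zero]

theorem Form.tsupport_extD_subset (u : Form E M) : tsupport u.extD ⊆ tsupport u := by
  refine closure_minimal (fun x hx => ?_) (isClosed_tsupport u)
  by_contra h
  exact hx (Form.extD_eq_zero_of_eventuallyEq (notMem_tsupport_iff_eventuallyEq.1 h))

/-! ### The operators `∂` and `∂̄` and their bidegrees -/

theorem linearPart_smul {k : ℕ} (L : E →L[ℝ] E [⋀^Fin k]→L[ℝ] ℂ) (c : ℂ) (v : E) :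
    linearPart L (c • v) = c • linearPart L v := by
  have h1 : ∀ v : E, c • v = c.re • v + c.im • (Complex.I • v) := by
    intro v
    conv_lhs => rw [← Complex.re_add_im c]
    simp only [add_smul, mul_smul, Complex.coe_smul]
  ext w
  simp only [linearPart, _root_.smul_apply, _root_.sub_apply, ContinuousLinearMap.comp_apply,
    ContinuousLinearMap.id_apply, h1, map_add, map_smul,
    ContinuousAlternatingMap.smul_apply, ContinuousAlternatingMap.sub_apply,
    ContinuousAlternatingMap.add_apply, smul_smul Complex.I Complex.I, Complex.I_mul_I,
    neg_one_smul, map_neg, ContinuousAlternatingMap.neg_apply, smul_eq_mul, Complex.real_smul]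
  conv_rhs => rw [← Complex.re_add_im c]
  linear_combination ((1 / 2 : ℂ) * c.im * (L (Complex.I • v)) w) * Complex.I_sq

theorem antilinearPart_smul {k : ℕ} (L : E →L[ℝ] E [⋀^Fin k]→L[ℝ] ℂ) (c : ℂ) (v : E) :
    antilinearPart L (c • v) = starRingEnd ℂ c • antilinearPart L v := by
  have h1 : ∀ v : E, c • v = c.re • v + c.im • (Complex.I • v) := by
    intro v
    conv_lhs => rw [← Complex.re_add_im c]
    simp only [add_smul, mul_smul, Complex.coe_smul]
  have h2 : starRingEnd ℂ c = c.re - c.im * Complex.I := by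
    apply Complex.ext <;> simp
  ext w
  simp only [antilinearPart, _root_.smul_apply, _root_.add_apply, ContinuousLinearMap.comp_apply,
    ContinuousLinearMap.id_apply, h1, map_add, map_smul,
    ContinuousAlternatingMap.smul_apply,
    ContinuousAlternatingMap.add_apply, smul_smul Complex.I Complex.I, Complex.I_mul_I,
    neg_one_smul, map_neg, ContinuousAlternatingMap.neg_apply, smul_eq_mul, Complex.real_smul, h2]
  linear_combination ((1 / 2 : ℂ) * c.im * (L (Complex.I • v)) w) * Complex.I_sq

/-- Chart differentials are complex linear, so local expressions keep their type. The type condition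
is linear with constant coefficients and thus passes to derivatives. -/
theorem fderiv_inChart_apply_smul {u : Form E M} (hu : u.IsSmooth) {p q : ℤ}
    (hpq : ∀ x, u x ∈ ofType (E := E) p q) (he : e ∈ atlas E M) {y : E} (hy : y ∈ e.target) (k : ℕ)
    {c : ℂ} (hc : c ≠ 0) (v : E) (w : Fin k → E) :
    fderiv ℝ (fun y => u.inChart e y k) y v (fun i => c • w i) =
      c ^ p * starRingEnd ℂ c ^ q * fderiv ℝ (fun y => u.inChart e y k) y v w := by
  have hd := hu.differentiableAt he k hy
  rw [← fderiv_continuousAlternatingMap_apply_const_apply hd,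
    ← fderiv_continuousAlternatingMap_apply_const_apply hd]
  have h1 : (fun y => u.inChart e y k fun i => c • w i) =ᶠ[𝓝 y]
      fun y => (c ^ p * starRingEnd ℂ c ^ q) • u.inChart e y k w := by
    filter_upwards [e.open_target.mem_nhds hy] with z hz
    exact pullback_mem_ofType (chartFrame_smul he hz) (hpq _) k c w hc
  rw [h1.fderiv_eq, fderiv_fun_const_smul (hd.continuousAlternatingMap_apply_const w)]
  rfl

/-- The slots of the form contribute `c^p c̄^q`, and the direction of differentiation one more `c`,
because only the complex linear part of the derivative is kept. For `∂̄` the extra factor is `c̄`.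
-/
theorem Form.del_mem_ofType {u : Form E M} (hu : u.IsSmooth) {p q : ℤ}
    (hpq : ∀ x, u x ∈ ofType (E := E) p q) (x : M) : u.del x ∈ ofType (E := E) (p + 1) q := by
  intro k c v hc
  rcases k with _ | k
  · simp [Form.del]
  · have h := fderiv_inChart_apply_smul hu hpq (chart_mem_atlas E x) (mem_chart_target E x) k hc
    set L := fderiv ℝ (fun y => u.inChart (chartAt E x) y k) (chartAt E x x) with hL
    have h' : ∀ a w, linearPart L a (fun i => c • w i) =
        c ^ p * starRingEnd ℂ c ^ q * linearPart L a w := by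
      intro a w
      simp only [linearPart, _root_.smul_apply, _root_.sub_apply, ContinuousLinearMap.comp_apply,
        ContinuousAlternatingMap.smul_apply, ContinuousAlternatingMap.sub_apply, h, smul_eq_mul]
      ring
    simp only [Form.del, ContinuousAlternatingMap.alternatizeUncurryFin_apply, linearPart_smul,
      Finset.mul_sum, ← hL]
    refine Finset.sum_congr rfl fun i _ => ?_
    have h1 : (i.removeNth fun j => c • v j) = fun j => c • i.removeNth v j := rfl
    rw [h1, ContinuousAlternatingMap.smul_apply, h', zpow_add_one₀ hc]
    simp only [smul_eq_mul, zsmul_eq_mul]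
    ring

theorem Form.delbar_mem_ofType {u : Form E M} (hu : u.IsSmooth) {p q : ℤ}
    (hpq : ∀ x, u x ∈ ofType (E := E) p q) (x : M) : u.delbar x ∈ ofType (E := E) p (q + 1) := by
  intro k c v hc
  rcases k with _ | k
  · simp [Form.delbar]
  · have h := fderiv_inChart_apply_smul hu hpq (chart_mem_atlas E x) (mem_chart_target E x) k hc
    set L := fderiv ℝ (fun y => u.inChart (chartAt E x) y k) (chartAt E x x) with hL
    have h' : ∀ a w, antilinearPart L a (fun i => c • w i) =
        c ^ p * starRingEnd ℂ c ^ q * antilinearPart L a w := by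
      intro a w
      simp only [antilinearPart, _root_.smul_apply, _root_.add_apply,
        ContinuousLinearMap.comp_apply, ContinuousAlternatingMap.smul_apply,
        ContinuousAlternatingMap.add_apply, h, smul_eq_mul]
      ring
    simp only [Form.delbar, ContinuousAlternatingMap.alternatizeUncurryFin_apply,
      antilinearPart_smul, Finset.mul_sum, ← hL]
    refine Finset.sum_congr rfl fun i _ => ?_
    have h1 : (i.removeNth fun j => c • v j) = fun j => c • i.removeNth v j := rfl
    rw [h1, ContinuousAlternatingMap.smul_apply, h',
      zpow_add_one₀ ((map_ne_zero (starRingEnd ℂ)).2 hc)]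
    simp only [smul_eq_mul, zsmul_eq_mul]
    ring

/-- The component of bidegree `(p, q)` of a form. -/
def Form.typePart (p q : ℤ) (u : Form E M) : Form E M := fun x => typeProj p q (u x)

theorem Form.typePart_mem (p q : ℤ) (u : Form E M) (x : M) :
    u.typePart p q x ∈ ofType (E := E) p q := typeProj_mem p q (u x)

theorem Form.typePart_add (p q : ℤ) (u v : Form E M) :
    (u + v).typePart p q = u.typePart p q + v.typePart p q :=
  funext fun x => map_add (typeProj p q) (u x) (v x)

theorem Form.typePart_smul (p q : ℤ) (c : ℂ) (u : Form E M) :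
    (c • u).typePart p q = c • u.typePart p q :=
  funext fun x => map_smul (typeProj p q) c (u x)

theorem Form.typePart_sum (p q : ℤ) {ι : Type*} (s : Finset ι) (u : ι → Form E M) :
    (∑ i ∈ s, u i).typePart p q = ∑ i ∈ s, (u i).typePart p q := by
  funext x
  simp only [Form.typePart, Finset.sum_apply, map_sum]

theorem Form.typePart_of_mem {p q : ℤ} {u : Form E M} (hu : ∀ x, u x ∈ ofType (E := E) p q) :
    u.typePart p q = u := funext fun x => typeProj_of_mem (hu x)

theorem Form.typePart_of_mem_ne {p q p' q' : ℤ} (h : (p, q) ≠ (p', q')) {u : Form E M}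
    (hu : ∀ x, u x ∈ ofType (E := E) p' q') : u.typePart p q = 0 :=
  funext fun x => typeProj_of_mem_ne h (hu x)

theorem Form.sum_typePart {k : ℕ} {u : Form E M} (hu : ∀ x, u x ∈ ofDegree (E := E) k) :
    ∑ i ∈ Finset.HasAntidiagonal.antidiagonal k, u.typePart (i.1 : ℤ) (i.2 : ℤ) = u := by
  funext x
  rw [Finset.sum_apply]
  exact sum_typeProj (hu x)

theorem Form.typePart_inChart (p q : ℤ) (u : Form E M) (he : e ∈ atlas E M) {y : E}
    (hy : y ∈ e.target) : (u.typePart p q).inChart e y = typeProj p q (u.inChart e y) :=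
  (typeProj_pullback p q (chartFrame_smul he hy) _).symm

theorem Form.IsSmooth.typePart (p q : ℤ) {u : Form E M} (hu : u.IsSmooth) :
    (u.typePart p q).IsSmooth := by
  intro e he k
  refine ((typeProjDeg p q k).contDiff.comp_contDiffOn (hu e he k)).congr fun y hy => ?_
  rw [Form.typePart_inChart p q u he hy]
  rfl

theorem Form.IsMeasurable.typePart [MeasurableSpace E] (p q : ℤ) {u : Form E M}
    (hu : u.IsMeasurable) : (u.typePart p q).IsMeasurable := by
  intro e he k v
  have h : (fun y : e.target => (u.typePart p q).inChart e (y : E) k v) =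
      fun y : e.target => typeProjDeg p q k (u.inChart e (y : E) k) v := by
    funext y
    rw [Form.typePart_inChart p q u he y.2]
    rfl
  rw [h]
  by_cases hk : (k : ℤ) = p + q
  · simp only [typeProjDeg_apply hk]
    exact Finset.measurable_sum _ fun j _ => (hu e he k _).const_mul _
  · simp only [typeProjDeg_of_ne hk]
    exact measurable_const

theorem Form.tsupport_typePart_subset (p q : ℤ) (u : Form E M) :
    tsupport (u.typePart p q) ⊆ tsupport u :=
  closure_mono fun x hx h => hx (by
    change typeProj p q (u x) = 0
    rw [h, map_zero])

/-! ### Test forms and the relations among `d`, `∂` and `∂̄` -/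

variable {S T : Submodule ℂ (CovectorAlgebra E)}

theorem Form.IsTest.mono (h : S ≤ T) {u : Form E M} (hu : u.IsTest S) : u.IsTest T :=
  ⟨hu.smooth, hu.compactSupport, fun x => h (hu.mem x)⟩

theorem Form.isTest_zero : (0 : Form E M).IsTest S :=
  ⟨Form.isSmooth_zero, HasCompactSupport.zero, fun _ => S.zero_mem⟩

theorem Form.IsTest.add {u v : Form E M} (hu : u.IsTest S) (hv : v.IsTest S) :
    (u + v).IsTest S :=
  ⟨hu.smooth.add hv.smooth, hu.compactSupport.add hv.compactSupport,
    fun x => S.add_mem (hu.mem x) (hv.mem x)⟩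

theorem Form.IsTest.extD {u : Form E M} (hu : u.IsTest S) : u.extD.IsTest ⊤ :=
  ⟨hu.smooth.extD, hu.compactSupport.mono' (subset_closure.trans u.tsupport_extD_subset),
    fun _ => trivial⟩

theorem Form.IsTest.typePart (p q : ℤ) {u : Form E M} (hu : u.IsTest S) :
    (u.typePart p q).IsTest (ofType p q) :=
  ⟨hu.smooth.typePart p q,
    hu.compactSupport.mono' (subset_closure.trans (u.tsupport_typePart_subset p q)),
    u.typePart_mem p q⟩

/-- This reduces `∂` to `d`: smoothness, compact support and the formal adjoint of `∂` all come from
those of `d` through the type projection. -/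
theorem Form.IsTest.del_eq {p q : ℤ} {u : Form E M} (hu : u.IsTest (ofType p q)) :
    u.del = u.extD.typePart (p + 1) q := by
  rw [u.extD_eq, Form.typePart_add, Form.typePart_of_mem (Form.del_mem_ofType hu.smooth hu.mem),
    Form.typePart_of_mem_ne (by simp) (Form.delbar_mem_ofType hu.smooth hu.mem), add_zero]

theorem Form.IsTest.delbar_eq {p q : ℤ} {u : Form E M} (hu : u.IsTest (ofType p q)) :
    u.delbar = u.extD.typePart p (q + 1) := by
  rw [u.extD_eq, Form.typePart_add, Form.typePart_of_mem (Form.delbar_mem_ofType hu.smooth hu.mem),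
    Form.typePart_of_mem_ne (by simp) (Form.del_mem_ofType hu.smooth hu.mem), zero_add]

theorem Form.IsTest.del {p q : ℤ} {u : Form E M} (hu : u.IsTest (ofType p q)) :
    u.del.IsTest (ofType (p + 1) q) := by
  rw [hu.del_eq]
  exact hu.extD.typePart _ _

theorem Form.IsTest.delbar {p q : ℤ} {u : Form E M} (hu : u.IsTest (ofType p q)) :
    u.delbar.IsTest (ofType p (q + 1)) := by
  rw [hu.delbar_eq]
  exact hu.extD.typePart _ _

theorem Form.IsTest.extD_extD_eq_zero {u : Form E M} {p q : ℤ} (hu : u.IsTest (ofType p q)) :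
    u.del.del + u.del.delbar + (u.delbar.del + u.delbar.delbar) = 0 := by
  rw [← Form.extD_eq, ← Form.extD_eq, ← Form.extD_add hu.del.smooth hu.delbar.smooth,
    ← Form.extD_eq, Form.extD_extD hu.smooth]

theorem Form.typePart_zero (p q : ℤ) : (0 : Form E M).typePart p q = 0 :=
  funext fun _ => map_zero (typeProj p q)

/-- The component of `d²u = 0` of bidegree `(p + 2, q)`; the other three terms have different
bidegrees. -/
theorem Form.IsTest.del_del {u : Form E M} {p q : ℤ} (hu : u.IsTest (ofType p q)) :
    u.del.del = 0 := by
  have h := congrArg (Form.typePart (p + 1 + 1) q) hu.extD_extD_eq_zero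
  rwa [Form.typePart_add, Form.typePart_add, Form.typePart_add, Form.typePart_zero,
    Form.typePart_of_mem hu.del.del.mem, Form.typePart_of_mem_ne (by simp) hu.del.delbar.mem,
    Form.typePart_of_mem_ne (by simp) hu.delbar.del.mem,
    Form.typePart_of_mem_ne (by simp; omega) hu.delbar.delbar.mem, add_zero, add_zero,
    add_zero] at h

theorem Form.IsTest.delbar_delbar {u : Form E M} {p q : ℤ} (hu : u.IsTest (ofType p q)) :
    u.delbar.delbar = 0 := by
  have h := congrArg (Form.typePart p (q + 1 + 1)) hu.extD_extD_eq_zero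
  rwa [Form.typePart_add, Form.typePart_add, Form.typePart_add, Form.typePart_zero,
    Form.typePart_of_mem hu.delbar.delbar.mem, Form.typePart_of_mem_ne (by simp) hu.delbar.del.mem,
    Form.typePart_of_mem_ne (by simp; omega) hu.del.del.mem,
    Form.typePart_of_mem_ne (by simp) hu.del.delbar.mem, zero_add, zero_add,
    zero_add] at h

theorem Form.IsTest.delbar_del {u : Form E M} {p q : ℤ} (hu : u.IsTest (ofType p q)) :
    u.del.delbar + u.delbar.del = 0 := by
  have h := hu.extD_extD_eq_zero
  rwa [hu.del_del, hu.delbar_delbar, zero_add, add_zero] at h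

end Charts

/-! ### Smoothness of the metric coefficients and the Riemannian measure -/

section RiemannianMeasure

open Filter Topology MeasureTheory

theorem contDiffOn_det {X : Type*} [NormedAddCommGroup X] [NormedSpace ℝ X] {n : ℕ} {s : Set X}
    {A : X → Matrix (Fin n) (Fin n) ℝ} (hA : ∀ i j, ContDiffOn ℝ ∞ (fun y => A y i j) s) :
    ContDiffOn ℝ ∞ (fun y => (A y).det) s := by
  simp only [Matrix.det_apply']
  exact ContDiffOn.sum fun σ _ => contDiffOn_const.mul (contDiffOn_prod fun i _ => hA _ _)

theorem contDiffOn_inv_apply {X : Type*} [NormedAddCommGroup X] [NormedSpace ℝ X] {n : ℕ}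
    {s : Set X} {A : X → Matrix (Fin n) (Fin n) ℝ}
    (hA : ∀ i j, ContDiffOn ℝ ∞ (fun y => A y i j) s) (hd : ∀ y ∈ s, (A y).det ≠ 0) (i j : Fin n) :
    ContDiffOn ℝ ∞ (fun y => (A y)⁻¹ i j) s := by
  simp only [Matrix.inv_def, Matrix.smul_apply, Ring.inverse_eq_inv', smul_eq_mul,
    Matrix.adjugate_apply]
  refine ((contDiffOn_det hA).inv hd).mul (contDiffOn_det fun k l => ?_)
  simp only [Matrix.updateRow_apply]
  split_ifs
  · exact contDiffOn_const
  · exact hA k l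

variable {E : Type*} [NormedAddCommGroup E] [NormedSpace ℂ E]
  {M : Type*} [TopologicalSpace M] [ChartedSpace E M] [IsManifold 𝓘(ℂ, E) ω M]
  {e e' : OpenPartialHomeomorph M E} (g : HermitianMetric E M)

theorem HermitianMetric.contDiffOn_inChart (he : e ∈ atlas E M) (v w : E) :
    ContDiffOn ℝ ∞ (fun y => g.inChart e y v w) e.target := by
  have hs : ContMDiffOn 𝓘(ℝ, E) 𝓘(ℝ, E) ∞ e.symm e.target :=
    contMDiffOn_symm_of_mem_maximalAtlas (IsManifold.subset_maximalAtlas he)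
  have ht := hs.contMDiffOn_tangentMapWithin (m := ∞) le_rfl e.open_target.uniqueMDiffOn
  have hvec : ∀ v : E, ContMDiffOn 𝓘(ℝ, E) (𝓘(ℝ, E).prod 𝓘(ℝ, E)) ∞
      (fun y => Bundle.TotalSpace.mk' E (E := fun x : M => TangentSpace 𝓘(ℝ, E) x) (e.symm y)
        (chartFrame e y v)) e.target := by
    intro v
    have hc : ContMDiffOn 𝓘(ℝ, E) (𝓘(ℝ, E).prod 𝓘(ℝ, E)) ∞
      (fun y : E => (⟨y, v⟩ : TangentBundle 𝓘(ℝ, E) E)) e.target :=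
      contMDiffOn_vectorSpace_iff_contDiffOn.2 contDiffOn_const
    refine (ht.comp hc fun y hy => hy).congr fun y hy => ?_
    simp only [Function.comp, tangentMapWithin, chartFrame]
    rw [mfderivWithin_of_isOpen e.open_target hy]
    rfl
  have hg := g.contMDiff.contMDiffOn (s := Set.univ) |>.comp hs (fun _ _ => Set.mem_univ _)
  have hfin := ContMDiffOn.clm_bundle_apply₂ (F₁ := E) (F₂ := E) (F₃ := ℝ)
    (E₃ := Bundle.Trivial M ℝ)
    (E₁ := fun x : M => TangentSpace 𝓘(ℝ, E) x) (E₂ := fun x : M => TangentSpace 𝓘(ℝ, E) x)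
    (b := e.symm) (ψ := fun y => g.inner (e.symm y)) hg (hvec v) (hvec w)
  intro y hy
  have h1 := hfin y hy
  simp only [Bundle.contMDiffWithinAt_totalSpace] at h1
  exact contMDiffWithinAt_iff_contDiffWithinAt.1 h1.2

theorem chartFrame_injective (he : e ∈ atlas E M) {y : E} (hy : y ∈ e.target) :
    Function.Injective (chartFrame e y) := by
  have h1 := (mdifferentiable_of_mem_atlas (I := 𝓘(ℝ, E)) he).comp_symm_deriv hy
  have h2 : Function.LeftInverse
      (mfderiv 𝓘(ℝ, E) 𝓘(ℝ, E) e (e.symm y) : E →L[ℝ] E) (chartFrame e y) :=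
    fun v => DFunLike.congr_fun h1 v
  exact h2.injective

theorem HermitianMetric.isInner_inChart (he : e ∈ atlas E M) {y : E} (hy : y ∈ e.target) :
    IsInner (g.inChart e y) where
  symm v w := (g.isInner (e.symm y)).symm (chartFrame e y v) (chartFrame e y w)
  pos v hv := by
    have h : chartFrame e y v ≠ 0 := fun h =>
      hv (chartFrame_injective he hy (h.trans (map_zero (chartFrame e y)).symm))
    exact (g.isInner (e.symm y)).pos (chartFrame e y v) h

theorem HermitianMetric.inChart_change (he : e ∈ atlas E M) (he' : e' ∈ atlas E M) {y : E}
    (hy : y ∈ e.target) (hy' : e.symm y ∈ e'.source) :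
    g.inChart e y =
      pullbackMetric (fderiv ℝ (e' ∘ e.symm) y) (g.inChart e' (e' (e.symm y))) := by
  rw [HermitianMetric.inChart, chartFrame_change he he' hy hy', HermitianMetric.inChart,
    e'.left_inv hy']
  rfl

variable [FiniteDimensional ℂ E]

theorem gram_pullbackMetric (L : E →L[ℝ] E) (G : E →L[ℝ] E →L[ℝ] ℝ) :
    gram (pullbackMetric L G) =
      (LinearMap.toMatrix (realBasis E) (realBasis E) L.toLinearMap).transpose * gram G *
        LinearMap.toMatrix (realBasis E) (realBasis E) L.toLinearMap := by
  set A := LinearMap.toMatrix (realBasis E) (realBasis E) L.toLinearMap with hA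
  have hLb : ∀ i, L (realBasis E i) = ∑ j, A j i • realBasis E j := by
    intro i
    have := (realBasis E).sum_repr (L (realBasis E i))
    rw [← this]
    refine Finset.sum_congr rfl fun j _ => ?_
    rw [hA, LinearMap.toMatrix_apply]; simp
  ext i j
  simp only [gram, pullbackMetric, Matrix.of_apply, ContinuousLinearMap.bilinearComp_apply, hLb,
    map_sum, map_smul, _root_.sum_apply, _root_.smul_apply, smul_eq_mul,
    Matrix.mul_apply, Matrix.transpose_apply, Finset.sum_mul, Finset.mul_sum]
  refine Finset.sum_congr rfl fun _ _ => Finset.sum_congr rfl fun _ _ => ?_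
  ring

theorem sqrt_det_gram_pullbackMetric (L : E →L[ℝ] E) (G : E →L[ℝ] E →L[ℝ] ℝ) :
    Real.sqrt (gram (pullbackMetric L G)).det = |L.det| * Real.sqrt (gram G).det := by
  rw [gram_pullbackMetric, Matrix.det_mul, Matrix.det_mul, Matrix.det_transpose,
    LinearMap.det_toMatrix]
  rw [show ∀ a b : ℝ, a * b * a = a ^ 2 * b by intros; ring, Real.sqrt_mul (sq_nonneg _),
    Real.sqrt_sq_eq_abs]

/-- The density `√det(g_{ij})` in the chart `e`. -/
def HermitianMetric.density (e : OpenPartialHomeomorph M E) (y : E) : ℝ :=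
  Real.sqrt (gram (g.inChart e y)).det

theorem HermitianMetric.det_gram_pos (he : e ∈ atlas E M) {y : E} (hy : y ∈ e.target) :
    0 < (gram (g.inChart e y)).det := (gram_posDef (g.isInner_inChart he hy)).det_pos

theorem HermitianMetric.density_pos (he : e ∈ atlas E M) {y : E} (hy : y ∈ e.target) :
    0 < g.density e y := Real.sqrt_pos.2 (g.det_gram_pos he hy)

theorem HermitianMetric.contDiffOn_density (he : e ∈ atlas E M) :
    ContDiffOn ℝ ∞ (g.density e) e.target :=
  (contDiffOn_det fun _ _ => g.contDiffOn_inChart he _ _).sqrt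
    fun _ hy => (g.det_gram_pos he hy).ne'

theorem HermitianMetric.contDiffOn_gram_inv (he : e ∈ atlas E M)
    (i j : Fin (Module.finrank ℝ E)) :
    ContDiffOn ℝ ∞ (fun y => (gram (g.inChart e y))⁻¹ i j) e.target :=
  contDiffOn_inv_apply (fun _ _ => g.contDiffOn_inChart he _ _)
    (fun _ hy => (g.det_gram_pos he hy).ne') i j

theorem HermitianMetric.density_change (he : e ∈ atlas E M) (he' : e' ∈ atlas E M) {y : E}
    (hy : y ∈ e.target) (hy' : e.symm y ∈ e'.source) :
    g.density e y = |(fderiv ℝ (e' ∘ e.symm) y).det| * g.density e' (e' (e.symm y)) := by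
  rw [HermitianMetric.density, g.inChart_change he he' hy hy', sqrt_det_gram_pullbackMetric]
  rfl

variable [MeasurableSpace E] [BorelSpace E] [MeasurableSpace M]

/-- The Riemannian measure of the domain of the chart `e`. -/
def HermitianMetric.chartMeasure (e : OpenPartialHomeomorph M E) : Measure M :=
  Measure.map e.symm (((realBasis E).addHaar.restrict e.target).withDensity
      fun y => ENNReal.ofReal (g.density e y))

variable [BorelSpace M]

theorem aemeasurable_symm (e : OpenPartialHomeomorph M E) (f : E → ENNReal) :
    AEMeasurable e.symm (((realBasis E).addHaar.restrict e.target).withDensity f) :=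
  (e.continuousOn_symm.aemeasurable e.open_target.measurableSet).mono_ac
    (withDensity_absolutelyContinuous _ _)

theorem HermitianMetric.chartMeasure_apply {A : Set M} (hA : MeasurableSet A) :
    g.chartMeasure e A = ∫⁻ y in e.symm ⁻¹' A ∩ e.target, ENNReal.ofReal (g.density e y)
      ∂(realBasis E).addHaar := by
  rw [HermitianMetric.chartMeasure, Measure.map_apply_of_aemeasurable (aemeasurable_symm e _) hA,
    withDensity_apply', Measure.restrict_restrict' e.open_target.measurableSet]

theorem measurableSet_symm_preimage_inter (e : OpenPartialHomeomorph M E) {A : Set M}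
    (hA : MeasurableSet A) : MeasurableSet (e.symm ⁻¹' A ∩ e.target) := by
  have h : Measurable fun y : e.target => e.symm y := e.continuousOn_symm.domRestrict.measurable
  have h1 := e.open_target.measurableSet.subtype_image (h hA)
  convert h1 using 1
  ext y
  simp [and_comm]

theorem HermitianMetric.chartMeasure_inter_source {A : Set M} (hA : MeasurableSet A) :
    g.chartMeasure e (A ∩ e.source) = g.chartMeasure e A := by
  rw [g.chartMeasure_apply hA, g.chartMeasure_apply (hA.inter e.open_source.measurableSet)]
  congr 2
  ext y
  simp only [Set.mem_inter_iff, Set.mem_preimage]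
  exact ⟨fun h => ⟨h.1.1, h.2⟩, fun h => ⟨⟨h.1, e.map_target h.2⟩, h.2⟩⟩

/-- Change of variables along the transition map: its Jacobian is exactly the ratio of the two
densities. -/
theorem HermitianMetric.chartMeasure_eq (he : e ∈ atlas E M) (he' : e' ∈ atlas E M) {A : Set M}
    (hA : MeasurableSet A) (h : A ⊆ e.source) (h' : A ⊆ e'.source) :
    g.chartMeasure e A = g.chartMeasure e' A := by
  rw [g.chartMeasure_apply hA, g.chartMeasure_apply hA]
  have himg : e'.symm ⁻¹' A ∩ e'.target = (e' ∘ e.symm) '' (e.symm ⁻¹' A ∩ e.target) := by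
    ext z
    constructor
    · rintro ⟨hz, hz'⟩
      refine ⟨e (e'.symm z), ⟨?_, e.map_source (h hz)⟩, ?_⟩
      · rw [Set.mem_preimage, e.left_inv (h hz)]; exact hz
      · simp only [Function.comp]
        rw [e.left_inv (h hz), e'.right_inv hz']
    · rintro ⟨y, ⟨hy, hy'⟩, rfl⟩
      refine ⟨?_, e'.map_source (h' hy)⟩
      simp only [Function.comp, Set.mem_preimage]
      rw [e'.left_inv (h' hy)]; exact hy
  have hinj : Set.InjOn (e' ∘ e.symm) (e.symm ⁻¹' A ∩ e.target) := by
    intro y hy z hz hyz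
    exact e.symm.injOn hy.2 hz.2 (e'.injOn (h' hy.1) (h' hz.1) hyz)
  rw [himg, lintegral_image_eq_lintegral_abs_det_fderiv_mul _
    (measurableSet_symm_preimage_inter e hA)
    (fun y hy => (differentiableAt_transition he he' hy.2 (h' hy.1)).hasFDerivAt.hasFDerivWithinAt)
    hinj]
  refine setLIntegral_congr_fun (measurableSet_symm_preimage_inter e hA) fun y hy => ?_
  rw [g.density_change he he' hy.2 (h' hy.1), ENNReal.ofReal_mul (abs_nonneg _)]
  rfl

theorem HermitianMetric.chartMeasure_le_vol (he : e ∈ atlas E M) : g.chartMeasure e ≤ g.vol :=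
  le_iSup (fun e : atlas E M => g.chartMeasure e.1) ⟨e, he⟩

/-- To bound the supremum defining `vol`, one measure must dominate all chart measures. Inside
`e.source` they agree with that of `e`; outside, the largest measure serves, and it is invisible on
subsets of `e.source`. -/
theorem HermitianMetric.vol_le (he : e ∈ atlas E M) :
    g.vol ≤ g.chartMeasure e + (⊤ : Measure M).restrict e.sourceᶜ := by
  refine iSup_le fun e' => ?_
  change g.chartMeasure e'.1 ≤ _
  have hs := e.open_source.measurableSet
  refine Measure.le_iff.2 fun A hA => ?_
  rw [← measure_inter_add_sdiff A hs, Measure.add_apply]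
  refine add_le_add ?_ ?_
  · rw [← g.chartMeasure_inter_source (hA.inter hs), ← g.chartMeasure_eq he e'.2
      ((hA.inter hs).inter e'.1.open_source.measurableSet)
      (fun _ hx => hx.1.2) (fun _ hx => hx.2)]
    exact measure_mono fun _ hx => hx.1.1
  · rw [Set.sdiff_eq, ← Measure.restrict_apply hA]
    exact (Measure.restrict_mono le_rfl le_top : (g.chartMeasure e'.1).restrict e.sourceᶜ ≤ _) A

theorem HermitianMetric.vol_apply (he : e ∈ atlas E M) {A : Set M} (hA : MeasurableSet A)
    (h : A ⊆ e.source) : g.vol A = g.chartMeasure e A := by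
  refine le_antisymm ?_ (g.chartMeasure_le_vol he A)
  refine (g.vol_le he A).trans ?_
  rw [Measure.add_apply, Measure.restrict_apply hA, ← Set.sdiff_eq,
    Set.sdiff_eq_empty.2 h, measure_empty, add_zero]

theorem HermitianMetric.vol_restrict_source (he : e ∈ atlas E M) :
    g.vol.restrict e.source = g.chartMeasure e := by
  ext A hA
  rw [Measure.restrict_apply hA, g.vol_apply he (hA.inter e.open_source.measurableSet)
    Set.inter_subset_right, g.chartMeasure_inter_source hA]

/-- In a chart the density is continuous, hence bounded on a compact neighbourhood. This makes
continuous compactly supported functions integrable, so that test forms are in `L²`. -/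
theorem HermitianMetric.isLocallyFiniteMeasure_vol : IsLocallyFiniteMeasure g.vol := by
  refine ⟨fun x => ?_⟩
  have he := chart_mem_atlas E x
  set e := chartAt E x
  have : FiniteDimensional ℝ E := FiniteDimensional.complexToReal E
  have : ProperSpace E := FiniteDimensional.proper ℝ E
  obtain ⟨K, hK, hxK, hKt⟩ := exists_compact_subset e.open_target (mem_chart_target E x)
  have hU : IsOpen (e.source ∩ e ⁻¹' interior K) := e.isOpen_inter_preimage isOpen_interior
  refine ⟨e.source ∩ e ⁻¹' interior K, hU.mem_nhds ⟨mem_chart_source E x, hxK⟩, ?_⟩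
  rw [g.vol_apply he hU.measurableSet Set.inter_subset_left, g.chartMeasure_apply hU.measurableSet]
  obtain ⟨C, hC⟩ := (hK.image_of_continuousOn
    ((g.contDiffOn_density he).continuousOn.mono hKt)).bddAbove
  calc _ ≤ ∫⁻ y in K, ENNReal.ofReal (g.density e y) ∂(realBasis E).addHaar := by
        refine lintegral_mono_set fun y hy => ?_
        have := hy.1.2
        rw [Set.mem_preimage, e.right_inv hy.2] at this
        exact interior_subset this
    _ ≤ ∫⁻ y in K, ENNReal.ofReal C ∂(realBasis E).addHaar :=
        setLIntegral_mono' hK.measurableSet fun y hy =>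
          ENNReal.ofReal_le_ofReal (hC ⟨y, hy, rfl⟩)
    _ < ⊤ := by
        rw [setLIntegral_const]
        exact ENNReal.mul_lt_top ENNReal.ofReal_lt_top hK.measure_lt_top

/-- Integration of functions supported in a chart domain. -/
theorem HermitianMetric.integral_eq_of_support (he : e ∈ atlas E M) {f : M → ℝ}
    (hf : Continuous f) (hsupp : ∀ x, x ∉ e.source → f x = 0) :
    ∫ x, f x ∂g.vol =
      ∫ y in e.target, g.density e y • f (e.symm y) ∂(realBasis E).addHaar := by
  rw [← setIntegral_eq_integral_of_forall_compl_eq_zero (s := e.source) hsupp,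
    g.vol_restrict_source he, HermitianMetric.chartMeasure,
    integral_map (aemeasurable_symm e _) hf.measurable.aestronglyMeasurable,
    integral_withDensity_eq_integral_toReal_smul₀]
  · refine setIntegral_congr_fun e.open_target.measurableSet fun y hy => ?_
    simp only [ENNReal.toReal_ofReal (g.density_pos he hy).le]
  · exact ((g.contDiffOn_density he).continuousOn.aemeasurable
      e.open_target.measurableSet).ennreal_ofReal
  · exact Eventually.of_forall fun y => ENNReal.ofReal_lt_top

end RiemannianMeasure

/-! ### Square-integrability of test forms -/

section TestForms

open Filter Topology MeasureTheory

variable {E : Type*} [NormedAddCommGroup E] [NormedSpace ℂ E] [FiniteDimensional ℂ E]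
  {M : Type*} [TopologicalSpace M] [ChartedSpace E M] [IsManifold 𝓘(ℂ, E) ω M]
  {e : OpenPartialHomeomorph M E} (g : HermitianMetric E M)

theorem Form.IsSmooth.continuousOn_apply {u : Form E M} (hu : u.IsSmooth) (he : e ∈ atlas E M)
    (k : ℕ) (v : Fin k → E) : ContinuousOn (fun y => u.inChart e y k v) e.target :=
  (ContinuousAlternatingMap.apply ℝ E ℂ v).continuous.comp_continuousOn (hu e he k).continuousOn

theorem HermitianMetric.continuous_formInner {u v : Form E M} (hu : u.IsSmooth)
    (hv : v.IsSmooth) : Continuous (g.formInner u v) := by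
  refine continuous_iff_continuousAt.2 fun x => ?_
  have he := chart_mem_atlas E x
  set e := chartAt E x
  have hx : x ∈ e.source := mem_chart_source E x
  have hF : ContinuousOn (fun y =>
      covectorInner (g.inChart e y) (u.inChart e y) (v.inChart e y)) e.target := by
    unfold covectorInner tensorInner coeffs
    refine continuousOn_finsetSum _ fun k _ => continuousOn_const.mul ?_
    refine continuousOn_finsetSum _ fun I _ => continuousOn_finsetSum _ fun J _ => ?_
    refine ContinuousOn.mul ?_ (ContinuousOn.mul ?_ (hv.continuousOn_apply he k _))
    · exact Complex.continuous_ofReal.comp_continuousOn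
        (continuousOn_finsetProd _ fun a _ => (g.contDiffOn_gram_inv he _ _).continuousOn)
    · exact Complex.continuous_conj.comp_continuousOn (hu.continuousOn_apply he k _)
  have h1 := (hF.comp e.continuousOn fun _ h => e.map_source h).continuousAt
    (e.open_source.mem_nhds hx)
  refine h1.congr ?_
  filter_upwards [e.open_source.mem_nhds hx] with z hz
  exact (g.formInner_eq u v he hz).symm

variable [MeasurableSpace E] [BorelSpace E] [MeasurableSpace M]

theorem Form.IsSmooth.isMeasurable {u : Form E M} (hu : u.IsSmooth) : u.IsMeasurable :=
  fun _ he k v => (hu.continuousOn_apply he k v).domRestrict.measurable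

variable [BorelSpace M] [SecondCountableTopology M]

theorem Form.IsTest.mem_squareIntegrable {S : Submodule ℂ (CovectorAlgebra E)} {u : Form E M}
    (hu : u.IsTest S) : u ∈ squareIntegrable g := by
  have := g.isLocallyFiniteMeasure_vol
  refine ⟨hu.smooth.isMeasurable,
    (g.continuous_formInner hu.smooth hu.smooth).integrable_of_hasCompactSupport ?_⟩
  refine hu.compactSupport.mono fun x hx h => hx ?_
  rw [HermitianMetric.formInner, h, covectorInner_zero_left]

end TestForms

set_option maxSynthPendingDepth 3

/-! ### Smooth forms on the manifold built from local expressions -/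

section SmoothForms

open Filter Topology MeasureTheory

variable {E : Type*} [NormedAddCommGroup E] [NormedSpace ℂ E] [FiniteDimensional ℂ E]

variable (E) in
/-- The coefficients of a `k`-form, as a linear map. -/
def coeffsCLM (k : ℕ) : (E [⋀^Fin k]→L[ℝ] ℂ) →L[ℝ] ((Fin k → Fin (Module.finrank ℝ E)) → ℂ) :=
  ContinuousLinearMap.pi fun I => ContinuousAlternatingMap.apply ℝ E ℂ fun a => realBasis E (I a)

theorem coeffsCLM_injective (k : ℕ) : Function.Injective (coeffsCLM E k) := by
  intro α β h
  apply ContinuousAlternatingMap.toAlternatingMap_injective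
  exact (realBasis E).ext_alternating fun I _ => congrFun h I

instance finiteDimensional_forms (k : ℕ) : FiniteDimensional ℝ (E [⋀^Fin k]→L[ℝ] ℂ) :=
  Module.Finite.of_injective (coeffsCLM E k).toLinearMap (coeffsCLM_injective k)

/-- The coefficient map is linear and injective into a finite-dimensional space, so it has a
continuous linear left inverse that recovers `f`. -/
theorem contDiffAt_of_coeffs {X : Type*} [NormedAddCommGroup X] [NormedSpace ℝ X] {k : ℕ}
    {f : X → E [⋀^Fin k]→L[ℝ] ℂ} {x : X}
    (h : ∀ I : Fin k → Fin (Module.finrank ℝ E),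
      ContDiffAt ℝ ∞ (fun y => f y fun a => realBasis E (I a)) x) : ContDiffAt ℝ ∞ f x := by
  obtain ⟨S, hS⟩ := (coeffsCLM E k).toLinearMap.exists_leftInverse_of_injective
    (LinearMap.ker_eq_bot.2 (coeffsCLM_injective k))
  have hf : f = S.toContinuousLinearMap ∘ fun y => coeffsCLM E k (f y) := by
    funext y
    exact (LinearMap.congr_fun hS (f y)).symm
  rw [hf]
  exact S.toContinuousLinearMap.contDiff.contDiffAt.comp x (contDiffAt_pi.2 h)

theorem apply_clm_basis {k : ℕ} (α : E [⋀^Fin k]→L[ℝ] ℂ) (L : E →L[ℝ] E)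
    (I : Fin k → Fin (Module.finrank ℝ E)) :
    (α fun a => L (realBasis E (I a))) = ∑ K : Fin k → Fin (Module.finrank ℝ E),
      (∏ a, (realBasis E).repr (L (realBasis E (I a))) (K a)) • α fun a => realBasis E (K a) := by
  have h1 : (fun a => L (realBasis E (I a))) =
      fun a => ∑ j, (realBasis E).repr (L (realBasis E (I a))) j • realBasis E j := by
    funext a
    exact ((realBasis E).sum_repr _).symm
  rw [h1]
  refine (α.toContinuousMultilinearMap.toMultilinearMap.map_sum
    (fun a j => (realBasis E).repr (L (realBasis E (I a))) j • realBasis E j)).trans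
    (Finset.sum_congr rfl fun K _ => ?_)
  exact α.toContinuousMultilinearMap.toMultilinearMap.map_smul_univ
    (fun a => (realBasis E).repr (L (realBasis E (I a))) (K a)) (fun a => realBasis E (K a))

/-- The coordinate functions of the basis `realBasis E`. -/
def realCoord (i : Fin (Module.finrank ℝ E)) : E →L[ℝ] ℝ :=
  LinearMap.toContinuousLinearMap ((realBasis E).coord i)

theorem sum_realCoord_smul (v : E) : ∑ i, realCoord i v • realBasis E i = v :=
  (realBasis E).sum_repr v

theorem contDiffAt_compContinuousLinearMap {X : Type*} [NormedAddCommGroup X] [NormedSpace ℝ X]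
    {k : ℕ} {f : X → E [⋀^Fin k]→L[ℝ] ℂ} {L : X → E →L[ℝ] E} {x : X} (hf : ContDiffAt ℝ ∞ f x)
    (hL : ContDiffAt ℝ ∞ L x) :
    ContDiffAt ℝ ∞ (fun y => (f y).compContinuousLinearMap (L y)) x := by
  refine contDiffAt_of_coeffs fun I => ?_
  have h : (fun y => (f y).compContinuousLinearMap (L y) fun a => realBasis E (I a)) =
      fun y => ∑ K : Fin k → Fin (Module.finrank ℝ E),
        (∏ a, realCoord (K a) (L y (realBasis E (I a)))) •
          ContinuousAlternatingMap.apply ℝ E ℂ (fun a => realBasis E (K a)) (f y) := by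
    funext y
    exact apply_clm_basis (f y) (L y) I
  rw [h]
  refine ContDiffAt.sum fun K _ => ?_
  have h1 : ContDiffAt ℝ ∞ (fun y => ∏ a, realCoord (K a) (L y (realBasis E (I a)))) x :=
    contDiffAt_prod fun a _ => (realCoord (K a)).contDiff.contDiffAt.comp x
      (hL.clm_apply contDiffAt_const)
  have h2 : ContDiffAt ℝ ∞ (fun y =>
      ContinuousAlternatingMap.apply ℝ E ℂ (fun a => realBasis E (K a)) (f y)) x :=
    (ContinuousAlternatingMap.apply ℝ E ℂ fun a =>
      realBasis E (K a)).contDiff.contDiffAt.comp x hf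
  exact h1.smul h2

variable {M : Type*} [TopologicalSpace M] [T2Space M] [ChartedSpace E M] [IsManifold 𝓘(ℂ, E) ω M]
  {e : OpenPartialHomeomorph M E}

/-- The differential of the chart `e` at `x`. -/
def chartCoframe (e : OpenPartialHomeomorph M E) (x : M) : E →L[ℝ] E :=
  mfderiv 𝓘(ℝ, E) 𝓘(ℝ, E) e x

theorem chartCoframe_comp_chartFrame (he : e ∈ atlas E M) {y : E} (hy : y ∈ e.target) :
    (chartCoframe e (e.symm y)).comp (chartFrame e y) = ContinuousLinearMap.id ℝ E := by
  have h1 := (mdifferentiable_of_mem_atlas (I := 𝓘(ℝ, E)) he).comp_symm_deriv hy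
  ext v
  exact DFunLike.congr_fun h1 v

/-- A smooth form with compact support in the range of a chart is the local expression of a smooth
form on the manifold. -/
theorem exists_isTest_inChart_eq (he : e ∈ atlas E M) {ζ : E → CovectorAlgebra E}
    (hζ : ∀ k, ContDiffOn ℝ ∞ (fun y => ζ y k) e.target) {K : Set E} (hK : IsCompact K)
    (hKt : K ⊆ e.target) (hζK : ∀ y ∈ e.target, y ∉ K → ζ y = 0) :
    ∃ z : Form E M, z.IsTest ⊤ ∧ (∀ y ∈ e.target, z.inChart e y = ζ y) ∧
      ∀ x, x ∉ e.source → z x = 0 := by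
  classical
  let z : Form E M := fun x => if x ∈ e.source then
    pullback (chartCoframe e x) (ζ (e x)) else 0
  have hz0 : ∀ x, x ∉ e.source → z x = 0 := fun x hx => if_neg hx
  have hze : ∀ y ∈ e.target, z.inChart e y = ζ y := by
    intro y hy
    simp only [Form.inChart, z, if_pos (e.map_target hy)]
    rw [← pullback_comp, chartCoframe_comp_chartFrame he hy, e.right_inv hy]
    funext k; ext v; rfl
  have hKM : IsCompact (e.symm '' K) := hK.image_of_continuousOn (e.continuousOn_symm.mono hKt)
  have hzK : ∀ x, x ∉ e.symm '' K → z x = 0 := by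
    intro x hx
    by_cases hxs : x ∈ e.source
    · have : ζ (e x) = 0 := hζK _ (e.map_source hxs) fun h => hx ⟨e x, h, e.left_inv hxs⟩
      simp only [z, if_pos hxs, this]
      exact pullback_zero _
    · exact hz0 x hxs
  refine ⟨z, ⟨?_, HasCompactSupport.intro hKM hzK, fun _ => trivial⟩, hze, hz0⟩
  intro e' he' k y hy
  refine ContDiffAt.contDiffWithinAt ?_
  by_cases hys : e'.symm y ∈ e.source
  · have h1 : (fun y => z.inChart e' y k) =ᶠ[𝓝 y] fun y =>
        (ζ ((e ∘ e'.symm) y) k).compContinuousLinearMap (fderiv ℝ (e ∘ e'.symm) y) := by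
      filter_upwards [(isOpen_transition_source e' e).mem_nhds ⟨hy, hys⟩] with y' hy'
      rw [z.inChart_change he' he hy'.1 hy'.2, hze _ (e.map_source hy'.2)]
      rfl
    refine ContDiffAt.congr_of_eventuallyEq ?_ h1
    have hφ := contDiffAt_transition he' he hy hys
    refine contDiffAt_compContinuousLinearMap ?_ (hφ.fderiv_right (by simp))
    exact ((hζ k).contDiffAt (e.open_target.mem_nhds (e.map_source hys))).comp y hφ
  · have h1 : (fun y => z.inChart e' y k) =ᶠ[𝓝 y] fun _ => 0 := by
      -- Here the Hausdorff property enters: the extension by zero is smooth outside `e.source`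
      -- because the compact support is closed in the whole manifold.
      have hcl : IsClosed (e.symm '' K) := hKM.isClosed
      have hyK : e'.symm y ∈ (e.symm '' K)ᶜ := by
        rintro ⟨y', hy', h⟩
        exact hys (h ▸ e.map_target (hKt hy'))
      filter_upwards [(e'.continuousAt_symm hy).preimage_mem_nhds
        (hcl.isOpen_compl.mem_nhds hyK)] with y' hy'
      rw [Form.inChart, hzK _ hy']
      exact congrFun (pullback_zero _) k
    exact contDiffAt_const.congr_of_eventuallyEq h1

end SmoothForms

/-! ### The inner product on `k`-forms as an invertible real pairing -/

section RealPairing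

variable {E : Type*} [NormedAddCommGroup E] [NormedSpace ℂ E] [FiniteDimensional ℂ E]

theorem tensorInner_one {m k : ℕ} (f h : (Fin k → Fin m) → ℂ) :
    tensorInner (1 : Matrix (Fin m) (Fin m) ℝ) f h = ∑ I, starRingEnd ℂ (f I) * h I := by
  have h1 : ∀ I J : Fin k → Fin m, (∏ a, (1 : Matrix (Fin m) (Fin m) ℝ) (I a) (J a)) =
      if I = J then 1 else 0 := by
    intro I J
    split_ifs with h
    · subst h; simp
    · obtain ⟨a, ha⟩ := Function.ne_iff.1 h
      exact Finset.prod_eq_zero (Finset.mem_univ a) (Matrix.one_apply_ne ha)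
  simp only [tensorInner, h1]
  refine Finset.sum_congr rfl fun I _ => ?_
  rw [Finset.sum_eq_single I] <;> simp +contextual [eq_comm]

/-- With `A⁻¹ = B Bᵀ`, the form is the sum of squares of the entries of `f` transformed by `B`. If
it vanishes, so does the pairing of `f` with every array. -/
theorem tensorInner_definite {m k : ℕ} {A : Matrix (Fin m) (Fin m) ℝ} (hA : A.PosDef)
    {f : (Fin k → Fin m) → ℂ} (hf : (tensorInner A⁻¹ f f).re = 0) : f = 0 := by
  obtain ⟨n, v, hv⟩ := Matrix.posSemidef_iff_eq_sum_vecMulVec.1 hA.inv.posSemidef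
  obtain ⟨B, hB⟩ : ∃ B : Matrix (Fin m) (Fin n) ℝ,
      A⁻¹ = B * (1 : Matrix (Fin n) (Fin n) ℝ) * B.transpose := by
    refine ⟨Matrix.of fun j i => v i j, ?_⟩
    rw [hv, Matrix.mul_one]
    ext i j
    simp [Matrix.mul_apply, Matrix.sum_apply, Matrix.vecMulVec_apply]
  have h0 : (fun I : Fin k → Fin n => ∑ K : Fin k → Fin m, ((∏ a, B (K a) (I a) : ℝ) : ℂ) * f K) = 0 := by
    rw [hB, ← tensorInner_change, tensorInner_one, Complex.re_sum] at hf
    have h1 := (Finset.sum_eq_zero_iff_of_nonneg fun I _ => by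
      rw [mul_comm, Complex.mul_conj, Complex.ofReal_re]
      exact Complex.normSq_nonneg _).1 hf
    funext I
    have h2 := h1 I (Finset.mem_univ I)
    rw [mul_comm, Complex.mul_conj, Complex.ofReal_re] at h2
    exact Complex.normSq_eq_zero.1 h2
  funext K
  -- The array made of columns of `A` is chosen because `A⁻¹ A = 1` turns the pairing with it into
  -- the conjugate of the entry `f K`.
  have h1 : tensorInner A⁻¹ f (fun J => ((∏ a, A (J a) (K a) : ℝ) : ℂ)) = 0 := by
    rw [hB, ← tensorInner_change, h0, tensorInner_zero_left]
  have h2 : ∀ I : Fin k → Fin m, ∑ J : Fin k → Fin m, (∏ a, A⁻¹ (I a) (J a)) *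
      ∏ a, A (J a) (K a) = if I = K then 1 else 0 := by
    intro I
    simp only [← Finset.prod_mul_distrib]
    have h3 := Finset.prod_univ_sum (fun _ : Fin k => (Finset.univ : Finset (Fin m)))
      fun a j => A⁻¹ (I a) j * A j (K a)
    rw [Fintype.piFinset_univ] at h3
    rw [← h3]
    have h4 : ∀ a, ∑ j, A⁻¹ (I a) j * A j (K a) = (1 : Matrix (Fin m) (Fin m) ℝ) (I a) (K a) := by
      intro a
      rw [← Matrix.mul_apply, Matrix.nonsing_inv_mul _ ((Matrix.isUnit_iff_isUnit_det _).1 hA.isUnit)]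
    simp only [h4]
    split_ifs with h
    · subst h; simp
    · obtain ⟨a, ha⟩ := Function.ne_iff.1 h
      exact Finset.prod_eq_zero (Finset.mem_univ a) (Matrix.one_apply_ne ha)
  have h3 : tensorInner A⁻¹ f (fun J => ((∏ a, A (J a) (K a) : ℝ) : ℂ)) =
      ∑ I, starRingEnd ℂ (f I) * ((∑ J : Fin k → Fin m, (∏ a, A⁻¹ (I a) (J a)) *
        ∏ a, A (J a) (K a) : ℝ) : ℂ) := by
    simp only [tensorInner, Complex.ofReal_sum, Complex.ofReal_mul, Finset.mul_sum]
    exact Finset.sum_congr rfl fun I _ => Finset.sum_congr rfl fun J _ => by ring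
  rw [h3, Finset.sum_eq_single K, h2, if_pos rfl, Complex.ofReal_one, mul_one] at h1
  · simpa using h1
  · intro I _ hI
    rw [h2, if_neg hI, Complex.ofReal_zero, mul_zero]
  · simp

/-- The real part of the Hermitian inner product on `k`-forms given by the inverse `N` of the Gram
matrix, as a bilinear map of the second and the first variable. -/
def degreePairing (N : Matrix (Fin (Module.finrank ℝ E)) (Fin (Module.finrank ℝ E)) ℝ) (k : ℕ) :
    (E [⋀^Fin k]→L[ℝ] ℂ) →L[ℝ] (E [⋀^Fin k]→L[ℝ] ℂ) →L[ℝ] ℝ :=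
  ∑ I : Fin k → Fin (Module.finrank ℝ E), ∑ J : Fin k → Fin (Module.finrank ℝ E),
    ((k.factorial : ℝ)⁻¹ * ∏ a, N (I a) (J a)) •
      (innerSL ℝ (E := ℂ)).bilinearComp
        (ContinuousAlternatingMap.apply ℝ E ℂ fun a => realBasis E (J a))
        (ContinuousAlternatingMap.apply ℝ E ℂ fun a => realBasis E (I a))

theorem degreePairing_apply (N : Matrix (Fin (Module.finrank ℝ E)) (Fin (Module.finrank ℝ E)) ℝ)
    (α β : CovectorAlgebra E) (k : ℕ) : degreePairing N k (β k) (α k) =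
      (((k.factorial : ℝ)⁻¹ : ℝ) * tensorInner N (coeffs α k) (coeffs β k)).re := by
  rw [Complex.re_ofReal_mul]
  simp only [degreePairing, tensorInner, _root_.sum_apply, _root_.smul_apply, Complex.re_sum,
    Finset.mul_sum, smul_eq_mul, mul_assoc]
  refine Finset.sum_congr rfl fun I _ => Finset.sum_congr rfl fun J _ => ?_
  congr 1
  rw [Complex.re_ofReal_mul]
  congr 1
  change inner ℝ (coeffs β k J) (coeffs α k I) = _
  rw [Complex.inner]
  simp

theorem re_covectorInner (G : E →L[ℝ] E →L[ℝ] ℝ) (α β : CovectorAlgebra E) :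
    (covectorInner G α β).re = ∑ k ∈ Finset.range (Module.finrank ℝ E + 1),
      degreePairing (gram G)⁻¹ k (β k) (α k) := by
  simp only [covectorInner, Complex.re_sum, degreePairing_apply]

/-- Definiteness gives injectivity, and a finite-dimensional space has the dimension of its dual.
The inverse turns the functional produced by integration by parts into a form. -/
theorem degreePairing_isInvertible {G : E →L[ℝ] E →L[ℝ] ℝ} (hG : IsInner G) (k : ℕ) :
    (degreePairing (gram G)⁻¹ k).IsInvertible := by
  have hinj : Function.Injective (degreePairing (gram G)⁻¹ k).toLinearMap := by
    rw [← LinearMap.ker_eq_bot, LinearMap.ker_eq_bot']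
    intro α hα
    obtain ⟨α', hk⟩ : ∃ α' : CovectorAlgebra E, α' k = α :=
      ⟨fun j => if h : j = k then h ▸ α else 0, by simp⟩
    have h1 := degreePairing_apply (gram G)⁻¹ α' α' k
    have h2 : degreePairing (gram G)⁻¹ k α = 0 := hα
    rw [hk, h2, Complex.re_ofReal_mul] at h1
    have h3 : (tensorInner (gram G)⁻¹ (coeffs α' k) (coeffs α' k)).re = 0 := by
      have : ((k.factorial : ℝ)⁻¹) ≠ 0 := by positivity
      exact (mul_eq_zero.1 h1.symm).resolve_left this
    have h4 := tensorInner_definite (gram_posDef hG) h3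
    refine coeffsCLM_injective k ?_
    rw [map_zero, ← h4, ← hk]
    rfl
  have hfin : Module.finrank ℝ (E [⋀^Fin k]→L[ℝ] ℂ) =
      Module.finrank ℝ ((E [⋀^Fin k]→L[ℝ] ℂ) →L[ℝ] ℝ) := by
    rw [← LinearEquiv.finrank_eq (LinearMap.toContinuousLinearMap
      (𝕜 := ℝ) (E := E [⋀^Fin k]→L[ℝ] ℂ) (F' := ℝ))]
    exact (Subspace.dual_finrank_eq (K := ℝ) (V := E [⋀^Fin k]→L[ℝ] ℂ)).symm
  exact ⟨(LinearEquiv.ofInjectiveOfFinrankEq _ hinj hfin).toContinuousLinearEquiv, by ext; rfl⟩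

end RealPairing

/-! ### Integration by parts in a vector space -/

section IntegrationByParts

open Filter Topology MeasureTheory

variable {X : Type*} [NormedAddCommGroup X] [NormedSpace ℝ X] [FiniteDimensional ℝ X]
  [MeasurableSpace X] [BorelSpace X] {μ : Measure X} [μ.IsAddHaarMeasure]

theorem integrable_fderiv_apply {s : X → ℝ} (hs : ContDiff ℝ ∞ s) (hc : HasCompactSupport s)
    (v : X) : Integrable (fun y => fderiv ℝ s y v) μ := by
  refine Continuous.integrable_of_hasCompactSupport
    ((hs.continuous_fderiv (by simp)).clm_apply continuous_const) ?_
  exact (hc.fderiv ℝ).comp_left (g := fun L : X →L[ℝ] ℝ => L v) (by simp)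

theorem integral_fderiv_apply_eq_zero {s : X → ℝ} (hs : ContDiff ℝ ∞ s)
    (hc : HasCompactSupport s) (v : X) : ∫ y, fderiv ℝ s y v ∂μ = 0 := by
  have h := integral_mul_fderiv_eq_neg_fderiv_mul_of_integrable (μ := μ) (f := fun _ : X => (1 : ℝ))
    (g := s) (v := v) (by simp) (by simpa using integrable_fderiv_apply hs hc v)
    (by simpa using hs.continuous.integrable_of_hasCompactSupport hc)
    (fun x _ => differentiableAt_const _) (fun x _ => (hs.differentiable (by simp)) x)
  simpa using h

/-- Integration by parts over an open set, for a functional with compact support. -/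
theorem setIntegral_fderiv_pairing {V : Type*} [NormedAddCommGroup V] [NormedSpace ℝ V] {U K : Set X}
    (hU : IsOpen U) (hK : IsCompact K) (hKU : K ⊆ U) {θ : X → V →L[ℝ] ℝ} {β : X → V}
    (hθ : ContDiffOn ℝ ∞ θ U) (hθK : ∀ y ∈ U, y ∉ K → θ y = 0) (hβ : ContDiffOn ℝ ∞ β U) (v : X) :
    IntegrableOn (fun y => θ y (fderiv ℝ β y v) + fderiv ℝ θ y v (β y)) U μ ∧
      ∫ y in U, (θ y (fderiv ℝ β y v) + fderiv ℝ θ y v (β y)) ∂μ = 0 := by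
  classical
  -- `β` need not have compact support: `θ` vanishes off `K`, so the product extended by zero is
  -- smooth on the whole space, and its directional derivatives integrate to zero.
  let s : X → ℝ := U.indicator fun y => θ y (β y)
  have hsK : ∀ y, y ∉ K → s y = 0 := by
    intro y hy
    by_cases hyU : y ∈ U
    · simp only [s, Set.indicator_of_mem hyU, hθK y hyU hy]
      rfl
    · exact Set.indicator_of_notMem hyU _
  have hsU : ∀ y ∈ U, s =ᶠ[𝓝 y] fun y => θ y (β y) := by
    intro y hy
    filter_upwards [hU.mem_nhds hy] with z hz
    exact Set.indicator_of_mem hz _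
  have hsc : ∀ y, y ∉ U → s =ᶠ[𝓝 y] fun _ => 0 := by
    intro y hy
    filter_upwards [hK.isClosed.isOpen_compl.mem_nhds fun h => hy (hKU h)] with z hz
    exact hsK z hz
  have hs : ContDiff ℝ ∞ s := by
    refine contDiff_iff_contDiffAt.2 fun y => ?_
    by_cases hy : y ∈ U
    · exact ((hθ.contDiffAt (hU.mem_nhds hy)).clm_apply
        (hβ.contDiffAt (hU.mem_nhds hy))).congr_of_eventuallyEq (hsU y hy)
    · exact contDiffAt_const.congr_of_eventuallyEq (hsc y hy)
  have hc : HasCompactSupport s := HasCompactSupport.intro hK hsK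
  have hd : ∀ y ∈ U, fderiv ℝ s y v = θ y (fderiv ℝ β y v) + fderiv ℝ θ y v (β y) := by
    intro y hy
    rw [(hsU y hy).fderiv_eq, fderiv_clm_apply
      ((hθ.contDiffAt (hU.mem_nhds hy)).differentiableAt (by simp))
      ((hβ.contDiffAt (hU.mem_nhds hy)).differentiableAt (by simp))]
    rfl
  have hint := integrable_fderiv_apply (μ := μ) hs hc v
  refine ⟨(hint.integrableOn (s := U)).congr_fun hd hU.measurableSet, ?_⟩
  rw [← setIntegral_congr_fun hU.measurableSet hd,
    setIntegral_eq_integral_of_forall_compl_eq_zero, integral_fderiv_apply_eq_zero hs hc]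
  intro y hy
  rw [(hsc y hy).fderiv_eq]
  simp

end IntegrationByParts

/-! ### Existence of the formal adjoint of `d` on test forms -/

section FormalAdjoint

open Filter Topology MeasureTheory

variable {E : Type*} [NormedAddCommGroup E] [NormedSpace ℂ E] [FiniteDimensional ℂ E]
  {M : Type*} [TopologicalSpace M] [ChartedSpace E M] [IsManifold 𝓘(ℂ, E) ω M]
  {e : OpenPartialHomeomorph M E} (g : HermitianMetric E M)

theorem HermitianMetric.contDiffOn_degreePairing (he : e ∈ atlas E M) (k : ℕ) :
    ContDiffOn ℝ ∞ (fun y => degreePairing (gram (g.inChart e y))⁻¹ k) e.target := by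
  unfold degreePairing
  refine ContDiffOn.sum fun I _ => ContDiffOn.sum fun J _ => ?_
  have h : ContDiffOn ℝ ∞ (fun y => (k.factorial : ℝ)⁻¹ *
      ∏ a, (gram (g.inChart e y))⁻¹ (I a) (J a)) e.target :=
    contDiffOn_const.mul (contDiffOn_prod fun a _ => g.contDiffOn_gram_inv he _ _)
  exact h.smul contDiffOn_const

theorem fderiv_eq_sum_smulRight {k : ℕ} (L : E →L[ℝ] E [⋀^Fin k]→L[ℝ] ℂ) :
    L = ∑ i, (realCoord i).smulRight (L (realBasis E i)) := by
  ext1 v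
  conv_lhs => rw [← sum_realCoord_smul v]
  simp [_root_.sum_apply]

/-- The functional on `k`-forms which, applied to the partial derivative `∂_i β`, gives the
contribution of this derivative to `√det(g) Re h(dβ, w)`. -/
def HermitianMetric.symbolPairing (e : OpenPartialHomeomorph M E) (w : Form E M) (k : ℕ)
    (i : Fin (Module.finrank ℝ E)) (y : E) : (E [⋀^Fin k]→L[ℝ] ℂ) →L[ℝ] ℝ :=
  (g.density e y • degreePairing (gram (g.inChart e y))⁻¹ (k + 1) (w.inChart e y (k + 1))).comp
    ((ContinuousAlternatingMap.alternatizeUncurryFinCLM ℝ E ℂ).comp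
      (ContinuousLinearMap.smulRightL ℝ E (E [⋀^Fin k]→L[ℝ] ℂ) (realCoord i)))

theorem HermitianMetric.contDiffOn_symbolPairing (he : e ∈ atlas E M) {w : Form E M}
    (hw : w.IsSmooth) (k : ℕ) (i : Fin (Module.finrank ℝ E)) :
    ContDiffOn ℝ ∞ (g.symbolPairing e w k i) e.target := by
  have h1 : ContDiffOn ℝ ∞ (fun y => degreePairing (gram (g.inChart e y))⁻¹ (k + 1)
      (w.inChart e y (k + 1))) e.target :=
    (g.contDiffOn_degreePairing he (k + 1)).clm_apply (hw e he (k + 1))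
  have h2 : ContDiffOn ℝ ∞ (fun y => g.density e y • degreePairing (gram (g.inChart e y))⁻¹ (k + 1)
      (w.inChart e y (k + 1))) e.target := (g.contDiffOn_density he).smul h1
  exact h2.clm_comp contDiffOn_const

theorem HermitianMetric.symbolPairing_eq_zero {w : Form E M} {y : E} (hw : w (e.symm y) = 0) (k : ℕ)
    (i : Fin (Module.finrank ℝ E)) : g.symbolPairing e w k i y = 0 := by
  have h : w.inChart e y (k + 1) = 0 := by
    rw [Form.inChart, hw]
    exact congrFun (pullback_zero _) (k + 1)
  ext β
  simp [HermitianMetric.symbolPairing, h]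

theorem HermitianMetric.sum_symbolPairing (w : Form E M) (k : ℕ) (y : E)
    (L : E →L[ℝ] E [⋀^Fin k]→L[ℝ] ℂ) :
    ∑ i, g.symbolPairing e w k i y (L (realBasis E i)) = g.density e y *
      degreePairing (gram (g.inChart e y))⁻¹ (k + 1) (w.inChart e y (k + 1))
        (ContinuousAlternatingMap.alternatizeUncurryFin L) := by
  conv_rhs => rw [fderiv_eq_sum_smulRight L]
  change _ = g.density e y *
    degreePairing (gram (g.inChart e y))⁻¹ (k + 1) (w.inChart e y (k + 1))
      (ContinuousAlternatingMap.alternatizeUncurryFinCLM ℝ E ℂ _)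
  rw [map_sum, map_sum, Finset.mul_sum]
  rfl

/-- The codifferential of `w` in the chart `e`. -/
def HermitianMetric.chartCodifferential (e : OpenPartialHomeomorph M E) (w : Form E M) (y : E) :
    CovectorAlgebra E := fun k =>
  -- Only degrees `k + 1` up to the real dimension enter the inner product, so `d` on forms of top
  -- degree contributes nothing and the codifferential is zero there.
  if k < Module.finrank ℝ E then
    (g.density e y)⁻¹ • (degreePairing (gram (g.inChart e y))⁻¹ k).inverse
      (-∑ i, fderiv ℝ (g.symbolPairing e w k i) y (realBasis E i))
  else 0

theorem HermitianMetric.contDiffOn_chartCodifferential (he : e ∈ atlas E M) {w : Form E M}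
    (hw : w.IsSmooth) (k : ℕ) :
    ContDiffOn ℝ ∞ (fun y => g.chartCodifferential e w y k) e.target := by
  unfold HermitianMetric.chartCodifferential
  split_ifs
  · have h1 : ContDiffOn ℝ ∞ (fun y => (g.density e y)⁻¹) e.target :=
      (g.contDiffOn_density he).inv fun y hy => (g.density_pos he hy).ne'
    have h2 : ContDiffOn ℝ ∞ (fun y =>
        (degreePairing (gram (g.inChart e y))⁻¹ k).inverse) e.target := by
      intro y hy
      exact (degreePairing_isInvertible (g.isInner_inChart he hy) k).contDiffAt_map_inverse
        |>.comp_contDiffWithinAt y (g.contDiffOn_degreePairing he k y hy)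
    have h3 : ContDiffOn ℝ ∞ (fun y =>
        -∑ i, fderiv ℝ (g.symbolPairing e w k i) y (realBasis E i)) e.target := by
      refine (ContDiffOn.sum fun i _ => ?_).neg
      exact ((g.contDiffOn_symbolPairing he hw k i).fderiv_of_isOpen e.open_target
        (by simp)).clm_apply contDiffOn_const
    exact h1.smul (h2.clm_apply h3)
  · exact contDiffOn_const

/-- The codifferential is defined so as to make this true: dividing by the density and applying the
inverse pairing cancels the same two operations on the left. -/
theorem HermitianMetric.re_covectorInner_chartCodifferential (he : e ∈ atlas E M) (w : Form E M)
    {y : E} (hy : y ∈ e.target) (β : CovectorAlgebra E) :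
    g.density e y * (covectorInner (g.inChart e y) β (g.chartCodifferential e w y)).re =
      -∑ k ∈ Finset.range (Module.finrank ℝ E), ∑ i,
        fderiv ℝ (g.symbolPairing e w k i) y (realBasis E i) (β k) := by
  rw [re_covectorInner, Finset.sum_range_succ, mul_add, Finset.mul_sum, ← Finset.sum_neg_distrib]
  have h0 : g.chartCodifferential e w y (Module.finrank ℝ E) = 0 := if_neg (lt_irrefl _)
  rw [h0, map_zero, _root_.zero_apply, mul_zero, add_zero]
  refine Finset.sum_congr rfl fun k hk => ?_
  have h1 : g.chartCodifferential e w y k = (g.density e y)⁻¹ •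
      (degreePairing (gram (g.inChart e y))⁻¹ k).inverse
        (-∑ i, fderiv ℝ (g.symbolPairing e w k i) y (realBasis E i)) :=
    if_pos (Finset.mem_range.1 hk)
  rw [h1, map_smul, (degreePairing_isInvertible (g.isInner_inChart he hy) k).self_apply_inverse]
  simp only [_root_.smul_apply, _root_.neg_apply, _root_.sum_apply, smul_eq_mul]
  rw [mul_inv_cancel_left₀ (g.density_pos he hy).ne']

theorem HermitianMetric.re_covectorInner_extD (he : e ∈ atlas E M) {b : Form E M} (hb : b.IsSmooth)
    (w : Form E M) {y : E} (hy : y ∈ e.target) :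
    g.density e y * (covectorInner (g.inChart e y) (b.extD.inChart e y) (w.inChart e y)).re =
      ∑ k ∈ Finset.range (Module.finrank ℝ E), ∑ i,
        g.symbolPairing e w k i y (fderiv ℝ (fun y => b.inChart e y k) y (realBasis E i)) := by
  rw [re_covectorInner, Finset.sum_range_succ', mul_add, Form.extD_inChart_zero, map_zero, mul_zero,
    add_zero, Finset.mul_sum]
  refine Finset.sum_congr rfl fun k _ => ?_
  rw [Form.extD_inChart_succ hb he k hy, g.sum_symbolPairing]
  rfl

variable [T2Space M] [MeasurableSpace E] [BorelSpace E] [MeasurableSpace M] [BorelSpace M]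

/-- `z` is the image of `w` under the formal adjoint of the exterior derivative. -/
def HermitianMetric.IsCodifferential (w z : Form E M) : Prop :=
  ∀ b : Form E M, b.IsTest ⊤ →
    ∫ x, g.formInner b.extD w x ∂g.vol = ∫ x, g.formInner b z x ∂g.vol

theorem HermitianMetric.integrable_formInner_of_isTest {S T : Submodule ℂ (CovectorAlgebra E)}
    {u v : Form E M} (hu : u.IsTest S) (hv : v.IsTest T) :
    Integrable (g.formInner u v) g.vol := by
  have := g.isLocallyFiniteMeasure_vol
  refine (g.continuous_formInner hu.smooth hv.smooth).integrable_of_hasCompactSupport ?_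
  refine hu.compactSupport.mono fun x hx h => hx ?_
  rw [HermitianMetric.formInner, h, covectorInner_zero_left]

theorem Form.IsTest.smul {S : Submodule ℂ (CovectorAlgebra E)} (c : ℂ) {u : Form E M}
    (hu : u.IsTest S) : (c • u).IsTest S := by
  refine ⟨fun e he k => ?_, hu.compactSupport.mono fun x hx h => hx ?_, fun x => S.smul_mem c (hu.mem x)⟩
  · exact (hu.smooth e he k).const_smul c
  · change c • u x = 0
    rw [h, smul_zero]

/-- Both sides are conjugate linear in `b`, so the real parts for `i b` are the imaginary parts for
`b`. This allows the local computation to be entirely real. -/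
theorem HermitianMetric.isCodifferential_of_re {w z : Form E M} (hw : w.IsTest ⊤) (hz : z.IsTest ⊤)
    (h : ∀ b : Form E M, b.IsTest ⊤ →
      ∫ x, (g.formInner b.extD w x).re ∂g.vol = ∫ x, (g.formInner b z x).re ∂g.vol) :
    g.IsCodifferential w z := by
  have hre : ∀ b : Form E M, b.IsTest ⊤ →
      (∫ x, g.formInner b.extD w x ∂g.vol).re = (∫ x, g.formInner b z x ∂g.vol).re := by
    intro b hb
    have h1 : ∀ {u v : Form E M}, u.IsTest ⊤ → v.IsTest ⊤ →
        (∫ x, g.formInner u v x ∂g.vol).re = ∫ x, (g.formInner u v x).re ∂g.vol :=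
      fun hu hv => (integral_re (g.integrable_formInner_of_isTest hu hv)).symm
    rw [h1 hb.extD hw, h1 hb hz, h b hb]
  intro b hb
  refine Complex.ext (hre b hb) ?_
  have h1 := hre _ (hb.smul Complex.I)
  rw [Form.extD_smul _ hb.smooth, g.formInner_smul_left, g.formInner_smul_left,
    integral_const_mul, integral_const_mul] at h1
  simpa using h1

theorem HermitianMetric.exists_isCodifferential_of_chart (he : e ∈ atlas E M) {w : Form E M}
    (hw : w.IsTest ⊤) (hsupp : tsupport w ⊆ e.source) :
    ∃ z : Form E M, z.IsTest ⊤ ∧ g.IsCodifferential w z := by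
  have hK : IsCompact (e '' tsupport w) :=
    hw.compactSupport.isCompact.image_of_continuousOn (e.continuousOn.mono hsupp)
  have hKt : e '' tsupport w ⊆ e.target := by
    rintro _ ⟨x, hx, rfl⟩
    exact e.map_source (hsupp hx)
  have hw0 : ∀ y ∈ e.target, y ∉ e '' tsupport w → w (e.symm y) = 0 := by
    intro y hy hyK
    by_contra h
    exact hyK ⟨e.symm y, subset_closure h, e.right_inv hy⟩
  have hθ0 : ∀ k i, ∀ y ∈ e.target, y ∉ e '' tsupport w → g.symbolPairing e w k i y = 0 :=
    fun k i y hy hyK => g.symbolPairing_eq_zero (hw0 y hy hyK) k i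
  have hζ0 : ∀ y ∈ e.target, y ∉ e '' tsupport w → g.chartCodifferential e w y = 0 := by
    intro y hy hyK
    funext k
    have h1 : ∀ i, fderiv ℝ (g.symbolPairing e w k i) y = 0 := by
      intro i
      have : g.symbolPairing e w k i =ᶠ[𝓝 y] fun _ => 0 := by
        filter_upwards [e.open_target.mem_nhds hy, hK.isClosed.isOpen_compl.mem_nhds hyK]
          with y' hy' hyK'
        exact hθ0 k i y' hy' hyK'
      rw [this.fderiv_eq]
      simp
    simp [HermitianMetric.chartCodifferential, h1]
  obtain ⟨z, hz, hze, hz0⟩ := exists_isTest_inChart_eq he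
    (g.contDiffOn_chartCodifferential he hw.smooth) hK hKt hζ0
  refine ⟨z, hz, g.isCodifferential_of_re hw hz fun b hb => ?_⟩
  have hcont : ∀ {u v : Form E M}, u.IsSmooth → v.IsSmooth →
      Continuous fun x => (g.formInner u v x).re :=
    fun hu hv => Complex.continuous_re.comp (g.continuous_formInner hu hv)
  rw [g.integral_eq_of_support he (hcont hb.extD.smooth hw.smooth),
    g.integral_eq_of_support he (hcont hb.smooth hz.smooth)]
  rotate_left
  · intro x hx
    rw [HermitianMetric.formInner, hz0 x hx, covectorInner_zero_right, Complex.zero_re]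
  · intro x hx
    rw [HermitianMetric.formInner, image_eq_zero_of_notMem_tsupport fun h => hx (hsupp h),
      covectorInner_zero_right, Complex.zero_re]
  have hparts := fun k i => setIntegral_fderiv_pairing (μ := (realBasis E).addHaar)
    e.open_target hK hKt (g.contDiffOn_symbolPairing he hw.smooth k i) (hθ0 k i)
    (hb.smooth e he k) (realBasis E i)
  have hloc : ∀ {u v : Form E M}, ∀ y ∈ e.target, g.formInner u v (e.symm y) =
      covectorInner (g.inChart e y) (u.inChart e y) (v.inChart e y) := by
    intro u v y hy
    rw [g.formInner_eq u v he (e.map_target hy), e.right_inv hy]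
  -- The two integrands differ by a sum of directional derivatives of compactly supported functions,
  -- whose integrals vanish by `hparts`.
  have hpt : ∀ y ∈ e.target, g.density e y • (g.formInner b.extD w (e.symm y)).re =
      g.density e y • (g.formInner b z (e.symm y)).re +
      ∑ k ∈ Finset.range (Module.finrank ℝ E), ∑ i,
        (g.symbolPairing e w k i y (fderiv ℝ (fun y => b.inChart e y k) y (realBasis E i)) +
          fderiv ℝ (g.symbolPairing e w k i) y (realBasis E i) (b.inChart e y k)) := by
    intro y hy
    rw [hloc y hy, hloc y hy, hze y hy, smul_eq_mul, smul_eq_mul,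
      g.re_covectorInner_chartCodifferential he w hy, g.re_covectorInner_extD he hb.smooth w hy]
    simp only [Finset.sum_add_distrib]
    ring
  rw [setIntegral_congr_fun e.open_target.measurableSet hpt]
  have hD : IntegrableOn (fun y => ∑ k ∈ Finset.range (Module.finrank ℝ E), ∑ i,
        (g.symbolPairing e w k i y (fderiv ℝ (fun y => b.inChart e y k) y (realBasis E i)) +
          fderiv ℝ (g.symbolPairing e w k i) y (realBasis E i) (b.inChart e y k))) e.target
      (realBasis E).addHaar :=
    integrable_finsetSum _ fun k _ => integrable_finsetSum _ fun i _ => (hparts k i).1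
  have hD0 : ∫ y in e.target, ∑ k ∈ Finset.range (Module.finrank ℝ E), ∑ i,
        (g.symbolPairing e w k i y (fderiv ℝ (fun y => b.inChart e y k) y (realBasis E i)) +
          fderiv ℝ (g.symbolPairing e w k i) y (realBasis E i) (b.inChart e y k))
      ∂(realBasis E).addHaar = 0 := by
    rw [integral_finsetSum _ fun k _ => integrable_finsetSum _ fun i _ => (hparts k i).1]
    refine Finset.sum_eq_zero fun k _ => ?_
    rw [integral_finsetSum _ fun i _ => (hparts k i).1]
    exact Finset.sum_eq_zero fun i _ => (hparts k i).2
  -- If this function were not integrable, its sum with the integrable remainder would not be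
  -- either, and both integrals would be `0` by convention.
  by_cases hQ : IntegrableOn (fun y => g.density e y • (g.formInner b z (e.symm y)).re) e.target
      (realBasis E).addHaar
  · rw [integral_add hQ hD, hD0, add_zero]
  · rw [integral_undef hQ, integral_undef]
    intro h
    refine hQ ((h.sub hD).congr ?_)
    exact Eventually.of_forall fun y => by simp

theorem HermitianMetric.IsCodifferential.add {w w' z z' : Form E M} (hw : w.IsTest ⊤)
    (hw' : w'.IsTest ⊤) (hz : z.IsTest ⊤) (hz' : z'.IsTest ⊤) (h : g.IsCodifferential w z)
    (h' : g.IsCodifferential w' z') : g.IsCodifferential (w + w') (z + z') := by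
  intro b hb
  rw [g.formInner_add_right, g.formInner_add_right]
  simp only [Pi.add_apply]
  rw [integral_add (g.integrable_formInner_of_isTest hb.extD hw)
      (g.integrable_formInner_of_isTest hb.extD hw'),
    integral_add (g.integrable_formInner_of_isTest hb hz)
      (g.integrable_formInner_of_isTest hb hz'), h b hb, h' b hb]

theorem Form.IsTest.real_smul {S : Submodule ℂ (CovectorAlgebra E)} {f : M → ℝ}
    (hf : ContMDiff 𝓘(ℝ, E) 𝓘(ℝ, ℝ) ∞ f) {u : Form E M} (hu : u.IsTest S) :
    Form.IsTest S fun x => (f x : ℂ) • u x := by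
  refine ⟨fun e he k => ?_, hu.compactSupport.mono fun x hx h => hx ?_,
    fun x => S.smul_mem _ (hu.mem x)⟩
  · have hs : ContMDiffOn 𝓘(ℝ, E) 𝓘(ℝ, E) ∞ e.symm e.target :=
      contMDiffOn_symm_of_mem_maximalAtlas (IsManifold.subset_maximalAtlas he)
    have h1 : ContDiffOn ℝ ∞ (fun y => f (e.symm y)) e.target :=
      contMDiffOn_iff_contDiffOn.1 (hf.comp_contMDiffOn hs)
    refine (h1.smul (hu.smooth e he k)).congr fun y _ => ?_
    ext v
    simp [Form.inChart, pullback]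
  · change (f x : ℂ) • u x = 0
    rw [h, smul_zero]

variable [SecondCountableTopology M]

/-- The exterior derivative has a formal adjoint on smooth compactly supported forms. -/
theorem HermitianMetric.exists_isCodifferential {w : Form E M} (hw : w.IsTest ⊤) :
    ∃ z : Form E M, z.IsTest ⊤ ∧ g.IsCodifferential w z := by
  classical
  have : ProperSpace E := FiniteDimensional.proper ℝ E
  have : LocallyCompactSpace M := ChartedSpace.locallyCompactSpace E M
  obtain ⟨f, hf⟩ := SmoothPartitionOfUnity.exists_isSubordinate_chartAt_source 𝓘(ℝ, E) M
  -- Only finitely many members of the partition of unity meet the support of `w`, so `w` is a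
  -- finite sum of test forms supported in chart domains.
  have hfin := f.locallyFinite.finite_nonempty_inter_compact hw.compactSupport.isCompact
  have hfw : ∀ i, Form.IsTest (⊤ : Submodule ℂ (CovectorAlgebra E)) fun x => (f i x : ℂ) • w x :=
    fun i => hw.real_smul (f i).contMDiff
  have hsum : w = ∑ i ∈ hfin.toFinset, fun x => (f i x : ℂ) • w x := by
    funext x
    rw [Finset.sum_apply, ← Finset.sum_smul]
    by_cases hx : w x = 0
    · rw [hx, smul_zero]
    · have hxK : x ∈ tsupport w := subset_closure hx
      have h1 : ∑ i ∈ hfin.toFinset, f i x = 1 := by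
        rw [← f.sum_eq_one (Set.mem_univ x), finsum_eq_sum_of_support_subset]
        intro i hi
        simp only [Set.Finite.coe_toFinset, Set.mem_ofPred_eq]
        exact ⟨x, hi, hxK⟩
      rw [← Complex.ofReal_sum, h1, Complex.ofReal_one, one_smul]
  have key : ∀ s : Finset M, ∃ z : Form E M, z.IsTest ⊤ ∧
      Form.IsTest (⊤ : Submodule ℂ (CovectorAlgebra E)) (∑ i ∈ s, fun x => (f i x : ℂ) • w x) ∧
      g.IsCodifferential (∑ i ∈ s, fun x => (f i x : ℂ) • w x) z := by
    intro s
    induction s using Finset.induction_on with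
    | empty =>
      refine ⟨0, Form.isTest_zero, Form.isTest_zero, fun b hb => ?_⟩
      rw [Finset.sum_empty]
      simp only [HermitianMetric.formInner, Pi.zero_apply, covectorInner_zero_right]
    | insert i s hi ih =>
      obtain ⟨z, hz, hs, hzs⟩ := ih
      have hsub : tsupport (fun x => (f i x : ℂ) • w x) ⊆ (chartAt E i).source := by
        have h0 : Function.support (fun x => (f i x : ℂ) • w x) ⊆ Function.support (f i) := by
          intro x hx h
          refine hx ?_
          change (f i x : ℂ) • w x = 0
          rw [h, Complex.ofReal_zero, zero_smul]
        exact (closure_mono h0).trans (hf i)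
      obtain ⟨z', hz', hzi⟩ := g.exists_isCodifferential_of_chart (chart_mem_atlas E i) (hfw i) hsub
      rw [Finset.sum_insert hi]
      exact ⟨z' + z, hz'.add hz, (hfw i).add hs,
        HermitianMetric.IsCodifferential.add g (hfw i) hs hz' hz hzi hzs⟩
  obtain ⟨z, hz, -, h⟩ := key hfin.toFinset
  rw [← hsum] at h
  exact ⟨z, hz, h⟩

end FormalAdjoint

/-! ### Closed images and maps induced on quotients -/

section GraphOperators

variable {X Y : Type*} [NormedAddCommGroup X] [InnerProductSpace ℂ X]
  [NormedAddCommGroup Y] [InnerProductSpace ℂ Y]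

/-- The preimage of `C` under the second projection is a closed subspace of the product, so
containing `G₀` it contains the closure of its span. Inclusions of closed images thus reduce to test
forms. -/
theorem opImClosure_strongExtension_le {G₀ : Set (X × Y)} {C : Submodule ℂ Y}
    (hC : IsClosed (C : Set Y)) (h : ∀ b ∈ G₀, b.2 ∈ C) :
    opImClosure (strongExtension G₀) ≤ C := by
  refine Submodule.topologicalClosure_minimal _ ?_ hC
  rw [Submodule.map_le_iff_le_comap]
  refine Submodule.topologicalClosure_minimal _ (Submodule.span_le.2 h) ?_
  exact hC.preimage continuous_snd

theorem isClosed_opImClosure (G : Submodule ℂ (X × Y)) : IsClosed (opImClosure G : Set Y) :=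
  Submodule.isClosed_topologicalClosure _

theorem snd_mem_opImClosure {G₀ : Set (X × Y)} {b : X × Y} (hb : b ∈ G₀) :
    b.2 ∈ opImClosure (strongExtension G₀) :=
  Submodule.le_topologicalClosure _
    ⟨b, Submodule.le_topologicalClosure _ (Submodule.subset_span hb), rfl⟩

/-- The map between quotients induced by the identity. -/
def cohomologyMap {Z B Z' B' : Submodule ℂ X} (hZ : Z ≤ Z') (hB : B ≤ B') :
    Cohomology Z B →ₗ[ℂ] Cohomology Z' B' :=
  Submodule.mapQ _ _ (Submodule.inclusion hZ) fun _ ha => hB ha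

theorem cohomologyMap_inducedByIdentity {Z B Z' B' : Submodule ℂ X} (hZ : Z ≤ Z') (hB : B ≤ B') :
    InducedByIdentity (cohomologyMap hZ hB) :=
  fun a => ⟨Submodule.inclusion hZ a, rfl, rfl⟩

end GraphOperators

/-! ### Type projections on `L²` and the kernel of a weak extension -/

section L2Forms

open MeasureTheory

variable {E : Type*} [NormedAddCommGroup E] [NormedSpace ℂ E] [FiniteDimensional ℂ E]
  [MeasurableSpace E] [BorelSpace E]
  {M : Type*} [TopologicalSpace M] [ChartedSpace E M] [IsManifold 𝓘(ℂ, E) ω M]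
  [MeasurableSpace M] (g : HermitianMetric E M)

/-- The `L²` pairing of forms. -/
def HermitianMetric.pair (u v : Form E M) : ℂ := ∫ x, g.formInner u v x ∂g.vol

theorem HermitianMetric.formInner_typePart_right {p q : ℤ} {u : Form E M}
    (hu : ∀ x, u x ∈ ofType (E := E) p q) (v : Form E M) :
    g.formInner u (v.typePart p q) = g.formInner u v :=
  funext fun x => covectorInner_typeProj_right (g.isInner x) (g.hermitian x) (hu x) (v x)

theorem HermitianMetric.formInner_typePart_left {p q : ℤ} (u : Form E M) {v : Form E M}
    (hv : ∀ x, v x ∈ ofType (E := E) p q) :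
    g.formInner (u.typePart p q) v = g.formInner u v := by
  funext x
  rw [← g.formInner_conj, g.formInner_typePart_right hv, g.formInner_conj]

theorem HermitianMetric.formInner_eq_zero {p q p' q' : ℤ} (h : (p, q) ≠ (p', q')) {u v : Form E M}
    (hu : ∀ x, u x ∈ ofType (E := E) p q) (hv : ∀ x, v x ∈ ofType (E := E) p' q') :
    g.formInner u v = 0 :=
  funext fun x => covectorInner_eq_zero_of_type (g.isInner x) (g.hermitian x) h (hu x) (hv x)

theorem HermitianMetric.pair_typePart_right {p q : ℤ} {u : Form E M}
    (hu : ∀ x, u x ∈ ofType (E := E) p q) (v : Form E M) :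
    g.pair u (v.typePart p q) = g.pair u v := by
  rw [HermitianMetric.pair, g.formInner_typePart_right hu, HermitianMetric.pair]

theorem HermitianMetric.pair_typePart_left {p q : ℤ} (u : Form E M) {v : Form E M}
    (hv : ∀ x, v x ∈ ofType (E := E) p q) : g.pair (u.typePart p q) v = g.pair u v := by
  rw [HermitianMetric.pair, g.formInner_typePart_left u hv, HermitianMetric.pair]

theorem HermitianMetric.pair_smul_right (c : ℂ) (u v : Form E M) :
    g.pair u (c • v) = c * g.pair u v := by
  rw [HermitianMetric.pair, g.formInner_smul_right, integral_const_mul, HermitianMetric.pair]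

theorem HermitianMetric.pair_zero_left (v : Form E M) : g.pair 0 v = 0 := by
  simp [HermitianMetric.pair, HermitianMetric.formInner, covectorInner_zero_left]

variable [T2Space M] [BorelSpace M] {S T : Submodule ℂ (CovectorAlgebra E)}

theorem HermitianMetric.pair_add_left {u u' v : Form E M} (hu : u.IsTest S) (hu' : u'.IsTest S)
    (hv : v.IsTest T) : g.pair (u + u') v = g.pair u v + g.pair u' v := by
  rw [HermitianMetric.pair, g.formInner_add_left]
  exact integral_add (g.integrable_formInner_of_isTest hu hv)
    (g.integrable_formInner_of_isTest hu' hv)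

variable [SecondCountableTopology M]
variable {g}

theorem Represents.inner_eq {a b : L2 g} {u v : Form E M} (ha : Represents a u)
    (hb : Represents b v) : inner ℂ a b = g.pair u v := by
  obtain ⟨hu, rfl⟩ := ha
  obtain ⟨hv, rfl⟩ := hb
  rfl

theorem Represents.unique {a b : L2 g} {u : Form E M} (ha : Represents a u)
    (hb : Represents b u) : a = b := by
  obtain ⟨_, rfl⟩ := ha
  obtain ⟨_, rfl⟩ := hb
  rfl

theorem Represents.add {a b : L2 g} {u v : Form E M} (ha : Represents a u)
    (hb : Represents b v) : Represents (a + b) (u + v) := by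
  obtain ⟨hu, rfl⟩ := ha
  obtain ⟨hv, rfl⟩ := hb
  exact ⟨(squareIntegrable g).add_mem hu hv, rfl⟩

theorem represents_zero : Represents (0 : L2 g) 0 := ⟨(squareIntegrable g).zero_mem, rfl⟩

theorem Represents.sum {ι : Type*} (s : Finset ι) {a : ι → L2 g} {u : ι → Form E M}
    (h : ∀ i ∈ s, Represents (a i) (u i)) : Represents (∑ i ∈ s, a i) (∑ i ∈ s, u i) := by
  classical
  induction s using Finset.induction_on with
  | empty => exact represents_zero
  | insert i s hi ih =>
    rw [Finset.sum_insert hi, Finset.sum_insert hi]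
    exact (h i (by simp)).add (ih fun j hj => h j (by simp [hj]))

variable (g) in
/-- The class of a smooth compactly supported form. -/
def Form.IsTest.toL2 {u : Form E M} (hu : u.IsTest S) : L2 g :=
  L2.mk (PreL2.ofForm u (hu.mem_squareIntegrable g))

theorem Form.IsTest.represents {u : Form E M} (hu : u.IsTest S) : Represents (hu.toL2 g) u :=
  ⟨hu.mem_squareIntegrable g, rfl⟩

theorem Form.IsTest.mem_testSections {u : Form E M} (hu : u.IsTest S) :
    hu.toL2 g ∈ testSections g S := ⟨u, hu, hu.represents⟩

theorem typePart_mem_squareIntegrable (p q : ℤ) {u : Form E M} (hu : u ∈ squareIntegrable g) :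
    u.typePart p q ∈ squareIntegrable g := by
  refine ⟨hu.1.typePart p q, hu.2.mono
    (g.measurable_formInner (hu.1.typePart p q) (hu.1.typePart p q)).aestronglyMeasurable
    (Filter.Eventually.of_forall fun x => ?_)⟩
  exact norm_covectorInner_typeProj_le (g.isInner x) (g.hermitian x) p q (u x)

variable (g) in
/-- The projection to bidegree `(p, q)` on square-integrable forms. -/
def preL2TypeProj (p q : ℤ) : PreL2 g →L[ℂ] PreL2 g :=
  LinearMap.mkContinuous
    { toFun := fun u => PreL2.ofForm (u.form.typePart p q) (typePart_mem_squareIntegrable p q u.2)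
      map_add' := fun u v => Subtype.ext (Form.typePart_add p q u.form v.form)
      map_smul' := fun c u => Subtype.ext (Form.typePart_smul p q c u.form) } 1 fun u => by
    set v : PreL2 g :=
      PreL2.ofForm (u.form.typePart p q) (typePart_mem_squareIntegrable p q u.2) with hv
    change ‖v‖ ≤ 1 * ‖u‖
    -- Orthogonality of the types gives `‖v‖² = ⟨v, u⟩ ≤ ‖v‖ ‖u‖`.
    have h1 : inner ℂ v v = inner ℂ v u :=
      g.pair_typePart_right (u.form.typePart_mem p q) u.form
    have h2 : ‖v‖ ^ 2 ≤ ‖v‖ * ‖u‖ := by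
      rw [← inner_self_eq_norm_sq (𝕜 := ℂ), h1]
      exact re_inner_le_norm v u
    rw [one_mul]
    by_contra h
    push Not at h
    nlinarith [norm_nonneg u, norm_nonneg v]

variable (g) in
/-- The projection `L²Λ^•_ℂ → L²Λ^{p,q}`. -/
def l2TypeProj (p q : ℤ) : L2 g →L[ℂ] L2 g :=
  SeparationQuotient.liftCLM ((SeparationQuotient.mkCLM ℂ (PreL2 g)).comp (preL2TypeProj g p q))
    fun _ _ h => SeparationQuotient.mk_eq_mk.2 (h.map (preL2TypeProj g p q).continuous)

theorem Represents.l2TypeProj (p q : ℤ) {a : L2 g} {u : Form E M} (ha : Represents a u) :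
    Represents (l2TypeProj g p q a) (u.typePart p q) := by
  obtain ⟨hu, rfl⟩ := ha
  exact ⟨typePart_mem_squareIntegrable p q hu, rfl⟩

theorem l2TypeProj_mem_sections (p q : ℤ) (a : L2 g) :
    l2TypeProj g p q a ∈ sections g (ofType p q) := by
  obtain ⟨u, rfl⟩ := SeparationQuotient.surjective_mk a
  exact ⟨u.form.typePart p q, Represents.l2TypeProj p q ⟨u.2, rfl⟩, u.form.typePart_mem p q⟩

theorem l2TypeProj_of_mem {p q : ℤ} {a : L2 g} (ha : a ∈ sections g (ofType p q)) :
    l2TypeProj g p q a = a := by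
  obtain ⟨u, hu, hu'⟩ := ha
  have h := hu.l2TypeProj p q
  rw [Form.typePart_of_mem hu'] at h
  exact h.unique hu

theorem l2TypeProj_of_mem_ne {p q p' q' : ℤ} (h : (p, q) ≠ (p', q')) {a : L2 g}
    (ha : a ∈ sections g (ofType p' q')) : l2TypeProj g p q a = 0 := by
  obtain ⟨u, hu, hu'⟩ := ha
  have h' := hu.l2TypeProj p q
  rw [Form.typePart_of_mem_ne h hu'] at h'
  exact h'.unique represents_zero

theorem sum_l2TypeProj {k : ℕ} {a : L2 g} (ha : a ∈ sections g (ofDegree k)) :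
    ∑ i ∈ Finset.HasAntidiagonal.antidiagonal k, l2TypeProj g (i.1 : ℤ) (i.2 : ℤ) a = a := by
  obtain ⟨u, hu, hu'⟩ := ha
  have h := Represents.sum (Finset.HasAntidiagonal.antidiagonal k)
    fun i _ => hu.l2TypeProj (i.1 : ℤ) (i.2 : ℤ)
  rw [Form.sum_typePart hu'] at h
  exact h.unique hu

theorem sections_mono (h : S ≤ T) : sections g S ≤ sections g T := by
  rintro a ⟨u, hu, hu'⟩
  exact ⟨u, hu, fun x => h (hu' x)⟩

theorem inner_l2TypeProj {p q : ℤ} (a : L2 g) {z : Form E M} (hz : z.IsTest (ofType p q)) :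
    inner ℂ (l2TypeProj g p q a) (hz.toL2 g) = inner ℂ a (hz.toL2 g) := by
  obtain ⟨u, rfl⟩ := SeparationQuotient.surjective_mk a
  have hu : Represents (SeparationQuotient.mk u : L2 g) u.form := ⟨u.2, rfl⟩
  rw [(hu.l2TypeProj p q).inner_eq hz.represents, g.pair_typePart_left _ hz.mem,
    hu.inner_eq hz.represents]

/-- A section of pure type only sees the component of `z` of that type, so a test form of mixed type
can be replaced by its component. -/
theorem inner_typePart {p q : ℤ} {a : L2 g} (ha : a ∈ sections g (ofType p q)) {z : Form E M}
    (hz : z.IsTest S) :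
    inner ℂ a ((hz.typePart p q).toL2 g) = inner ℂ a (hz.toL2 g) := by
  obtain ⟨u, hu, hu'⟩ := ha
  rw [hu.inner_eq (hz.typePart p q).represents, g.pair_typePart_right hu',
    hu.inner_eq hz.represents]

/-- The kernel of the weak extension is the annihilator of the image of the formal adjoint. -/
theorem mem_opKer_weak_iff {P : Form E M → Form E M}
    (hP : ∀ u : Form E M, u.IsTest S → (P u).IsTest ⊤) {a : L2 g} :
    a ∈ opKer (weak g S T P) ↔ a ∈ sections g S ∧
      ∀ (w z : Form E M) (_ : w.IsTest T) (hz : z.IsTest S),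
        (∀ u : Form E M, u.IsTest S → g.pair (P u) w = g.pair u z) →
          inner ℂ a (hz.toL2 g) = 0 := by
  constructor
  · rintro ⟨h1, -, h3⟩
    refine ⟨h1, fun w z hw hz h => ?_⟩
    have := h3 _ hw.mem_testSections _ hz.mem_testSections ?_
    · exact this.symm.trans (inner_zero_left _)
    · rintro b ⟨u, hu, hb1, hb2⟩
      rw [hb2.inner_eq hw.represents, hb1.inner_eq hz.represents, h u hu]
  · rintro ⟨h1, h3⟩
    refine ⟨h1, Submodule.zero_mem _, ?_⟩
    rintro w ⟨w', hw', hw⟩ z ⟨z', hz', hz⟩ h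
    have := h3 w' z' hw' hz' fun u hu => by
      -- Since `P u` is again a test form, it has a class in `L²`, and the pair of classes lies in
      -- the graph over which `h` quantifies.
      have := h (hu.toL2 g, (hP u hu).toL2 g) ⟨u, hu, hu.represents, (hP u hu).represents⟩
      rwa [(hP u hu).represents.inner_eq hw, hu.represents.inner_eq hz] at this
    rw [hz'.represents.unique hz] at this
    exact (inner_zero_left _).trans this.symm

end L2Forms

/-! ### Comparison of kernels and closed images -/

section Comparison

open MeasureTheory

variable {E : Type*} [NormedAddCommGroup E] [NormedSpace ℂ E] [FiniteDimensional ℂ E]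
  {M : Type*} [TopologicalSpace M] [ChartedSpace E M] [IsManifold 𝓘(ℂ, E) ω M]

/-- `dv` has components only in bidegrees `(a + 1, b)` and `(a, b + 1)`; at most one of them is `(p,
q)`, and it then comes from the matching term on the right. -/
theorem Form.typePart_extD_of_type {a b : ℤ} {v : Form E M} (hv : v.IsTest (ofType a b))
    (p q : ℤ) : v.extD.typePart p q =
      (v.typePart (p - 1) q).extD.typePart p q + (v.typePart p (q - 1)).extD.typePart p q := by
  by_cases h1 : (p - 1, q) = (a, b)
  · obtain ⟨rfl, rfl⟩ := Prod.mk.inj h1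
    rw [Form.typePart_of_mem hv.mem, Form.typePart_of_mem_ne (by simp) hv.mem, Form.extD_zero,
      Form.typePart_zero, add_zero]
  by_cases h2 : (p, q - 1) = (a, b)
  · obtain ⟨rfl, rfl⟩ := Prod.mk.inj h2
    rw [Form.typePart_of_mem hv.mem, Form.typePart_of_mem_ne (by simp) hv.mem, Form.extD_zero,
      Form.typePart_zero, zero_add]
  rw [Form.typePart_of_mem_ne h1 hv.mem, Form.typePart_of_mem_ne h2 hv.mem, Form.extD_zero,
    Form.typePart_zero, add_zero, Form.extD_eq, Form.typePart_add,
    Form.typePart_of_mem_ne _ hv.del.mem, Form.typePart_of_mem_ne _ hv.delbar.mem, add_zero]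
  · intro h
    obtain ⟨rfl, h'⟩ := Prod.mk.inj h
    exact h2 (by rw [h']; simp)
  · intro h
    obtain ⟨h', rfl⟩ := Prod.mk.inj h
    exact h1 (by rw [h']; simp)

/-- `(dα)^{p,q} = ∂ α^{p-1,q} + ∂̄ α^{p,q-1}`. -/
theorem Form.IsTest.typePart_extD {k : ℤ} {u : Form E M} (hu : u.IsTest (ofDegree k)) (p q : ℤ) :
    u.extD.typePart p q = (u.typePart (p - 1) q).del + (u.typePart p (q - 1)).delbar := by
  rw [(hu.typePart (p - 1) q).del_eq, (hu.typePart p (q - 1)).delbar_eq, sub_add_cancel,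
    sub_add_cancel]
  by_cases hk : 0 ≤ k
  · obtain ⟨n, rfl⟩ := Int.eq_ofNat_of_zero_le hk
    have hsum := Form.sum_typePart hu.mem
    generalize hw : (fun i : ℕ × ℕ => u.typePart (i.1 : ℤ) (i.2 : ℤ)) = w
    have hw' : ∀ i, (w i).IsTest (ofType (i.1 : ℤ) (i.2 : ℤ)) := fun i => by
      rw [← hw]; exact hu.typePart _ _
    have hsum' : u = ∑ i ∈ Finset.HasAntidiagonal.antidiagonal n, w i := by
      rw [← hw]; exact hsum.symm
    rw [hsum', Form.extD_sum _ fun i _ => (hw' i).smooth, Form.typePart_sum, Form.typePart_sum,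
      Form.typePart_sum, Form.extD_sum _ fun i _ => ((hw' i).typePart _ _).smooth,
      Form.extD_sum _ fun i _ => ((hw' i).typePart _ _).smooth, Form.typePart_sum,
      Form.typePart_sum, ← Finset.sum_add_distrib]
    exact Finset.sum_congr rfl fun i _ => Form.typePart_extD_of_type (hw' i) p q
  · have h0 : u = 0 := by
      funext x j
      exact hu.mem x j (by omega)
    simp only [h0, Form.extD_zero, Form.typePart_zero, add_zero]

variable [T2Space M] [SecondCountableTopology M] [MeasurableSpace E] [BorelSpace E]
  [MeasurableSpace M] [BorelSpace M] (g : HermitianMetric E M)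

/-- The formal adjoint of `∂`. -/
theorem HermitianMetric.exists_del_adjoint {p q : ℤ} {w : Form E M}
    (hw : w.IsTest (ofType (p + 1) q)) : ∃ z : Form E M, z.IsTest (ofType p q) ∧
      ∀ b : Form E M, b.IsTest (ofType p q) → g.pair b.del w = g.pair b z := by
  obtain ⟨z, hz, h⟩ := g.exists_isCodifferential (hw.mono le_top)
  refine ⟨z.typePart p q, hz.typePart p q, fun b hb => ?_⟩
  rw [hb.del_eq, g.pair_typePart_left _ hw.mem, g.pair_typePart_right hb.mem]
  exact h b (hb.mono le_top)

/-- The formal adjoint of `∂̄`. -/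
theorem HermitianMetric.exists_delbar_adjoint {p q : ℤ} {w : Form E M}
    (hw : w.IsTest (ofType p (q + 1))) : ∃ z : Form E M, z.IsTest (ofType p q) ∧
      ∀ b : Form E M, b.IsTest (ofType p q) → g.pair b.delbar w = g.pair b z := by
  obtain ⟨z, hz, h⟩ := g.exists_isCodifferential (hw.mono le_top)
  refine ⟨z.typePart p q, hz.typePart p q, fun b hb => ?_⟩
  rw [hb.delbar_eq, g.pair_typePart_left _ hw.mem, g.pair_typePart_right hb.mem]
  exact h b (hb.mono le_top)

theorem mem_delZ_iff {p q : ℤ} {a : L2 g} : a ∈ delZ g p q ↔ a ∈ sections g (ofType p q) ∧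
    ∀ (w z : Form E M) (_ : w.IsTest (ofType (p + 1) q)) (hz : z.IsTest (ofType p q)),
      (∀ u : Form E M, u.IsTest (ofType p q) → g.pair u.del w = g.pair u z) →
        inner ℂ a (hz.toL2 g) = 0 :=
  mem_opKer_weak_iff fun _ hu => hu.del.mono le_top

theorem mem_delbarZ_iff {p q : ℤ} {a : L2 g} : a ∈ delbarZ g p q ↔ a ∈ sections g (ofType p q) ∧
    ∀ (w z : Form E M) (_ : w.IsTest (ofType p (q + 1))) (hz : z.IsTest (ofType p q)),
      (∀ u : Form E M, u.IsTest (ofType p q) → g.pair u.delbar w = g.pair u z) →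
        inner ℂ a (hz.toL2 g) = 0 :=
  mem_opKer_weak_iff fun _ hu => hu.delbar.mono le_top

theorem mem_deRhamZ_iff {k : ℤ} {a : L2 g} : a ∈ deRhamZ g k ↔ a ∈ sections g (ofDegree k) ∧
    ∀ (w z : Form E M) (_ : w.IsTest (ofDegree (k + 1))) (hz : z.IsTest (ofDegree k)),
      (∀ u : Form E M, u.IsTest (ofDegree k) → g.pair u.extD w = g.pair u z) →
        inner ℂ a (hz.toL2 g) = 0 :=
  mem_opKer_weak_iff fun _ hu => hu.extD

theorem mem_bottChernZ_iff {p q : ℤ} {a : L2 g} : a ∈ bottChernZ g p q ↔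
    a ∈ sections g (ofType p q) ∧
    ∀ (w z : Form E M) (_ : w.IsTest (ofType (p + 1) q ⊔ ofType p (q + 1)))
      (hz : z.IsTest (ofType p q)),
      (∀ u : Form E M, u.IsTest (ofType p q) → g.pair (u.del + u.delbar) w = g.pair u z) →
        inner ℂ a (hz.toL2 g) = 0 :=
  mem_opKer_weak_iff fun _ hu => (hu.del.mono le_top).add (hu.delbar.mono le_top)

theorem mem_aeppliZ_iff {p q : ℤ} {a : L2 g} : a ∈ aeppliZ g p q ↔
    a ∈ sections g (ofType p q) ∧
    ∀ (w z : Form E M) (_ : w.IsTest (ofType (p + 1) (q + 1))) (hz : z.IsTest (ofType p q)),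
      (∀ u : Form E M, u.IsTest (ofType p q) → g.pair u.delbar.del w = g.pair u z) →
        inner ℂ a (hz.toL2 g) = 0 :=
  mem_opKer_weak_iff fun _ hu => hu.delbar.del.mono le_top

/-- A test form `w` of type `(p + 1, q)` is orthogonal to every `∂̄u`, so `(∂ + ∂̄)^*w = ∂^*w`. -/
theorem bottChernZ_le_delZ (p q : ℤ) : bottChernZ g p q ≤ delZ g p q := by
  intro a ha
  rw [mem_bottChernZ_iff] at ha
  rw [mem_delZ_iff]
  refine ⟨ha.1, fun w z hw hz h => ha.2 w z (hw.mono le_sup_left) hz fun u hu => ?_⟩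
  rw [← h u hu, ← Form.extD_eq, hu.del_eq, g.pair_typePart_left _ hw.mem]

theorem bottChernZ_le_delbarZ (p q : ℤ) : bottChernZ g p q ≤ delbarZ g p q := by
  intro a ha
  rw [mem_bottChernZ_iff] at ha
  rw [mem_delbarZ_iff]
  refine ⟨ha.1, fun w z hw hz h => ha.2 w z (hw.mono le_sup_right) hz fun u hu => ?_⟩
  rw [← h u hu, ← Form.extD_eq, hu.delbar_eq, g.pair_typePart_left _ hw.mem]

/-- For `u` of type `(p, q)`, `du` only sees the `(p + 1, q)` and `(p, q + 1)` components of `w`.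
Hence `(d^*w)^{p,q}` is the adjoint of `∂ + ∂̄` applied to their sum, and `a` is sensitive to this
component alone. -/
theorem bottChernZ_le_deRhamZ (p q : ℤ) : bottChernZ g p q ≤ deRhamZ g (p + q) := by
  intro a ha
  rw [mem_bottChernZ_iff] at ha
  rw [mem_deRhamZ_iff]
  refine ⟨sections_mono (ofType_le_ofDegree p q) ha.1, fun w z hw hz h => ?_⟩
  rw [← inner_typePart ha.1 hz]
  refine ha.2 (w.typePart (p + 1) q + w.typePart p (q + 1)) _
    (((hw.typePart _ _).mono le_sup_left).add ((hw.typePart _ _).mono le_sup_right))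
    (hz.typePart p q) fun u hu => ?_
  rw [g.pair_typePart_right hu.mem, ← h u (hu.mono (ofType_le_ofDegree p q)), Form.extD_eq]
  rw [HermitianMetric.pair, HermitianMetric.pair, g.formInner_add_left, g.formInner_add_left,
    g.formInner_add_right, g.formInner_add_right, g.formInner_typePart_right hu.del.mem,
    g.formInner_typePart_right hu.delbar.mem,
    g.formInner_eq_zero (by simp) hu.del.mem (w.typePart_mem p (q + 1)),
    g.formInner_eq_zero (by simp) hu.delbar.mem (w.typePart_mem (p + 1) q), add_zero, zero_add]

/-- `∂∂̄ = -∂̄∂` gives `(∂∂̄)^*w = ∂^*(-∂̄^*w)`; the test form `-∂̄^*w` is the witness. -/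
theorem delZ_le_aeppliZ (p q : ℤ) : delZ g p q ≤ aeppliZ g p q := by
  intro a ha
  rw [mem_delZ_iff] at ha
  rw [mem_aeppliZ_iff]
  refine ⟨ha.1, fun w z hw hz h => ?_⟩
  obtain ⟨w', hw', hadj⟩ := g.exists_delbar_adjoint hw
  refine ha.2 ((-1 : ℂ) • w') z (hw'.smul _) hz fun u hu => ?_
  have h1 : g.pair (u.del.delbar + u.delbar.del) w = 0 := by
    rw [hu.delbar_del, g.pair_zero_left]
  rw [g.pair_add_left hu.del.delbar hu.delbar.del hw] at h1
  rw [g.pair_smul_right, ← hadj _ hu.del, ← h u hu]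
  linear_combination -h1

/-- Here `(∂∂̄)^*w = ∂̄^*(∂^*w)` directly, without a sign. -/
theorem delbarZ_le_aeppliZ (p q : ℤ) : delbarZ g p q ≤ aeppliZ g p q := by
  intro a ha
  rw [mem_delbarZ_iff] at ha
  rw [mem_aeppliZ_iff]
  refine ⟨ha.1, fun w z hw hz h => ?_⟩
  obtain ⟨w', hw', hadj⟩ := g.exists_del_adjoint hw
  refine ha.2 w' z hw' hz fun u hu => ?_
  rw [← hadj _ hu.delbar, h u hu]

/-- The class `a` is tested against `d^*w'` with `w' = ∂^*w` of type `(p, q + 1)`. In `⟨du, w'⟩`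
only `∂u^{p-1,q+1} + ∂̄u^{p,q}` matters; moving `∂^*` back, the first term vanishes by `∂² = 0` and
the second is `⟨∂∂̄u^{p,q}, w⟩`. -/
theorem l2TypeProj_mem_aeppliZ {k p q : ℤ} (hk : p + q = k) {a : L2 g} (ha : a ∈ deRhamZ g k) :
    l2TypeProj g p q a ∈ aeppliZ g p q := by
  subst hk
  rw [mem_deRhamZ_iff] at ha
  rw [mem_aeppliZ_iff]
  refine ⟨l2TypeProj_mem_sections p q a, fun w z hw hz h => ?_⟩
  obtain ⟨w', hw', hadj⟩ := g.exists_del_adjoint hw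
  rw [inner_l2TypeProj]
  have hdeg : ofType (E := E) p (q + 1) ≤ ofDegree (p + q + 1) := by
    rw [add_assoc]; exact ofType_le_ofDegree p (q + 1)
  refine ha.2 w' z (hw'.mono hdeg) (hz.mono (ofType_le_ofDegree p q)) fun u hu => ?_
  have hd : (u.typePart (p - 1) (q + 1)).del.IsTest (ofType p (q + 1)) := by
    have := (hu.typePart (p - 1) (q + 1)).del
    rwa [sub_add_cancel] at this
  have hdb := (hu.typePart p q).delbar
  rw [← g.pair_typePart_left _ hw'.mem, hu.typePart_extD, add_sub_cancel_right,
    g.pair_add_left hd hdb hw', hadj _ hd |>.symm, hadj _ hdb |>.symm,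
    (hu.typePart (p - 1) (q + 1)).del_del, g.pair_zero_left, zero_add, h _ (hu.typePart p q),
    g.pair_typePart_left _ hz.mem]

theorem bottChernB_le_delB (p q : ℤ) : bottChernB g p q ≤ delB g p q := by
  refine opImClosure_strongExtension_le (isClosed_opImClosure _) ?_
  rintro b ⟨u, hu, -, hb⟩
  have hd : u.delbar.IsTest (ofType (p - 1) q) := by
    have := hu.delbar
    rwa [sub_add_cancel] at this
  exact snd_mem_opImClosure (b := (hd.toL2 g, b.2)) ⟨u.delbar, hd, hd.represents, hb⟩

/-- `∂∂̄u = -∂̄(∂u)`, and the image is closed under negation. -/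
theorem bottChernB_le_delbarB (p q : ℤ) : bottChernB g p q ≤ delbarB g p q := by
  refine opImClosure_strongExtension_le (isClosed_opImClosure _) ?_
  rintro b ⟨u, hu, -, hb⟩
  have hd : u.del.IsTest (ofType p (q - 1)) := by
    have := hu.del
    rwa [sub_add_cancel] at this
  have h1 : hd.delbar.toL2 g ∈ delbarB g p q :=
    snd_mem_opImClosure (b := (hd.toL2 g, hd.delbar.toL2 g))
      ⟨u.del, hd, hd.represents, hd.delbar.represents⟩
  have h2 := (hd.delbar.represents (g := g)).add hb
  rw [hu.delbar_del] at h2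
  rw [eq_neg_of_add_eq_zero_right (h2.unique represents_zero)]
  exact neg_mem h1

/-- `∂∂̄u = d(∂̄u)` because `∂̄² = 0`. -/
theorem bottChernB_le_deRhamB (p q : ℤ) : bottChernB g p q ≤ deRhamB g (p + q) := by
  refine opImClosure_strongExtension_le (isClosed_opImClosure _) ?_
  rintro b ⟨u, hu, -, hb⟩
  have hd : u.delbar.IsTest (ofDegree (p + q - 1)) := by
    have := hu.delbar.mono (ofType_le_ofDegree _ _)
    rwa [show p - 1 + (q - 1 + 1) = p + q - 1 by ring] at this
  have h1 : u.delbar.extD = u.delbar.del := by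
    rw [Form.extD_eq, hu.delbar_delbar, add_zero]
  exact snd_mem_opImClosure (b := (hd.toL2 g, b.2)) ⟨u.delbar, hd, hd.represents, h1 ▸ hb⟩

theorem Form.del_zero : (0 : Form E M).del = 0 := by
  rw [(Form.isTest_zero (S := ofType 0 0)).del_eq, Form.extD_zero, Form.typePart_zero]

theorem Form.delbar_zero : (0 : Form E M).delbar = 0 := by
  rw [(Form.isTest_zero (S := ofType 0 0)).delbar_eq, Form.extD_zero, Form.typePart_zero]

theorem delB_le_aeppliB (p q : ℤ) : delB g p q ≤ aeppliB g p q := by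
  refine opImClosure_strongExtension_le (isClosed_opImClosure _) ?_
  rintro b ⟨u, hu, hb1, hb2⟩
  refine snd_mem_opImClosure (b := (WithLp.toLp 2 (0, b.1), b.2))
    ⟨0, u, Form.isTest_zero, hu, represents_zero, hb1, ?_⟩
  rwa [Form.delbar_zero, zero_add]

theorem delbarB_le_aeppliB (p q : ℤ) : delbarB g p q ≤ aeppliB g p q := by
  refine opImClosure_strongExtension_le (isClosed_opImClosure _) ?_
  rintro b ⟨u, hu, hb1, hb2⟩
  refine snd_mem_opImClosure (b := (WithLp.toLp 2 (b.1, 0), b.2))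
    ⟨u, 0, hu, Form.isTest_zero, hb1, represents_zero, ?_⟩
  rwa [Form.del_zero, add_zero]

/-- By `(du)^{p,q} = ∂̄u^{p,q-1} + ∂u^{p-1,q}` the projection of an exact test form is a generator
of the Aeppli image; continuity of the projection on `L²` handles the closure. -/
theorem l2TypeProj_mem_aeppliB {k : ℤ} (p q : ℤ) {a : L2 g} (ha : a ∈ deRhamB g k) :
    l2TypeProj g p q a ∈ aeppliB g p q := by
  have h : deRhamB g k ≤ (aeppliB g p q).comap (l2TypeProj g p q).toLinearMap := by
    refine opImClosure_strongExtension_le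
      ((isClosed_opImClosure _).preimage (l2TypeProj g p q).continuous) ?_
    rintro b ⟨u, hu, -, hb⟩
    have h1 := hb.l2TypeProj p q
    rw [hu.typePart_extD, add_comm] at h1
    have hd := hu.typePart p (q - 1)
    have hd' := hu.typePart (p - 1) q
    exact snd_mem_opImClosure
      (b := (WithLp.toLp 2 (hd.toL2 g, hd'.toL2 g), l2TypeProj g p q b.2))
      ⟨_, _, hd, hd', hd.represents, hd'.represents, h1⟩
  exact h ha

/-- The map from de Rham to Aeppli cohomology given by the component of bidegree `(p, q)`. -/
def deRhamToAeppliComponent {k p q : ℤ} (hk : p + q = k) :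
    DeRhamCohomology g k →ₗ[ℂ] AeppliCohomology g p q :=
  Submodule.mapQ _ _
    (((l2TypeProj g p q).toLinearMap ∘ₗ (deRhamZ g k).subtype).codRestrict (aeppliZ g p q)
      fun a => l2TypeProj_mem_aeppliZ g hk a.2)
    fun _ ha => l2TypeProj_mem_aeppliB g p q ha

/-- The map from de Rham to total Aeppli cohomology. -/
def deRhamToTotalAeppli (k : ℕ) : DeRhamCohomology g k →ₗ[ℂ] TotalAeppliCohomology g k :=
  LinearMap.pi fun i => deRhamToAeppliComponent g
    (by exact_mod_cast Finset.HasAntidiagonal.mem_antidiagonal.1 i.2)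

theorem deRhamToTotalAeppli_inducedByDecomposition (k : ℕ) :
    InducedByDecomposition g k (deRhamToTotalAeppli g k) := by
  intro a
  refine ⟨fun i => ⟨l2TypeProj g (i.1.1 : ℤ) (i.1.2 : ℤ) a, l2TypeProj_mem_aeppliZ g
    (by exact_mod_cast Finset.HasAntidiagonal.mem_antidiagonal.1 i.2) a.2⟩, ?_, fun i => rfl⟩
  have h := sum_l2TypeProj ((mem_deRhamZ_iff g).1 a.2).1
  exact (Finset.sum_coe_sort (Finset.HasAntidiagonal.antidiagonal k)
    fun i : ℕ × ℕ => l2TypeProj g (i.1 : ℤ) (i.2 : ℤ) (a : L2 g)).trans h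

end Comparison

/-- A map into a product that vanishes in all coordinates but one factors through the
inclusion of that coordinate. -/
theorem eq_single_comp {R N ι : Type*} [Semiring R] [AddCommMonoid N] [Module R N]
    [DecidableEq ι] {φ : ι → Type*} [∀ i, AddCommMonoid (φ i)] [∀ i, Module R (φ i)]
    {f : N →ₗ[R] ∀ i, φ i} (i₀ : ι) {h : N →ₗ[R] φ i₀} (h₀ : ∀ x, f x i₀ = h x)
    (h₁ : ∀ x i, i ≠ i₀ → f x i = 0) : f = LinearMap.single R φ i₀ ∘ₗ h := by
  refine LinearMap.ext fun x => funext fun i => ?_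
  by_cases hi : i = i₀
  · subst hi
    simp [h₀]
  · simp [h₁ x i hi, hi]

end
end L2Hodge

/-! ### The diagram of cohomology maps -/

open L2Hodge in
theorem mainTheorem10
    {E : Type*} [NormedAddCommGroup E] [NormedSpace ℂ E] [FiniteDimensional ℂ E]
    [MeasurableSpace E] [BorelSpace E]
    {M : Type*} [TopologicalSpace M] [T2Space M] [SecondCountableTopology M]
    [MeasurableSpace M] [BorelSpace M]
    [ChartedSpace E M] [IsManifold 𝓘(ℂ, E) ω M]
    (g : L2Hodge.HermitianMetric E M) :
    ∃ (bcToDel : ∀ p q : ℕ,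
        L2Hodge.BottChernCohomology g p q →ₗ[ℂ] L2Hodge.DelCohomology g p q)
      (bcToDelbar : ∀ p q : ℕ,
        L2Hodge.BottChernCohomology g p q →ₗ[ℂ] L2Hodge.DelbarCohomology g p q)
      (bcToDeRham : ∀ p q : ℕ,
        L2Hodge.BottChernCohomology g p q →ₗ[ℂ] L2Hodge.DeRhamCohomology g ((p + q : ℕ) : ℤ))
      (delToAeppli : ∀ p q : ℕ,
        L2Hodge.DelCohomology g p q →ₗ[ℂ] L2Hodge.AeppliCohomology g p q)
      (delbarToAeppli : ∀ p q : ℕ,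
        L2Hodge.DelbarCohomology g p q →ₗ[ℂ] L2Hodge.AeppliCohomology g p q)
      (deRhamToAeppli : ∀ k : ℕ,
        L2Hodge.DeRhamCohomology g k →ₗ[ℂ] L2Hodge.TotalAeppliCohomology g k),
      (∀ p q, L2Hodge.InducedByIdentity (bcToDel p q)) ∧
      (∀ p q, L2Hodge.InducedByIdentity (bcToDelbar p q)) ∧
      (∀ p q, L2Hodge.InducedByIdentity (bcToDeRham p q)) ∧
      (∀ p q, L2Hodge.InducedByIdentity (delToAeppli p q)) ∧
      (∀ p q, L2Hodge.InducedByIdentity (delbarToAeppli p q)) ∧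
      (∀ k, L2Hodge.InducedByDecomposition g k (deRhamToAeppli k)) ∧
      (∀ p q, delToAeppli p q ∘ₗ bcToDel p q = delbarToAeppli p q ∘ₗ bcToDelbar p q) ∧
      (∀ p q, deRhamToAeppli (p + q) ∘ₗ bcToDeRham p q =
        LinearMap.single ℂ
            (fun i : Finset.HasAntidiagonal.antidiagonal (p + q) =>
              L2Hodge.AeppliCohomology g (i.1.1 : ℤ) (i.1.2 : ℤ))
            ⟨(p, q), Finset.HasAntidiagonal.mem_antidiagonal.2 rfl⟩ ∘ₗ
          (delToAeppli p q ∘ₗ bcToDel p q)) := by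
  refine ⟨fun p q => cohomologyMap (bottChernZ_le_delZ g p q) (bottChernB_le_delB g p q),
    fun p q => cohomologyMap (bottChernZ_le_delbarZ g p q) (bottChernB_le_delbarB g p q),
    fun p q => cohomologyMap
      ((bottChernZ_le_deRhamZ g p q).trans_eq (congrArg (deRhamZ g) (Nat.cast_add p q).symm))
      ((bottChernB_le_deRhamB g p q).trans_eq (congrArg (deRhamB g) (Nat.cast_add p q).symm)),
    fun p q => cohomologyMap (delZ_le_aeppliZ g p q) (delB_le_aeppliB g p q),
    fun p q => cohomologyMap (delbarZ_le_aeppliZ g p q) (delbarB_le_aeppliB g p q),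
    deRhamToTotalAeppli g,
    fun p q => cohomologyMap_inducedByIdentity _ _,
    fun p q => cohomologyMap_inducedByIdentity _ _,
    fun p q => cohomologyMap_inducedByIdentity _ _,
    fun p q => cohomologyMap_inducedByIdentity _ _,
    fun p q => cohomologyMap_inducedByIdentity _ _,
    deRhamToTotalAeppli_inducedByDecomposition g, fun p q => ?_, fun p q => ?_⟩
  -- Both composites are the identity on representatives.
  · refine Submodule.linearMap_qext _ (LinearMap.ext fun a => rfl)
  -- A Bott–Chern representative has pure type `(p, q)`: its `(p, q)` component is itself and all
  -- others vanish.
  · refine eq_single_comp _ (fun x => ?_) (fun x i hi => ?_)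
    · obtain ⟨a, rfl⟩ := Submodule.Quotient.mk_surjective _ x
      exact congrArg (Submodule.Quotient.mk (p := (aeppliB g p q).submoduleOf (aeppliZ g p q)))
        (Subtype.ext (l2TypeProj_of_mem ((mem_bottChernZ_iff g).1 a.2).1))
    · obtain ⟨a, rfl⟩ := Submodule.Quotient.mk_surjective _ x
      refine (Submodule.Quotient.mk_eq_zero
        ((aeppliB g i.1.1 i.1.2).submoduleOf (aeppliZ g i.1.1 i.1.2))).2 ?_
      have h0 : l2TypeProj g (i.1.1 : ℤ) (i.1.2 : ℤ) a = 0 := by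
        refine l2TypeProj_of_mem_ne (fun h => hi ?_) ((mem_bottChernZ_iff g).1 a.2).1
        obtain ⟨h1, h2⟩ := Prod.mk.inj h
        exact Subtype.ext (Prod.ext (by exact_mod_cast h1) (by exact_mod_cast h2))
      have h1 : l2TypeProj g (i.1.1 : ℤ) (i.1.2 : ℤ) a ∈ aeppliB g i.1.1 i.1.2 :=
        h0 ▸ zero_mem _
      exact h1
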